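/- \textbf{Setting.} All functions, distributions and generalized functions are real valued. A family $(u_\varepsilon)_{\varepsilon\in(0,1]}$ of smooth functions on $\mathbb R^n$ is \emph{moderate} if for every compact $K$ and every multi-index $\alpha$ there is $p\ge 0$ with $\sup_K|\partial^\alpha u_\varepsilon|=O(\varepsilon^{-p})$ as $\varepsilon\to0$, and \emph{null} if for all $K,\alpha$ and every $q\ge 0$ one has $\sup_K|\partial^\alpha u_\varepsilon|=O(\varepsilon^{q})$. The Colombeau algebra $\mathcal G(\mathbb R^n)$ is the algebra of moderate families modulo the ideal of null families; derivatives, the restriction to $\{t=0\}$ and the superposition $f(u)$ (for smooth $f$ which, with all its derivatives, is of at most polynomial growth) are defined on representatives. Fix $\varphi\in\mathcal S(\mathbb R)$ with $\int\varphi=1$ and $\int x^k\varphi(x)\,dx=0$ for all $k\ge1$, put $\varphi_\varepsilon(x)=\varepsilon^{-1}\varphi(x/\varepsilon)$, and fix a compactly supported smooth function $\chi$ that equals $1$ near $0$. A distribution $a\in\mathcal D'(\mathbb R)$ is embedded in $\mathcal G(\mathbb R)$ as $\iota(a)=$ class of $(a*(\chi\varphi_\varepsilon))_{\varepsilon\in(0,1]}$.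 An element $u\in\mathcal G(\mathbb R^2)$ is \emph{associated} with $T\in\mathcal D'(\mathbb R^2)$ if its representatives satisfy $u_\varepsilon\to T$ in the sense of distributions as $\varepsilon\to0$. \textbf{Proposition.} Let $f:\mathbb R\to\mathbb R$ be smooth, bounded and globally Lipschitz, with all derivatives of at most polynomial growth, and let $a,b\in\mathcal D'(\mathbb R)$ have discrete support. Let $v\in\mathcal D'(\mathbb R^2)$ be the d'Alembert solution $$v(x,t)=\tfrac12\big(a(x-t)+a(x+t)\big)+\tfrac12\int_{x-t}^{x+t}b(y)\,dy$$ of $v_{tt}-v_{xx}=0$, $v(\cdot,0)=a$, $v_t(\cdot,0)=b$. Let $S$ be the singular support of $v$, and let $\mathbf 1_{S^{\mathsf C}}v$ be the function that equals the smooth function $v$ off $S$ and equals $0$ on $S$. Let $w\in C(\mathbb R^2)$ be the continuous weak solution of $$w_{tt}-w_{xx}=f(\mathbf 1_{S^{\mathsf C}}v+w)\ \text{ on }\mathbb R^2,\qquad w(\cdot,0)=0,\quad w_t(\cdot,0)=0 .$$ Let $u\in\mathcal G(\mathbb R^2)$ be the Colombeau solution of $$u_{tt}-u_{xx}=f(u),\qquad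 u(\cdot,0)=\iota(a),\quad u_t(\cdot,0)=\iota(b).$$ Then $u$ is associated with the distribution $v+w$. -/

import Mathlib

open scoped Distributions ContDiff Topology SchwartzMap LineDeriv
open MeasureTheory Filter TopologicalSpace

noncomputable section

namespace DeltaWave

/-! ### Nets, moderate nets, null nets -/

/-- The parameter set `(0, 1]`. -/
abbrev Param : Type := Set.Ioc (0 : ℝ) 1

/-- The filter `ε → 0` on `(0, 1]`. -/
def toZero : Filter Param := comap (fun ε : Param => (ε : ℝ)) (𝓝 0)

/-- A family of smooth functions all of whose derivatives are `O(ε ^ (-p))` on every compact set,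
where `p` may depend on the compact set and on the order of the derivative. -/
def IsModerate {E F : Type*} [NormedAddCommGroup E] [NormedSpace ℝ E]
    [NormedAddCommGroup F] [NormedSpace ℝ F] (u : Param → E → F) : Prop :=
  (∀ ε, ContDiff ℝ ∞ (u ε)) ∧
  ∀ K : Set E, IsCompact K → ∀ k : ℕ, ∃ (p : ℕ) (C : ℝ), ∀ᶠ ε in toZero, ∀ x ∈ K,
    ‖iteratedFDeriv ℝ k (u ε) x‖ ≤ C * (((ε : ℝ) ^ p)⁻¹)

/-- A family of smooth functions all of whose derivatives are `O(ε ^ q)` on every compact set,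
for every `q`. -/
def IsNull {E F : Type*} [NormedAddCommGroup E] [NormedSpace ℝ E]
    [NormedAddCommGroup F] [NormedSpace ℝ F] (u : Param → E → F) : Prop :=
  (∀ ε, ContDiff ℝ ∞ (u ε)) ∧
  ∀ K : Set E, IsCompact K → ∀ k : ℕ, ∀ q : ℕ, ∃ C : ℝ, ∀ᶠ ε in toZero, ∀ x ∈ K,
    ‖iteratedFDeriv ℝ k (u ε) x‖ ≤ C * (ε : ℝ) ^ q

section Bounds

variable {E F : Type*} [NormedAddCommGroup E] [NormedSpace ℝ E]
    [NormedAddCommGroup F] [NormedSpace ℝ F]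

/-- The estimate `O(ε ^ r)` on `K` for the derivatives of order at most `k`. -/
def Bd (u : Param → E → F) (K : Set E) (k : ℕ) (r : ℤ) : Prop :=
  ∃ C : ℝ, 0 ≤ C ∧ ∀ᶠ ε in toZero, ∀ x ∈ K, ∀ i ≤ k, ‖iteratedFDeriv ℝ i (u ε) x‖ ≤ C * (ε : ℝ) ^ r

lemma Bd.congr_order {u : Param → E → F} {K : Set E} {k : ℕ} {r s : ℤ} (h : Bd u K k r)
    (hs : s ≤ r) : Bd u K k s := by
  obtain ⟨C, hC, h⟩ := h
  refine ⟨C, hC, h.mono fun ε h x hx i hi => (h x hx i hi).trans ?_⟩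
  have := ε.2.1
  gcongr C * ?_
  exact zpow_le_zpow_right_of_le_one₀ ε.2.1 ε.2.2 hs

lemma Bd.of_le {u : Param → E → F} {K : Set E} {k j : ℕ} {r : ℤ} (h : Bd u K k r)
    (hj : j ≤ k) : Bd u K j r := by
  obtain ⟨C, hC, h⟩ := h
  exact ⟨C, hC, h.mono fun ε h x hx i hi => h x hx i (hi.trans hj)⟩

lemma Bd.of_forall {u : Param → E → F} {K : Set E} {k : ℕ} {r : ℤ}
    (h : ∀ i ≤ k, ∃ C : ℝ, ∀ᶠ ε in toZero, ∀ x ∈ K,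
      ‖iteratedFDeriv ℝ i (u ε) x‖ ≤ C * (ε : ℝ) ^ r) : Bd u K k r := by
  choose! C h using h
  refine ⟨∑ i ∈ Finset.range (k + 1), |C i|, Finset.sum_nonneg fun _ _ => abs_nonneg _, ?_⟩
  have h' : ∀ᶠ ε in toZero, ∀ i ∈ Finset.range (k + 1), ∀ x ∈ K,
      ‖iteratedFDeriv ℝ i (u ε) x‖ ≤ C i * (ε : ℝ) ^ r := by
    rw [eventually_all_finset]
    intro i hi
    exact h i (by simpa [Nat.lt_succ_iff] using hi)
  refine h'.mono fun ε h x hx i hi => ?_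
  have hi' : i ∈ Finset.range (k + 1) := by simpa [Nat.lt_succ_iff] using hi
  have hε : 0 ≤ (ε : ℝ) ^ r := zpow_nonneg ε.2.1.le r
  refine (h i hi' x hx).trans ?_
  gcongr
  exact (le_abs_self _).trans
    (Finset.single_le_sum (f := fun i => |C i|) (fun _ _ => abs_nonneg _) hi')

lemma IsModerate.bd {u : Param → E → F} (h : IsModerate u) {K : Set E} (hK : IsCompact K) (k : ℕ) :
    ∃ p : ℕ, Bd u K k (-p) := by
  choose p C h using fun i => h.2 K hK i
  refine ⟨(Finset.range (k + 1)).sup p, Bd.of_forall fun i hi => ⟨|C i|, ?_⟩⟩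
  refine (h i).mono fun ε h x hx => (h x hx).trans ?_
  have hi' : i ∈ Finset.range (k + 1) := by simpa [Nat.lt_succ_iff] using hi
  have hp : p i ≤ (Finset.range (k + 1)).sup p := Finset.le_sup hi'
  have h0 := ε.2.1
  rw [← zpow_natCast, ← zpow_neg]
  have : (ε : ℝ) ^ (-(p i : ℤ)) ≤ (ε : ℝ) ^ (-(((Finset.range (k + 1)).sup p : ℕ) : ℤ)) :=
    zpow_le_zpow_right_of_le_one₀ ε.2.1 ε.2.2 (by omega)
  have h1 : 0 ≤ (ε : ℝ) ^ (-(p i : ℤ)) := by positivity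
  exact (mul_le_mul_of_nonneg_right (le_abs_self _) h1).trans
    (mul_le_mul_of_nonneg_left this (abs_nonneg _))

lemma IsNull.bd {u : Param → E → F} (h : IsNull u) {K : Set E} (hK : IsCompact K) (k : ℕ) (q : ℕ) :
    Bd u K k q :=
  Bd.of_forall fun i _ => by simpa using h.2 K hK i q

lemma isModerate_of_bd {u : Param → E → F} (h : ∀ ε, ContDiff ℝ ∞ (u ε))
    (h' : ∀ K : Set E, IsCompact K → ∀ k : ℕ, ∃ p : ℕ, Bd u K k (-p)) : IsModerate u := by
  refine ⟨h, fun K hK k => ?_⟩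
  obtain ⟨p, C, hC, h⟩ := h' K hK k
  refine ⟨p, C, h.mono fun ε h x hx => ?_⟩
  simpa using h x hx k le_rfl

lemma isNull_of_bd {u : Param → E → F} (h : ∀ ε, ContDiff ℝ ∞ (u ε))
    (h' : ∀ K : Set E, IsCompact K → ∀ k q : ℕ, Bd u K k q) : IsNull u := by
  refine ⟨h, fun K hK k q => ?_⟩
  obtain ⟨C, hC, h⟩ := h' K hK k q
  refine ⟨C, h.mono fun ε h x hx => ?_⟩
  simpa using h x hx k le_rfl

lemma Bd.add {u v : Param → E → F} {K : Set E} {k : ℕ} {r : ℤ} (hu : Bd u K k r) (hv : Bd v K k r)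
    (su : ∀ ε, ContDiff ℝ ∞ (u ε)) (sv : ∀ ε, ContDiff ℝ ∞ (v ε)) : Bd (u + v) K k r := by
  obtain ⟨C, hC, hu⟩ := hu
  obtain ⟨D, hD, hv⟩ := hv
  refine ⟨C + D, by positivity, ?_⟩
  filter_upwards [hu, hv] with ε hu hv x hx i hi
  have e : iteratedFDeriv ℝ i ((u + v) ε) x =
      iteratedFDeriv ℝ i (u ε) x + iteratedFDeriv ℝ i (v ε) x := by
    rw [Pi.add_apply, iteratedFDeriv_add_apply]
    · exact ((su ε).of_le (by exact_mod_cast le_top)).contDiffAt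
    · exact ((sv ε).of_le (by exact_mod_cast le_top)).contDiffAt
  rw [e, add_mul]
  exact (norm_add_le _ _).trans (add_le_add (hu x hx i hi) (hv x hx i hi))

lemma Bd.smul {u : Param → E → ℝ} {v : Param → E → F} {K : Set E} {k : ℕ} {r s : ℤ}
    (hu : Bd u K k r) (hv : Bd v K k s)
    (su : ∀ ε, ContDiff ℝ ∞ (u ε)) (sv : ∀ ε, ContDiff ℝ ∞ (v ε)) :
    Bd (fun ε x => u ε x • v ε x) K k (r + s) := by
  obtain ⟨C, hC, hu⟩ := hu
  obtain ⟨D, hD, hv⟩ := hv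
  refine Bd.of_forall fun i hi => ⟨∑ j ∈ Finset.range (i + 1), (i.choose j : ℝ) * C * D, ?_⟩
  filter_upwards [hu, hv] with ε hu hv x hx
  refine (norm_iteratedFDeriv_smul_le (N := ∞) (su ε) (sv ε) x
    (by exact_mod_cast le_top)).trans ?_
  rw [Finset.sum_mul]
  refine Finset.sum_le_sum fun j hj => ?_
  have hj' : j ≤ i := by simpa [Nat.lt_succ_iff] using hj
  have h0 := ε.2.1
  rw [zpow_add₀ h0.ne']
  calc (i.choose j : ℝ) * ‖iteratedFDeriv ℝ j (u ε) x‖ * ‖iteratedFDeriv ℝ (i - j) (v ε) x‖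
      ≤ (i.choose j : ℝ) * (C * (ε : ℝ) ^ r) * (D * (ε : ℝ) ^ s) := by
        gcongr
        · exact hu x hx j (hj'.trans hi)
        · exact hv x hx (i - j) ((Nat.sub_le _ _).trans hi)
    _ = _ := by ring

lemma Bd.fderiv {u : Param → E → F} {K : Set E} {k : ℕ} {r : ℤ} (hu : Bd u K (k + 1) r) :
    Bd (fun ε => fderiv ℝ (u ε)) K k r := by
  obtain ⟨C, hC, hu⟩ := hu
  refine ⟨C, hC, hu.mono fun ε hu x hx i hi => ?_⟩
  rw [norm_iteratedFDeriv_fderiv]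
  exact hu x hx (i + 1) (by omega)

lemma Bd.succ {u : Param → E → F} {K : Set E} {k : ℕ} {r : ℤ} (h0 : Bd u K 0 r)
    (hu : Bd (fun ε => _root_.fderiv ℝ (u ε)) K k r) : Bd u K (k + 1) r := by
  obtain ⟨C, hC, h0⟩ := h0
  obtain ⟨D, hD, hu⟩ := hu
  refine ⟨C + D, by positivity, ?_⟩
  filter_upwards [h0, hu] with ε h0 hu x hx i hi
  have hε : 0 ≤ (ε : ℝ) ^ r := zpow_nonneg ε.2.1.le r
  rcases i with _ | i
  · refine (h0 x hx 0 le_rfl).trans ?_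
    gcongr
    linarith
  · rw [← norm_iteratedFDeriv_fderiv]
    refine (hu x hx i (by omega)).trans ?_
    gcongr
    linarith

lemma contDiff_fderiv_of_top {f : E → F} (h : ContDiff ℝ ∞ f) : ContDiff ℝ ∞ (fderiv ℝ f) :=
  h.fderiv_right (m := ∞) (by simp)

lemma isModerate_add {u v : Param → E → F} (hu : IsModerate u) (hv : IsModerate v) :
    IsModerate (u + v) := by
  refine isModerate_of_bd (fun ε => (hu.1 ε).add (hv.1 ε)) fun K hK k => ?_
  obtain ⟨p, hp⟩ := hu.bd hK k
  obtain ⟨q, hq⟩ := hv.bd hK k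
  exact ⟨p + q, (hp.congr_order (by push_cast; omega)).add (hq.congr_order (by push_cast; omega))
    hu.1 hv.1⟩

lemma isModerate_smul {u : Param → E → ℝ} {v : Param → E → F} (hu : IsModerate u)
    (hv : IsModerate v) : IsModerate (fun ε x => u ε x • v ε x) := by
  refine isModerate_of_bd (fun ε => (hu.1 ε).smul (hv.1 ε)) fun K hK k => ?_
  obtain ⟨p, hp⟩ := hu.bd hK k
  obtain ⟨q, hq⟩ := hv.bd hK k
  refine ⟨p + q, ?_⟩
  have := hp.smul hq hu.1 hv.1
  rwa [show -((p + q : ℕ) : ℤ) = -(p : ℤ) + -(q : ℤ) by push_cast; ring]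

lemma isNull_add {u v : Param → E → F} (hu : IsNull u) (hv : IsNull v) : IsNull (u + v) :=
  isNull_of_bd (fun ε => (hu.1 ε).add (hv.1 ε)) fun _ hK k q =>
    (hu.bd hK k q).add (hv.bd hK k q) hu.1 hv.1

lemma isNull_smul {u : Param → E → ℝ} {v : Param → E → F} (hu : IsModerate u)
    (hv : IsNull v) : IsNull (fun ε x => u ε x • v ε x) := by
  refine isNull_of_bd (fun ε => (hu.1 ε).smul (hv.1 ε)) fun K hK k q => ?_
  obtain ⟨p, hp⟩ := hu.bd hK k
  have := hp.smul (hv.bd hK k (p + q)) hu.1 hv.1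
  simpa using this

lemma isModerate_const (c : Param → F) (C : ℝ) (h : ∀ ε, ‖c ε‖ ≤ C) :
    IsModerate (fun ε (_ : E) => c ε) := by
  refine ⟨fun ε => contDiff_const, fun K hK k => ⟨0, |C|, ?_⟩⟩
  filter_upwards with ε x _
  rcases k with _ | k
  · simpa using (h ε).trans (le_abs_self C)
  · simp [iteratedFDeriv_const_of_ne]

lemma isNull_zero : IsNull (fun _ _ => 0 : Param → E → F) := by
  refine ⟨fun ε => contDiff_const, fun K hK k q => ⟨0, ?_⟩⟩
  filter_upwards with ε x _
  simp

end Bounds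

/-! ### The Colombeau algebra -/

/-- The algebra of moderate families on `E`. -/
def moderate (E : Type*) [NormedAddCommGroup E] [NormedSpace ℝ E] :
    Subalgebra ℝ (Param → E → ℝ) where
  carrier := {u | IsModerate u}
  mul_mem' hu hv := isModerate_smul hu hv
  add_mem' hu hv := isModerate_add hu hv
  algebraMap_mem' c := isModerate_const (fun _ => c) |c| fun _ => le_rfl

/-- The ideal of null families in the algebra of moderate families. -/
def null (E : Type*) [NormedAddCommGroup E] [NormedSpace ℝ E] : Ideal (moderate E) where
  carrier := {u | IsNull (u : Param → E → ℝ)}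
  add_mem' hu hv := isNull_add hu hv
  zero_mem' := isNull_zero
  smul_mem' c _ hu := isNull_smul c.2 hu

/-- The (special) Colombeau algebra on `E`. -/
abbrev Colombeau (E : Type*) [NormedAddCommGroup E] [NormedSpace ℝ E] : Type _ :=
  moderate E ⧸ null E

/-- The class of a moderate family. -/
def Colombeau.mk {E : Type*} [NormedAddCommGroup E] [NormedSpace ℝ E] (r : moderate E) :
    Colombeau E := Ideal.Quotient.mk (null E) r

/-- An operation on moderate families that respects null families induces an operation on the
Colombeau algebras. -/
def Colombeau.map {E E' : Type*} [NormedAddCommGroup E] [NormedSpace ℝ E]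
    [NormedAddCommGroup E'] [NormedSpace ℝ E'] (T : (E → ℝ) → (E' → ℝ))
    (h₁ : ∀ u : Param → E → ℝ, IsModerate u → IsModerate fun ε => T (u ε))
    (h₂ : ∀ u v : Param → E → ℝ, IsModerate u → IsModerate v → IsNull (u - v) →
      IsNull fun ε => T (u ε) - T (v ε)) : Colombeau E → Colombeau E' :=
  Quotient.lift
    (fun r : moderate E => Colombeau.mk ⟨fun ε => T ((r : Param → E → ℝ) ε), h₁ _ r.2⟩)
    (fun r s hrs => Ideal.Quotient.eq.mpr (h₂ _ _ r.2 s.2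
      (Ideal.Quotient.eq.mp (Quotient.sound hrs : Colombeau.mk r = Colombeau.mk s))))

lemma Colombeau.map_mk {E E' : Type*} [NormedAddCommGroup E] [NormedSpace ℝ E]
    [NormedAddCommGroup E'] [NormedSpace ℝ E'] (T : (E → ℝ) → (E' → ℝ))
    (h₁ : ∀ u : Param → E → ℝ, IsModerate u → IsModerate fun ε => T (u ε))
    (h₂ : ∀ u v : Param → E → ℝ, IsModerate u → IsModerate v → IsNull (u - v) →
      IsNull fun ε => T (u ε) - T (v ε)) (r : moderate E) :
    Colombeau.map T h₁ h₂ (Colombeau.mk r) =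
      Colombeau.mk ⟨fun ε => T ((r : Param → E → ℝ) ε), h₁ _ r.2⟩ := rfl

section Operations

variable {E : Type*} [NormedAddCommGroup E] [NormedSpace ℝ E]

lemma Bd.clm_comp {F G : Type*} [NormedAddCommGroup F] [NormedSpace ℝ F]
    [NormedAddCommGroup G] [NormedSpace ℝ G] {u : Param → E → F} {K : Set E} {k : ℕ} {r : ℤ}
    (L : F →L[ℝ] G) (hu : Bd u K k r) (su : ∀ ε, ContDiff ℝ ∞ (u ε)) :
    Bd (fun ε x => L (u ε x)) K k r := by
  obtain ⟨C, hC, hu⟩ := hu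
  refine ⟨‖L‖ * C, by positivity, hu.mono fun ε hu x hx i hi => ?_⟩
  have := L.norm_iteratedFDeriv_comp_left (n := i) (N := ∞) (su ε).contDiffAt (x := x)
    (by exact_mod_cast le_top)
  rw [mul_assoc]
  exact this.trans (by gcongr; exact hu x hx i hi)

lemma IsModerate.pderiv {u : Param → E → ℝ} (hu : IsModerate u) (h : E) :
    IsModerate fun ε x => fderiv ℝ (u ε) x h := by
  refine isModerate_of_bd (fun ε => (contDiff_fderiv_of_top (hu.1 ε)).clm_apply contDiff_const)
    fun K hK k => ?_
  obtain ⟨p, hp⟩ := hu.bd hK (k + 1)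
  exact ⟨p, Bd.clm_comp (ContinuousLinearMap.apply ℝ ℝ h) hp.fderiv
    fun ε => contDiff_fderiv_of_top (hu.1 ε)⟩

lemma IsNull.pderiv {u : Param → E → ℝ} (hu : IsNull u) (h : E) :
    IsNull fun ε x => fderiv ℝ (u ε) x h :=
  isNull_of_bd (fun ε => (contDiff_fderiv_of_top (hu.1 ε)).clm_apply contDiff_const)
    fun _ hK k q => Bd.clm_comp (ContinuousLinearMap.apply ℝ ℝ h) (hu.bd hK (k + 1) q).fderiv
      fun ε => contDiff_fderiv_of_top (hu.1 ε)

/-- The derivative in the direction `h` on the Colombeau algebra. -/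
def Colombeau.pderiv (h : E) : Colombeau E → Colombeau E :=
  Colombeau.map (fun g x => fderiv ℝ g x h) (fun _ hu => hu.pderiv h) fun u v hu hv huv => by
    convert huv.pderiv h using 2 with ε
    ext x
    have a := ((hu.1 ε).differentiable (by simp)) x
    have b := ((hv.1 ε).differentiable (by simp)) x
    simp [fderiv_sub a b]

lemma Bd.comp_right {E' : Type*} [NormedAddCommGroup E'] [NormedSpace ℝ E']
    {u : Param → E → ℝ} {K : Set E'} {k : ℕ} {r : ℤ} (L : E' →L[ℝ] E)
    (hu : Bd u (L '' K) k r) (su : ∀ ε, ContDiff ℝ ∞ (u ε)) :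
    Bd (fun ε x => u ε (L x)) K k r := by
  obtain ⟨C, hC, hu⟩ := hu
  refine Bd.of_forall fun i hi => ⟨‖L‖ ^ i * C, hu.mono fun ε hu x hx => ?_⟩
  have := L.iteratedFDeriv_comp_right (su ε) x (i := i) (by exact_mod_cast le_top)
  change ‖iteratedFDeriv ℝ i (u ε ∘ L) x‖ ≤ _
  rw [this]
  refine (ContinuousMultilinearMap.norm_compContinuousLinearMap_le _ _).trans ?_
  have := hu (L x) ⟨x, hx, rfl⟩ i hi
  calc _ ≤ C * (ε : ℝ) ^ r * ‖L‖ ^ i := by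
        simp only [Finset.prod_const, Finset.card_univ, Fintype.card_fin]; gcongr
    _ = _ := by ring

lemma IsModerate.restrict {u : Param → ℝ × ℝ → ℝ} (hu : IsModerate u) :
    IsModerate fun ε (x : ℝ) => u ε (x, 0) := by
  refine isModerate_of_bd (fun ε => (hu.1 ε).comp (contDiff_prodMk_left 0)) fun K hK k => ?_
  obtain ⟨p, hp⟩ := hu.bd (hK.image (ContinuousLinearMap.inl ℝ ℝ ℝ).continuous) k
  exact ⟨p, Bd.comp_right (ContinuousLinearMap.inl ℝ ℝ ℝ) hp hu.1⟩

lemma IsNull.restrict {u : Param → ℝ × ℝ → ℝ} (hu : IsNull u) :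
    IsNull fun ε (x : ℝ) => u ε (x, 0) := by
  refine isNull_of_bd (fun ε => (hu.1 ε).comp (contDiff_prodMk_left 0)) fun K hK k q => ?_
  exact Bd.comp_right (ContinuousLinearMap.inl ℝ ℝ ℝ)
    (hu.bd (hK.image (ContinuousLinearMap.inl ℝ ℝ ℝ).continuous) k q) hu.1

/-- The restriction of an element of the Colombeau algebra on the `(x, t)`-plane to the line
`t = 0`. -/
def Colombeau.restrict : Colombeau (ℝ × ℝ) → Colombeau ℝ :=
  Colombeau.map (fun g x => g (x, 0)) (fun _ hu => hu.restrict) fun _ _ _ _ huv => huv.restrict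

/-- A smooth function which is, together with all its derivatives, of at most polynomial growth. -/
def IsSlowlyGrowing (f : ℝ → ℝ) : Prop :=
  ContDiff ℝ ∞ f ∧ ∀ k : ℕ, ∃ (m : ℕ) (C : ℝ), ∀ y, |iteratedDeriv k f y| ≤ C * (1 + |y|) ^ m

lemma IsSlowlyGrowing.deriv {f : ℝ → ℝ} (hf : IsSlowlyGrowing f) : IsSlowlyGrowing (deriv f) := by
  refine ⟨(contDiff_infty_iff_deriv.mp hf.1).2, fun k => ?_⟩
  simpa only [iteratedDeriv_succ'] using hf.2 (k + 1)

lemma IsSlowlyGrowing.exists_bound {f : ℝ → ℝ} (hf : IsSlowlyGrowing f) (k : ℕ) :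
    ∃ (m : ℕ) (C : ℝ), 0 ≤ C ∧ ∀ i ≤ k, ∀ y, |iteratedDeriv i f y| ≤ C * (1 + |y|) ^ m := by
  choose m C h using hf.2
  refine ⟨(Finset.range (k + 1)).sup m, ∑ i ∈ Finset.range (k + 1), |C i|,
    Finset.sum_nonneg fun _ _ => abs_nonneg _, fun i hi y => (h i y).trans ?_⟩
  have hi' : i ∈ Finset.range (k + 1) := by simpa [Nat.lt_succ_iff] using hi
  have h1 : C i ≤ ∑ i ∈ Finset.range (k + 1), |C i| := (le_abs_self _).trans
    (Finset.single_le_sum (f := fun i => |C i|) (fun _ _ => abs_nonneg _) hi')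
  have h2 : (1 + |y|) ^ m i ≤ (1 + |y|) ^ (Finset.range (k + 1)).sup m :=
    pow_le_pow_right₀ (by linarith [abs_nonneg y]) (Finset.le_sup hi')
  have h3 : 0 ≤ ∑ i ∈ Finset.range (k + 1), |C i| := Finset.sum_nonneg fun _ _ => abs_nonneg _
  calc _ ≤ (∑ i ∈ Finset.range (k + 1), |C i|) * (1 + |y|) ^ m i := by gcongr
    _ ≤ _ := by gcongr

lemma IsModerate.superpos {f : ℝ → ℝ} (hf : IsSlowlyGrowing f) {u : Param → E → ℝ}
    (hu : IsModerate u) : IsModerate fun ε x => f (u ε x) := by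
  refine isModerate_of_bd (fun ε => hf.1.comp (hu.1 ε)) fun K hK k => ?_
  obtain ⟨p, D, hD, hp⟩ := hu.bd hK k
  obtain ⟨m, C, hC, hf'⟩ := hf.exists_bound k
  refine ⟨p * m + p * k, Bd.of_forall fun i hi => ⟨i.factorial * (C * (1 + D) ^ m) * (1 + D) ^ i,
    hp.mono fun ε hp x hx => ?_⟩⟩
  have h0 := ε.2.1
  have h1 : 1 ≤ (ε : ℝ) ^ (-(p : ℤ)) := one_le_zpow_of_nonpos₀ ε.2.1 ε.2.2 (by simp)
  have hb : ∀ j ≤ k, ‖iteratedFDeriv ℝ j (u ε) x‖ ≤ (1 + D) * (ε : ℝ) ^ (-(p : ℤ)) := fun j hj =>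
    (hp x hx j hj).trans (by gcongr; linarith)
  have h2 : 1 ≤ (1 + D) * (ε : ℝ) ^ (-(p : ℤ)) := by nlinarith
  have hb0 : 1 + |u ε x| ≤ (1 + D) * (ε : ℝ) ^ (-(p : ℤ)) := by
    have := hp x hx 0 (by simp)
    simp only [norm_iteratedFDeriv_zero, Real.norm_eq_abs] at this
    nlinarith
  have key := norm_iteratedFDeriv_comp_le (n := i) (N := ∞) hf.1 (hu.1 ε)
    (by exact_mod_cast le_top) x (C := C * ((1 + D) * (ε : ℝ) ^ (-(p : ℤ))) ^ m)
    (D := (1 + D) * (ε : ℝ) ^ (-(p : ℤ)))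
    (fun j hj => by
      rw [norm_iteratedFDeriv_eq_norm_iteratedDeriv]
      refine (hf' j (hj.trans hi) _).trans ?_
      gcongr)
    (fun j hj hj' => (hb j (hj'.trans hi)).trans (le_self_pow₀ h2 (by omega)))
  refine key.trans ?_
  have e : (ε : ℝ) ^ (-((p * m + p * k : ℕ) : ℤ)) =
      ((ε : ℝ) ^ (-(p : ℤ))) ^ m * ((ε : ℝ) ^ (-(p : ℤ))) ^ k := by
    rw [← zpow_natCast, ← zpow_natCast, ← zpow_mul, ← zpow_mul, ← zpow_add₀ h0.ne']
    congr 1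
    push_cast
    ring
  rw [e, mul_pow, mul_pow]
  have h3 : ((ε : ℝ) ^ (-(p : ℤ))) ^ i ≤ ((ε : ℝ) ^ (-(p : ℤ))) ^ k := pow_le_pow_right₀ h1 hi
  calc _ = (i.factorial * (C * (1 + D) ^ m) * (1 + D) ^ i * ((ε : ℝ) ^ (-(p : ℤ))) ^ m) *
        ((ε : ℝ) ^ (-(p : ℤ))) ^ i := by ring
    _ ≤ (i.factorial * (C * (1 + D) ^ m) * (1 + D) ^ i * ((ε : ℝ) ^ (-(p : ℤ))) ^ m) *
        ((ε : ℝ) ^ (-(p : ℤ))) ^ k := by gcongr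
    _ = _ := by ring

lemma Bd.superpos_zero {f : ℝ → ℝ} (hf : IsSlowlyGrowing f) {u v : Param → E → ℝ}
    (hu : IsModerate u) (hv : IsModerate v) (huv : IsNull (u - v)) {K : Set E} (hK : IsCompact K)
    (q : ℕ) : Bd (fun ε x => f (u ε x) - f (v ε x)) K 0 q := by
  obtain ⟨p, D, hD, hp⟩ := hu.bd hK 0
  obtain ⟨p', D', hD', hp'⟩ := hv.bd hK 0
  obtain ⟨m, C, hC, hf'⟩ := hf.exists_bound 1
  obtain ⟨A, hA, hn⟩ := huv.bd hK 0 (q + (p + p') * m)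
  refine Bd.of_forall fun i hi => ⟨C * (1 + D + D') ^ m * A, ?_⟩
  filter_upwards [hp, hp', hn] with ε hp hp' hn x hx
  obtain rfl : i = 0 := by omega
  have h0 := ε.2.1
  have a1 := hp x hx 0 le_rfl
  have a2 := hp' x hx 0 le_rfl
  have a3 := hn x hx 0 le_rfl
  simp only [norm_iteratedFDeriv_zero, Real.norm_eq_abs, Pi.sub_apply] at a1 a2 a3 ⊢
  set R : ℝ := (1 + D + D') * (ε : ℝ) ^ (-((p + p' : ℕ) : ℤ)) with hR
  have e1 : (ε : ℝ) ^ (-(p : ℤ)) ≤ (ε : ℝ) ^ (-((p + p' : ℕ) : ℤ)) :=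
    zpow_le_zpow_right_of_le_one₀ ε.2.1 ε.2.2 (by push_cast; omega)
  have e2 : (ε : ℝ) ^ (-(p' : ℤ)) ≤ (ε : ℝ) ^ (-((p + p' : ℕ) : ℤ)) :=
    zpow_le_zpow_right_of_le_one₀ ε.2.1 ε.2.2 (by push_cast; omega)
  have e3 : 1 ≤ (ε : ℝ) ^ (-((p + p' : ℕ) : ℤ)) :=
    one_le_zpow_of_nonpos₀ ε.2.1 ε.2.2 (by push_cast; omega)
  have b1 : |u ε x| ≤ R - 1 := by nlinarith
  have b2 : |v ε x| ≤ R - 1 := by nlinarith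
  have hR1 : 1 ≤ R := by nlinarith [abs_nonneg (u ε x)]
  have lip : ‖f (u ε x) - f (v ε x)‖ ≤ C * R ^ m * ‖u ε x - v ε x‖ := by
    refine (convex_Icc (-(R - 1)) (R - 1)).norm_image_sub_le_of_norm_deriv_le (f := f)
      (fun y _ => (hf.1.differentiable (by simp)) y) (fun y hy => ?_)
      (abs_le.mp b2) (abs_le.mp b1)
    have := hf' 1 le_rfl y
    rw [iteratedDeriv_one] at this
    have hy' : |y| ≤ R - 1 := abs_le.mpr hy
    refine this.trans ?_
    gcongr
    linarith
  rw [Real.norm_eq_abs, Real.norm_eq_abs] at lip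
  refine lip.trans ?_
  have e4 : (ε : ℝ) ^ (((q + (p + p') * m : ℕ) : ℤ)) * ((ε : ℝ) ^ (-((p + p' : ℕ) : ℤ))) ^ m =
      (ε : ℝ) ^ (q : ℤ) := by
    rw [← zpow_natCast ((ε : ℝ) ^ (-((p + p' : ℕ) : ℤ))) m, ← zpow_mul, ← zpow_add₀ h0.ne']
    congr 1
    push_cast
    ring
  calc C * R ^ m * |u ε x - v ε x|
      ≤ C * R ^ m * (A * (ε : ℝ) ^ (((q + (p + p') * m : ℕ) : ℤ))) := by
        have : 0 ≤ R := by linarith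
        gcongr
    _ = C * (1 + D + D') ^ m * A *
        ((ε : ℝ) ^ (((q + (p + p') * m : ℕ) : ℤ)) * ((ε : ℝ) ^ (-((p + p' : ℕ) : ℤ))) ^ m) := by
        rw [hR, mul_pow]; ring
    _ = _ := by rw [e4]

lemma Bd.superpos {u v : Param → E → ℝ}
    (hu : IsModerate u) (hv : IsModerate v) (huv : IsNull (u - v)) {K : Set E} (hK : IsCompact K)
    (k : ℕ) : ∀ {f : ℝ → ℝ}, IsSlowlyGrowing f → ∀ q : ℕ,
      Bd (fun ε x => f (u ε x) - f (v ε x)) K k q := by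
  induction k with
  | zero => exact fun hf q => Bd.superpos_zero hf hu hv huv hK q
  | succ k ih =>
    intro f hf q
    refine Bd.succ (Bd.superpos_zero hf hu hv huv hK q) ?_
    have hd := hf.deriv
    have e : (fun ε : Param => _root_.fderiv ℝ (fun x => f (u ε x) - f (v ε x))) =
        (fun ε x => (deriv f (u ε x) - deriv f (v ε x)) • _root_.fderiv ℝ (u ε) x) +
        fun ε x => deriv f (v ε x) • _root_.fderiv ℝ ((u - v) ε) x := by
      funext ε x
      have a := ((hu.1 ε).differentiable (by simp)) x
      have b := ((hv.1 ε).differentiable (by simp)) x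
      have fa := (hf.1.differentiable (by simp)) (u ε x)
      have fb := (hf.1.differentiable (by simp)) (v ε x)
      have h1 := fa.hasDerivAt.comp_hasFDerivAt x a.hasFDerivAt
      have h2 := fb.hasDerivAt.comp_hasFDerivAt x b.hasFDerivAt
      have h3 := (h1.sub h2).fderiv
      have h4 : _root_.fderiv ℝ ((u - v) ε) x =
          _root_.fderiv ℝ (u ε) x - _root_.fderiv ℝ (v ε) x := by
        rw [Pi.sub_apply, fderiv_sub a b]
      simp only [Pi.add_apply]
      rw [h4]
      refine Eq.trans h3 ?_
      module
    rw [e]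
    have su : ∀ ε, ContDiff ℝ ∞ (_root_.fderiv ℝ (u ε)) := fun ε =>
      contDiff_fderiv_of_top (hu.1 ε)
    have sn : ∀ ε, ContDiff ℝ ∞ (_root_.fderiv ℝ ((u - v) ε)) := fun ε =>
      contDiff_fderiv_of_top (huv.1 ε)
    have s1 : ∀ ε : Param, ContDiff ℝ ∞ (fun x => deriv f (u ε x) - deriv f (v ε x)) := fun ε =>
      (hd.1.comp (hu.1 ε)).sub (hd.1.comp (hv.1 ε))
    have s2 : ∀ ε : Param, ContDiff ℝ ∞ (fun x => deriv f (v ε x)) := fun ε =>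
      hd.1.comp (hv.1 ε)
    refine Bd.add ?_ ?_ (fun ε => (s1 ε).smul (su ε)) (fun ε => (s2 ε).smul (sn ε))
    · obtain ⟨p, hp⟩ := hu.bd hK (k + 1)
      have := (ih hd (p + q)).smul hp.fderiv s1 su
      simpa using this
    · obtain ⟨p, hp⟩ := (IsModerate.superpos hd hv).bd hK k
      have := hp.smul (huv.bd hK (k + 1) (p + q)).fderiv s2 sn
      simpa using this

/-- The superposition `f(u)` of a slowly growing smooth function with an element of the Colombeau
algebra. -/
def Colombeau.superpos (f : ℝ → ℝ) (hf : IsSlowlyGrowing f) : Colombeau E → Colombeau E :=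
  Colombeau.map (fun g x => f (g x)) (fun _ hu => hu.superpos hf) fun _ _ hu hv huv =>
    isNull_of_bd (fun ε => (hf.1.comp (hu.1 ε)).sub (hf.1.comp (hv.1 ε)))
      fun _ hK k q => Bd.superpos hu hv huv hK k hf q

end Operations

/-- An element of the Colombeau algebra is associated with the distribution `T` if its
representatives converge to `T` in the sense of distributions. -/
def Colombeau.IsAssociated {E : Type*} [NormedAddCommGroup E] [NormedSpace ℝ E] [MeasureSpace E]
    (u : Colombeau E) (T : 𝓓'((⊤ : Opens E), ℝ)) : Prop :=
  ∀ r : moderate E, Colombeau.mk r = u → ∀ ψ : 𝓓((⊤ : Opens E), ℝ),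
    Tendsto (fun ε => ∫ x, (r : Param → E → ℝ) ε x * ψ x) toZero (𝓝 (T ψ))

/-! ### Distributions -/

section Distributions

/-- A distribution is bounded, on test functions supported in a fixed compact set, by finitely many
sup norms of derivatives. -/
lemma exists_dist_bound {E : Type*} [NormedAddCommGroup E] [NormedSpace ℝ E]
    (a : 𝓓'((⊤ : Opens E), ℝ)) {K : Set E} (hK : IsCompact K) :
    ∃ (N : ℕ) (C : ℝ), 0 ≤ C ∧ ∀ ψ : 𝓓((⊤ : Opens E), ℝ), tsupport ψ ⊆ K → ∀ M : ℝ, 0 ≤ M →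
      (∀ i ≤ N, ∀ x, ‖iteratedFDeriv ℝ i ψ x‖ ≤ M) → |a ψ| ≤ C * M := by
  let K' : Compacts E := ⟨K, hK⟩
  have hK' : (K' : Set E) ⊆ (⊤ : Opens E) := fun _ _ => trivial
  let A : 𝓓_{K'}(E, ℝ) →L[ℝ] ℝ :=
    ContinuousLinearMap.comp (show 𝓓((⊤ : Opens E), ℝ) →L[ℝ] ℝ from a)
      (TestFunction.ofSupportedInCLM ℝ hK')
  obtain ⟨s, C, -, hC⟩ := Seminorm.bound_of_continuous
    (ContDiffMapSupportedIn.withSeminorms ℝ E ℝ ⊤ K') ((normSeminorm ℝ ℝ).comp A.toLinearMap)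
    (continuous_norm.comp A.continuous)
  refine ⟨s.sup id, C, C.2, fun ψ hψ M hM h => ?_⟩
  let ψ' : 𝓓_{K'}(E, ℝ) :=
    .of_support_subset ψ.contDiff ((subset_tsupport _).trans hψ)
  have h1 : A ψ' = a ψ := rfl
  have h2 := hC ψ'
  have h3 : (s.sup fun i => ContDiffMapSupportedIn.seminorm ℝ E ℝ ⊤ K' i) ψ' ≤ M := by
    refine Seminorm.finset_sup_apply_le hM fun i hi => ?_
    rw [ContDiffMapSupportedIn.seminorm_top_le_iff ℝ hM]
    exact fun x _ => h i (Finset.le_sup (f := id) hi) x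
  rw [← h1]
  refine le_trans h2 ?_
  change (C : ℝ) * _ ≤ _
  gcongr

/-- The distribution defined by a locally integrable function. -/
def ofFun {E : Type*} [NormedAddCommGroup E] [NormedSpace ℝ E] [MeasureSpace E]
    [OpensMeasurableSpace E] (g : E → ℝ) : 𝓓'((⊤ : Opens E), ℝ) :=
  (TestFunction.integralAgainstBilinCLM (ContinuousLinearMap.mul ℝ ℝ) volume g :
    𝓓((⊤ : Opens E), ℝ) →L[ℝ] ℝ)

/-- The distribution `T` is given on the open set `U` by the smooth function `g`. -/
def IsSmoothOn {E : Type*} [NormedAddCommGroup E] [NormedSpace ℝ E] [MeasureSpace E]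
    (T : 𝓓'((⊤ : Opens E), ℝ)) (U : Set E) (g : E → ℝ) : Prop :=
  IsOpen U ∧ ContDiffOn ℝ ∞ g U ∧
    ∀ ψ : 𝓓((⊤ : Opens E), ℝ), tsupport ψ ⊆ U → T ψ = ∫ x, g x * ψ x

/-- The singular support of a distribution: the complement of the largest open set on which it is
a smooth function. -/
def singSupp {E : Type*} [NormedAddCommGroup E] [NormedSpace ℝ E] [MeasureSpace E]
    (T : 𝓓'((⊤ : Opens E), ℝ)) : Set E :=
  {x | ¬ ∃ (U : Set E) (g : E → ℝ), x ∈ U ∧ IsSmoothOn T U g}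

open Classical in
/-- The function which is `0` on the singular support of `T` and equals the smooth function `T`
off the singular support. (The value at a point does not depend on the choices made.) -/
def offSingSupp {E : Type*} [NormedAddCommGroup E] [NormedSpace ℝ E] [MeasureSpace E]
    (T : 𝓓'((⊤ : Opens E), ℝ)) (x : E) : ℝ :=
  if h : ∃ (U : Set E) (g : E → ℝ), x ∈ U ∧ IsSmoothOn T U g then h.choose_spec.choose x else 0

end Distributions

/-! ### Convolution and the embedding of distributions on the line -/

section Embedding

/-- The test function `y ↦ θ (x - y)`. -/
def reflect (θ : 𝓓((⊤ : Opens ℝ), ℝ)) (x : ℝ) : 𝓓((⊤ : Opens ℝ), ℝ) where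
  toFun y := θ (x - y)
  contDiff' := θ.contDiff.comp (contDiff_const.sub contDiff_id)
  hasCompactSupport' := θ.hasCompactSupport.comp_homeomorph (Homeomorph.subLeft x)
  tsupport_subset' := fun _ _ => trivial

/-- The convolution `x ↦ ⟨a, θ (x - ·)⟩` of a distribution with a test function. -/
def conv (a : 𝓓'((⊤ : Opens ℝ), ℝ)) (θ : 𝓓((⊤ : Opens ℝ), ℝ)) (x : ℝ) : ℝ := a (reflect θ x)

lemma coe_lineDeriv (θ : 𝓓((⊤ : Opens ℝ), ℝ)) : ⇑(∂_{(1 : ℝ)} θ : 𝓓((⊤ : Opens ℝ), ℝ)) = deriv θ := by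
  funext x
  rw [TestFunction.lineDerivOp_eq_lineDerivCLM ℝ, TestFunction.lineDerivCLM_apply_of_le (by simp)]
  simp [lineDeriv, deriv_comp_const_add]

lemma iteratedDeriv_reflect (θ : 𝓓((⊤ : Opens ℝ), ℝ)) (x : ℝ) (i : ℕ) (y : ℝ) :
    iteratedDeriv i (reflect θ x) y = (-1) ^ i * iteratedDeriv i θ (x - y) := by
  have := congrFun (iteratedDeriv_comp_const_sub i (f := (θ : ℝ → ℝ)) x) y
  simp only [smul_eq_mul] at this
  exact this

lemma exists_bound_iteratedDeriv (θ : 𝓓((⊤ : Opens ℝ), ℝ)) (N : ℕ) :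
    ∃ B : ℝ, 0 ≤ B ∧ ∀ i ≤ N, ∀ z, |iteratedDeriv i θ z| ≤ B := by
  have h : ∀ i : ℕ, ∃ B : ℝ, ∀ z, |iteratedDeriv i θ z| ≤ B := fun i => by
    have h1 : HasCompactSupport (iteratedFDeriv ℝ i θ) := θ.hasCompactSupport.iteratedFDeriv i
    obtain ⟨B, hB⟩ := (θ.contDiff.continuous_iteratedFDeriv (m := i)
      (by exact_mod_cast le_top)).bounded_above_of_compact_support h1
    refine ⟨B, fun z => ?_⟩
    rw [← Real.norm_eq_abs, ← norm_iteratedFDeriv_eq_norm_iteratedDeriv]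
    exact hB z
  choose B hB using h
  have hn : ∀ i, 0 ≤ B i := fun i => (abs_nonneg _).trans (hB i 0)
  refine ⟨∑ i ∈ Finset.range (N + 1), B i, Finset.sum_nonneg fun i _ => hn i, fun i hi z => ?_⟩
  exact (hB i z).trans (Finset.single_le_sum (f := B) (fun i _ => hn i)
    (by simpa [Nat.lt_succ_iff] using hi))

lemma taylor_two {g : ℝ → ℝ} (hg : ContDiff ℝ ∞ g) {B : ℝ}
    (hB : ∀ z, |deriv (deriv g) z| ≤ B) (z h : ℝ) :
    |g (z + h) - g z - h * deriv g z| ≤ B * h ^ 2 := by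
  have hg1 := (contDiff_infty_iff_deriv.mp hg).2
  have l1 : ∀ s : ℝ, |deriv g (z + s) - deriv g z| ≤ B * |s| := fun s => by
    have := convex_univ.norm_image_sub_le_of_norm_deriv_le (f := deriv g) (C := B)
      (fun y _ => (hg1.differentiable (by simp)) y) (fun y _ => hB y)
      (Set.mem_univ z) (Set.mem_univ (z + s))
    simpa using this
  have hB0 : 0 ≤ B := (abs_nonneg _).trans (hB 0)
  have hd : ∀ s : ℝ, HasDerivAt (fun s => g (z + s) - s * deriv g z)
      (deriv g (z + s) - deriv g z) s := fun s => by
    have h1 := ((hg.differentiable (by simp)) (z + s)).hasDerivAt.comp_const_add z s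
    have h2 := (hasDerivAt_id s).mul_const (deriv g z)
    simp only [one_mul] at h2
    exact h1.sub h2
  have := (convex_uIcc 0 h).norm_image_sub_le_of_norm_hasDerivWithin_le
    (f := fun s => g (z + s) - s * deriv g z) (C := B * |h|)
    (fun s _ => (hd s).hasDerivWithinAt) (fun s hs => (l1 s).trans (by
      have := Set.abs_sub_left_of_mem_uIcc hs
      simp only [sub_zero] at this
      gcongr)) Set.left_mem_uIcc Set.right_mem_uIcc
  simp only [Real.norm_eq_abs, add_zero, zero_mul, sub_zero] at this
  calc _ = |g (z + h) - h * deriv g z - g z| := by ring_nf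
    _ ≤ _ := this
    _ = _ := by rw [mul_assoc, ← sq, sq_abs]

lemma tsupport_reflect_subset (θ : 𝓓((⊤ : Opens ℝ), ℝ)) {L : Set ℝ} (hL : IsCompact L) {x : ℝ}
    (hx : x ∈ L) :
    tsupport (reflect θ x) ⊆ (fun p : ℝ × ℝ => p.1 - p.2) '' (L ×ˢ tsupport θ) := by
  have hc : IsCompact ((fun p : ℝ × ℝ => p.1 - p.2) '' (L ×ˢ tsupport θ)) :=
    (hL.prod θ.hasCompactSupport).image (by fun_prop)
  refine closure_minimal (fun y hy => ?_) hc.isClosed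
  exact ⟨(x, x - y), ⟨hx, subset_tsupport _ hy⟩, by simp⟩

lemma hasDerivAt_conv (a : 𝓓'((⊤ : Opens ℝ), ℝ)) (θ : 𝓓((⊤ : Opens ℝ), ℝ)) (x : ℝ) :
    HasDerivAt (conv a θ) (conv a (∂_{(1 : ℝ)} θ) x) x := by
  set L : Set ℝ := Set.Icc (x - 1) (x + 1)
  have hL : IsCompact L := isCompact_Icc
  set K : Set ℝ := (fun p : ℝ × ℝ => p.1 - p.2) '' (L ×ˢ tsupport θ)
  have hK : IsCompact K := (hL.prod θ.hasCompactSupport).image (by fun_prop)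
  obtain ⟨N, C, hC, hb⟩ := exists_dist_bound a hK
  obtain ⟨B, hB, hB'⟩ := exists_bound_iteratedDeriv θ (N + 2)
  rw [hasDerivAt_iff_isLittleO_nhds_zero]
  have hO : (fun h => conv a θ (x + h) - conv a θ x - h • conv a (∂_{(1 : ℝ)} θ) x)
      =O[𝓝 0] fun h : ℝ => h ^ 2 := by
    refine Asymptotics.IsBigO.of_bound (C * B) ?_
    filter_upwards [Icc_mem_nhds (show (-1 : ℝ) < 0 by norm_num) (show (0 : ℝ) < 1 by norm_num)]
      with h hh
    have e : conv a θ (x + h) - conv a θ x - h • conv a (∂_{(1 : ℝ)} θ) x =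
        a (reflect θ (x + h) - reflect θ x - h • reflect (∂_{(1 : ℝ)} θ) x) := by
      simp only [conv, map_sub, map_smul]
    rw [e, Real.norm_eq_abs, Real.norm_eq_abs, abs_of_nonneg (sq_nonneg h), mul_assoc]
    refine hb _ ?_ _ (by positivity) fun i hi y => ?_
    · refine closure_minimal (fun y hy => ?_) hK.isClosed
      by_contra hn
      have t1 : reflect θ (x + h) y = 0 := image_eq_zero_of_notMem_tsupport fun ht => hn
        (tsupport_reflect_subset θ hL (x := x + h)
          ⟨by linarith [hh.1], by linarith [hh.2]⟩ ht)
      have t2 : x - y ∉ tsupport θ := fun ht =>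
        hn ⟨(x, x - y), ⟨⟨by simp, by simp⟩, ht⟩, by simp⟩
      have t3 : reflect θ x y = 0 := image_eq_zero_of_notMem_tsupport (f := (θ : ℝ → ℝ)) t2
      have t4 : reflect (∂_{(1 : ℝ)} θ) x y = 0 := by
        change (∂_{(1 : ℝ)} θ : 𝓓((⊤ : Opens ℝ), ℝ)) (x - y) = 0
        rw [coe_lineDeriv]
        exact image_eq_zero_of_notMem_tsupport fun ht => t2 (tsupport_deriv_subset ht)
      apply hy
      change reflect θ (x + h) y - reflect θ x y - h * reflect (∂_{(1 : ℝ)} θ) x y = 0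
      simp [t1, t3, t4]
    · rw [norm_iteratedFDeriv_eq_norm_iteratedDeriv]
      have c : ∀ φ : 𝓓((⊤ : Opens ℝ), ℝ), ContDiffAt ℝ i φ y := fun φ =>
        (φ.contDiff.of_le (by exact_mod_cast le_top)).contDiffAt
      have e1 : iteratedDeriv i
          (⇑(reflect θ (x + h) - reflect θ x - h • reflect (∂_{(1 : ℝ)} θ) x)) y =
          iteratedDeriv i (reflect θ (x + h)) y - iteratedDeriv i (reflect θ x) y -
            h * iteratedDeriv i (reflect (∂_{(1 : ℝ)} θ) x) y := by
        change iteratedDeriv i ((⇑(reflect θ (x + h)) - ⇑(reflect θ x)) -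
          (fun z => h * reflect (∂_{(1 : ℝ)} θ) x z)) y = _
        have c' : ContDiffAt ℝ i (fun z => h * reflect (∂_{(1 : ℝ)} θ) x z) y :=
          contDiffAt_const.mul (c _)
        have c'' : ContDiffAt ℝ i (⇑(reflect θ (x + h)) - ⇑(reflect θ x)) y := (c _).sub (c _)
        rw [iteratedDeriv_sub c'' c',
          iteratedDeriv_sub (c _) (c _), iteratedDeriv_const_mul_field]
      have e2 : iteratedDeriv i (∂_{(1 : ℝ)} θ : 𝓓((⊤ : Opens ℝ), ℝ)) = deriv (iteratedDeriv i θ) := by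
        rw [coe_lineDeriv, ← iteratedDeriv_succ', iteratedDeriv_succ]
      rw [e1, iteratedDeriv_reflect, iteratedDeriv_reflect, iteratedDeriv_reflect, e2]
      have hs : ContDiff ℝ ∞ (iteratedDeriv i θ) := by
        rw [iteratedDeriv_eq_iterate]
        exact (θ.contDiff : ContDiff ℝ ∞ θ).iterate_deriv i
      have hT := taylor_two hs (B := B) (fun z => by
        rw [← iteratedDeriv_succ, ← iteratedDeriv_succ]
        exact hB' _ (by omega) z) (x - y) h
      calc _ = |(-1) ^ i * (iteratedDeriv i θ (x - y + h) - iteratedDeriv i θ (x - y) -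
            h * deriv (iteratedDeriv i θ) (x - y))| := by
            rw [Real.norm_eq_abs]
            congr 1
            rw [show x + h - y = x - y + h by ring]
            ring
        _ ≤ _ := by
            rw [abs_mul, abs_pow, abs_neg, abs_one, one_pow, one_mul]
            exact hT
  refine hO.trans_isLittleO ?_
  simpa using Asymptotics.isLittleO_pow_id (𝕜 := ℝ) (n := 2) (by norm_num)

lemma contDiff_conv (a : 𝓓'((⊤ : Opens ℝ), ℝ)) (θ : 𝓓((⊤ : Opens ℝ), ℝ)) :
    ContDiff ℝ ∞ (conv a θ) := by
  rw [contDiff_infty]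
  intro n
  induction n generalizing θ with
  | zero =>
    exact contDiff_zero.mpr (continuous_iff_continuousAt.mpr
      fun x => (hasDerivAt_conv a θ x).continuousAt)
  | succ n ih =>
    have h : deriv (conv a θ) = conv a (∂_{(1 : ℝ)} θ) :=
      funext fun x => (hasDerivAt_conv a θ x).deriv
    push_cast
    refine contDiff_succ_iff_deriv.mpr
      ⟨fun x => (hasDerivAt_conv a θ x).differentiableAt, by simp, ?_⟩
    rw [h]
    exact ih _

lemma iteratedDeriv_conv (a : 𝓓'((⊤ : Opens ℝ), ℝ)) (k : ℕ) (θ : 𝓓((⊤ : Opens ℝ), ℝ)) :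
    iteratedDeriv k (conv a θ) = conv a ((fun η => ∂_{(1 : ℝ)} η)^[k] θ) := by
  induction k generalizing θ with
  | zero => rfl
  | succ k ih =>
    have h : deriv (conv a θ) = conv a (∂_{(1 : ℝ)} θ) :=
      funext fun x => (hasDerivAt_conv a θ x).deriv
    rw [iteratedDeriv_succ', h, ih, Function.iterate_succ_apply]

lemma coe_iterate_lineDeriv (k : ℕ) (θ : 𝓓((⊤ : Opens ℝ), ℝ)) :
    ⇑((fun η => ∂_{(1 : ℝ)} η)^[k] θ) = iteratedDeriv k θ := by
  induction k generalizing θ with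
  | zero => rfl
  | succ k ih => rw [Function.iterate_succ_apply, ih, coe_lineDeriv, iteratedDeriv_succ']

/-- The cut off and rescaled mollifier `x ↦ χ(x) ε⁻¹ φ(x / ε)`. -/
def cutMollifier (φ : 𝓢(ℝ, ℝ)) (χ : 𝓓((⊤ : Opens ℝ), ℝ)) (ε : Param) : 𝓓((⊤ : Opens ℝ), ℝ) where
  toFun x := χ x * ((ε : ℝ)⁻¹ * φ (x / ε))
  contDiff' := χ.contDiff.mul (contDiff_const.mul
    ((φ.smooth ⊤).comp (contDiff_id.div_const _)))
  hasCompactSupport' := χ.hasCompactSupport.mul_right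
  tsupport_subset' := fun _ _ => trivial

lemma isModerate_cutMollifier (φ : 𝓢(ℝ, ℝ)) (χ : 𝓓((⊤ : Opens ℝ), ℝ)) :
    IsModerate fun ε => (cutMollifier φ χ ε : ℝ → ℝ) := by
  have h1 : IsModerate fun (_ : Param) => (χ : ℝ → ℝ) := by
    refine ⟨fun _ => χ.contDiff, fun K hK k => ?_⟩
    obtain ⟨B, -, hB⟩ := exists_bound_iteratedDeriv χ k
    refine ⟨0, B, ?_⟩
    filter_upwards with ε x _
    rw [norm_iteratedFDeriv_eq_norm_iteratedDeriv]
    simpa using hB k le_rfl x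
  have h2 : IsModerate fun (ε : Param) (x : ℝ) => (ε : ℝ)⁻¹ * φ ((ε : ℝ)⁻¹ * x) := by
    refine ⟨fun ε => contDiff_const.mul ((φ.smooth ⊤).comp (contDiff_const.mul contDiff_id)),
      fun K hK k => ?_⟩
    obtain ⟨B, hB⟩ := φ.decay 0 k
    refine ⟨k + 1, B, ?_⟩
    filter_upwards with ε x _
    have h0 := ε.2.1
    rw [norm_iteratedFDeriv_eq_norm_iteratedDeriv, iteratedDeriv_const_mul_field,
      iteratedDeriv_comp_const_mul ((φ.smooth ⊤).of_le (by exact_mod_cast le_top))]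
    have := hB.2 ((ε : ℝ)⁻¹ * x)
    rw [pow_zero, one_mul, norm_iteratedFDeriv_eq_norm_iteratedDeriv] at this
    rw [norm_mul, norm_mul, norm_pow, norm_inv, Real.norm_of_nonneg h0.le]
    calc _ = ‖iteratedDeriv k φ ((ε : ℝ)⁻¹ * x)‖ * (((ε : ℝ) ^ (k + 1))⁻¹) := by
          rw [pow_succ, mul_inv, inv_pow]; ring
      _ ≤ _ := by gcongr
  have := isModerate_smul h1 h2
  convert this using 3 with ε x
  change χ x * ((ε : ℝ)⁻¹ * φ (x / ε)) = _
  rw [smul_eq_mul, div_eq_inv_mul]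

lemma isModerate_conv (φ : 𝓢(ℝ, ℝ)) (χ : 𝓓((⊤ : Opens ℝ), ℝ)) (a : 𝓓'((⊤ : Opens ℝ), ℝ)) :
    IsModerate fun ε => conv a (cutMollifier φ χ ε) := by
  refine ⟨fun ε => contDiff_conv a _, fun L hL k => ?_⟩
  set K : Set ℝ := (fun p : ℝ × ℝ => p.1 - p.2) '' (L ×ˢ tsupport χ)
  have hK : IsCompact K := (hL.prod χ.hasCompactSupport).image (by fun_prop)
  obtain ⟨N, C, hC, hb⟩ := exists_dist_bound a hK
  obtain ⟨p, D, hD, hp⟩ := (isModerate_cutMollifier φ χ).bd χ.hasCompactSupport (N + k)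
  refine ⟨p, C * D, hp.mono fun ε hp x hx => ?_⟩
  have h0 := ε.2.1
  rw [norm_iteratedFDeriv_eq_norm_iteratedDeriv, iteratedDeriv_conv, Real.norm_eq_abs, mul_assoc]
  set θ := cutMollifier φ χ ε
  have hsupp : tsupport θ ⊆ tsupport χ := closure_mono (Function.support_mul_subset_left _ _)
  have hd : ∀ j, ∀ z, z ∉ tsupport χ → iteratedDeriv j θ z = 0 := fun j z hz => by
    rw [← norm_eq_zero, ← norm_iteratedFDeriv_eq_norm_iteratedDeriv, norm_eq_zero]
    exact image_eq_zero_of_notMem_tsupport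
      fun h => hz (hsupp (tsupport_iteratedFDeriv_subset j h))
  refine hb _ ?_ _ (by positivity) fun i hi y => ?_
  · refine closure_minimal (fun y hy => ?_) hK.isClosed
    by_contra hn
    apply hy
    change ((fun η => ∂_{(1 : ℝ)} η)^[k] θ) (x - y) = 0
    rw [coe_iterate_lineDeriv]
    exact hd k _ fun h => hn ⟨(x, x - y), ⟨hx, h⟩, by simp⟩
  · rw [norm_iteratedFDeriv_eq_norm_iteratedDeriv, iteratedDeriv_reflect, coe_iterate_lineDeriv,
      norm_mul, norm_pow, norm_neg, norm_one, one_pow, one_mul]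
    have e : iteratedDeriv i (iteratedDeriv k θ) = iteratedDeriv (i + k) θ := by
      simp only [iteratedDeriv_eq_iterate, Function.iterate_add_apply]
    rw [e]
    by_cases hz : x - y ∈ tsupport χ
    · have := hp _ hz (i + k) (by omega)
      rw [norm_iteratedFDeriv_eq_norm_iteratedDeriv] at this
      simpa using this
    · rw [hd _ _ hz, norm_zero]
      positivity

/-- The embedding of the distributions on the line into the Colombeau algebra, by convolution with
the mollifiers `χ φ_ε`, where `φ_ε(x) = ε⁻¹ φ(x / ε)`. -/
def embed (φ : 𝓢(ℝ, ℝ)) (χ : 𝓓((⊤ : Opens ℝ), ℝ)) (a : 𝓓'((⊤ : Opens ℝ), ℝ)) : Colombeau ℝ :=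
  Colombeau.mk ⟨fun ε => conv a (cutMollifier φ χ ε), isModerate_conv φ χ a⟩

end Embedding
/-! ### The solution of the linear wave equation with distributional data -/

section Linear

/-- The space of test functions on the `(x, t)`-plane. -/
abbrev PlaneTest : Type := 𝓓((⊤ : Opens (ℝ × ℝ)), ℝ)

variable {Θ : Type*} [MeasurableSpace Θ]

/-- The superposition `y ↦ ∫ σ(θ) ψ(y + ξ(θ), τ(θ)) dμ(θ)` of translates of `ψ`. -/
def pull (μ : Measure Θ) (σ ξ τ : Θ → ℝ) (ψ : PlaneTest) (y : ℝ) : ℝ :=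
  ∫ θ, σ θ * ψ (y + ξ θ, τ θ) ∂μ

/-- Admissible weights and translations: the points `(ξ, τ)` lie in the light cone. -/
structure Admissible (μ : Measure Θ) (σ ξ τ : Θ → ℝ) : Prop where
  meas_weight : Measurable σ
  meas_space : Measurable ξ
  meas_time : Measurable τ
  weight_le : ∀ θ, |σ θ| ≤ 1
  cone : ∀ᵐ θ ∂μ, |ξ θ| ≤ |τ θ|
  finite : ∀ R : ℝ, μ {θ | |τ θ| ≤ R} < ⊤

lemma coe_lineDeriv_two (ψ : PlaneTest) (h z : ℝ × ℝ) :
    (∂_{h} ψ : PlaneTest) z = fderiv ℝ ψ z h := by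
  rw [TestFunction.lineDerivOp_eq_lineDerivCLM ℝ, TestFunction.lineDerivCLM_apply_of_le (by simp),
    (ψ.contDiff.differentiable (by simp)).differentiableAt.lineDeriv_eq_fderiv]

lemma pull_bound {μ : Measure Θ} {σ ξ τ : Θ → ℝ} (H : Admissible μ σ ξ τ) (ψ : PlaneTest) {R M : ℝ}
    (hR : tsupport ψ ⊆ Metric.closedBall 0 R) (hM : ∀ z, |ψ z| ≤ M) (y : ℝ) (θ : Θ) :
    ‖σ θ * ψ (y + ξ θ, τ θ)‖ ≤ {θ | |τ θ| ≤ R}.indicator (fun _ => M) θ := by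
  by_cases h : |τ θ| ≤ R
  · rw [Set.indicator_of_mem (by exact h), norm_mul]
    calc _ ≤ 1 * M := mul_le_mul (H.weight_le θ) (hM _) (abs_nonneg _) zero_le_one
      _ = M := one_mul M
  · rw [Set.indicator_of_notMem (by exact h)]
    have : ψ (y + ξ θ, τ θ) = 0 := image_eq_zero_of_notMem_tsupport fun hm => h (by
      have := hR hm
      rw [mem_closedBall_zero_iff, Prod.norm_def] at this
      exact (le_max_right _ _).trans this)
    simp [this]

lemma integrable_bound {μ : Measure Θ} {σ ξ τ : Θ → ℝ} (H : Admissible μ σ ξ τ) (R M : ℝ) :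
    Integrable ({θ | |τ θ| ≤ R}.indicator (fun _ => M)) μ :=
  (integrable_indicator_iff (measurableSet_le H.meas_time.abs measurable_const)).mpr
    (integrableOn_const (H.finite R).ne)

lemma aesm_pull {μ : Measure Θ} {σ ξ τ : Θ → ℝ} (H : Admissible μ σ ξ τ) (ψ : PlaneTest) (y : ℝ) :
    AEStronglyMeasurable (fun θ => σ θ * ψ (y + ξ θ, τ θ)) μ :=
  (H.meas_weight.mul (ψ.continuous.measurable.comp
    ((measurable_const.add H.meas_space).prodMk H.meas_time))).aestronglyMeasurable

lemma exists_ball (ψ : PlaneTest) : ∃ R, tsupport ψ ⊆ Metric.closedBall 0 R :=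
  (ψ.hasCompactSupport.isBounded).subset_closedBall 0

lemma exists_sup (ψ : PlaneTest) : ∃ M, ∀ z, |ψ z| ≤ M :=
  ψ.continuous.bounded_above_of_compact_support ψ.hasCompactSupport

lemma integrable_pull {μ : Measure Θ} {σ ξ τ : Θ → ℝ} (H : Admissible μ σ ξ τ) (ψ : PlaneTest) (y : ℝ) :
    Integrable (fun θ => σ θ * ψ (y + ξ θ, τ θ)) μ := by
  obtain ⟨R, hR⟩ := exists_ball ψ
  obtain ⟨M, hM⟩ := exists_sup ψ
  exact (integrable_bound H R M).mono' (aesm_pull H ψ y)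
    (Eventually.of_forall (pull_bound H ψ hR hM y))

lemma abs_pull_le {μ : Measure Θ} {σ ξ τ : Θ → ℝ} (H : Admissible μ σ ξ τ) (ψ : PlaneTest) {R M : ℝ}
    (hR : tsupport ψ ⊆ Metric.closedBall 0 R) (hM : ∀ z, |ψ z| ≤ M) (y : ℝ) :
    |pull μ σ ξ τ ψ y| ≤ μ.real {θ | |τ θ| ≤ R} * M := by
  have := norm_integral_le_of_norm_le (integrable_bound H R M)
    (Eventually.of_forall (pull_bound H ψ hR hM y))
  rwa [integral_indicator_const _ (measurableSet_le H.meas_time.abs measurable_const)] at this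

lemma pull_eq_zero {μ : Measure Θ} {σ ξ τ : Θ → ℝ} (H : Admissible μ σ ξ τ) (ψ : PlaneTest) {R : ℝ}
    (hR : tsupport ψ ⊆ Metric.closedBall 0 R) {y : ℝ} (hy : y ∉ Metric.closedBall (0 : ℝ) (2 * R)) :
    pull μ σ ξ τ ψ y = 0 := by
  refine integral_eq_zero_of_ae (H.cone.mono fun θ hθ => ?_)
  have : ψ (y + ξ θ, τ θ) = 0 := image_eq_zero_of_notMem_tsupport fun hm => hy (by
    have h := hR hm
    rw [mem_closedBall_zero_iff, Prod.norm_def] at h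
    have h1 : |y + ξ θ| ≤ R := (le_max_left _ _).trans h
    have h2 : |τ θ| ≤ R := (le_max_right _ _).trans h
    rw [mem_closedBall_zero_iff, Real.norm_eq_abs]
    calc |y| = |(y + ξ θ) - ξ θ| := by ring_nf
      _ ≤ |y + ξ θ| + |ξ θ| := abs_sub _ _
      _ ≤ 2 * R := by linarith)
  simp [this]

/-- The derivative of a test function in the direction of `x`. -/
def dx (ψ : PlaneTest) : PlaneTest := ∂_{((1 : ℝ), (0 : ℝ))} ψ

lemma hasDerivAt_pull {μ : Measure Θ} {σ ξ τ : Θ → ℝ} (H : Admissible μ σ ξ τ) (ψ : PlaneTest) (y : ℝ) :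
    HasDerivAt (pull μ σ ξ τ ψ) (pull μ σ ξ τ (dx ψ) y) y := by
  obtain ⟨R, hR⟩ := exists_ball (dx ψ)
  obtain ⟨M, hM⟩ := exists_sup (dx ψ)
  refine (hasDerivAt_integral_of_dominated_loc_of_deriv_le (s := Set.univ) Filter.univ_mem
    (Eventually.of_forall fun y => aesm_pull H ψ y) (integrable_pull H ψ y)
    (aesm_pull H (dx ψ) y)
    (Eventually.of_forall fun θ y _ => pull_bound H _ hR hM y θ) (integrable_bound H R M)
    (Eventually.of_forall fun θ y _ => ?_)).2
  refine HasDerivAt.const_mul _ ?_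
  rw [dx, coe_lineDeriv_two]
  have h1 : HasDerivAt (fun y : ℝ => (y + ξ θ, τ θ)) ((1 : ℝ), (0 : ℝ)) y :=
    ((hasDerivAt_id y).add_const _).prodMk (hasDerivAt_const y _)
  exact ((ψ.contDiff.differentiable (by simp)) _).hasFDerivAt.comp_hasDerivAt y h1

lemma contDiff_pull {μ : Measure Θ} {σ ξ τ : Θ → ℝ} (H : Admissible μ σ ξ τ) (ψ : PlaneTest) :
    ContDiff ℝ ∞ (pull μ σ ξ τ ψ) := by
  rw [contDiff_infty]
  intro n
  induction n generalizing ψ with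
  | zero =>
    exact contDiff_zero.mpr (continuous_iff_continuousAt.mpr
      fun x => (hasDerivAt_pull H ψ x).continuousAt)
  | succ n ih =>
    have h : deriv (pull μ σ ξ τ ψ) = pull μ σ ξ τ (dx ψ) :=
      funext fun x => (hasDerivAt_pull H ψ x).deriv
    push_cast
    refine contDiff_succ_iff_deriv.mpr
      ⟨fun x => (hasDerivAt_pull H ψ x).differentiableAt, by simp, ?_⟩
    rw [h]
    exact ih _

lemma iteratedDeriv_pull {μ : Measure Θ} {σ ξ τ : Θ → ℝ} (H : Admissible μ σ ξ τ) (k : ℕ)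
    (ψ : PlaneTest) : iteratedDeriv k (pull μ σ ξ τ ψ) =
      pull μ σ ξ τ (dx^[k] ψ) := by
  induction k generalizing ψ with
  | zero => rfl
  | succ k ih =>
    have h : deriv (pull μ σ ξ τ ψ) = pull μ σ ξ τ (dx ψ) :=
      funext fun x => (hasDerivAt_pull H ψ x).deriv
    rw [iteratedDeriv_succ', h, ih, Function.iterate_succ_apply]

lemma norm_iterate_lineDeriv_le (k : ℕ) (ψ : PlaneTest) (j : ℕ) (z : ℝ × ℝ) :
    ‖iteratedFDeriv ℝ j (dx^[k] ψ) z‖ ≤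
      ‖iteratedFDeriv ℝ (j + k) ψ z‖ := by
  induction k generalizing ψ j with
  | zero => exact le_rfl
  | succ k ih =>
    rw [Function.iterate_succ_apply]
    refine (ih _ _).trans ?_
    have e : (dx ψ : ℝ × ℝ → ℝ) =
        ContinuousLinearMap.apply ℝ ℝ ((1 : ℝ), (0 : ℝ)) ∘ fderiv ℝ ψ := by
      funext z
      exact coe_lineDeriv_two ψ _ z
    have hn : ‖ContinuousLinearMap.apply ℝ ℝ ((1 : ℝ), (0 : ℝ))‖ ≤ 1 := by
      refine ContinuousLinearMap.opNorm_le_bound _ zero_le_one fun L => ?_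
      rw [one_mul]
      refine (L.le_opNorm _).trans ?_
      simp [Prod.norm_def]
    rw [e]
    refine (ContinuousLinearMap.norm_iteratedFDeriv_comp_left _ (N := ∞)
      (contDiff_fderiv_of_top ψ.contDiff).contDiffAt (by exact_mod_cast le_top)).trans ?_
    rw [norm_iteratedFDeriv_fderiv, ← add_assoc]
    exact mul_le_of_le_one_left (norm_nonneg _) hn

lemma tsupport_lineDeriv_two_subset (k : ℕ) (ψ : PlaneTest) :
    tsupport (dx^[k] ψ) ⊆ tsupport ψ := by
  induction k generalizing ψ with
  | zero => exact subset_rfl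
  | succ k ih =>
    rw [Function.iterate_succ_apply]
    refine (ih _).trans ?_
    have e : (dx ψ : ℝ × ℝ → ℝ) =
        fun z => fderiv ℝ ψ z ((1 : ℝ), (0 : ℝ)) := funext fun z => coe_lineDeriv_two ψ _ z
    rw [e]
    exact tsupport_fderiv_apply_subset ℝ _

/-- The superposition of translates of a test function, as a test function on the line. -/
def pullTest {μ : Measure Θ} {σ ξ τ : Θ → ℝ} (H : Admissible μ σ ξ τ) (ψ : PlaneTest) :
    𝓓((⊤ : Opens ℝ), ℝ) where
  toFun := pull μ σ ξ τ ψ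
  contDiff' := contDiff_pull H ψ
  hasCompactSupport' := by
    obtain ⟨R, hR⟩ := exists_ball ψ
    exact HasCompactSupport.intro (isCompact_closedBall (0 : ℝ) (2 * R))
      fun _ hy => pull_eq_zero H ψ hR hy
  tsupport_subset' := fun _ _ => trivial

/-- The transpose of `pullTest`, as a map on distributions. -/
def push {μ : Measure Θ} {σ ξ τ : Θ → ℝ} (H : Admissible μ σ ξ τ) (a : 𝓓'((⊤ : Opens ℝ), ℝ)) :
    𝓓'((⊤ : Opens (ℝ × ℝ)), ℝ) :=
  TestFunction.mkCLM ℝ (fun ψ : PlaneTest => a (pullTest H ψ))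
    (fun ψ₁ ψ₂ => by
      rw [← map_add]
      congr 1
      ext y
      change ∫ θ, σ θ * (ψ₁ (y + ξ θ, τ θ) + ψ₂ (y + ξ θ, τ θ)) ∂μ =
        pull μ σ ξ τ ψ₁ y + pull μ σ ξ τ ψ₂ y
      simp only [mul_add]
      exact integral_add (integrable_pull H ψ₁ y) (integrable_pull H ψ₂ y))
    (fun c ψ => by
      rw [← map_smul]
      congr 1
      ext y
      change ∫ θ, σ θ * (c * ψ (y + ξ θ, τ θ)) ∂μ = c * pull μ σ ξ τ ψ y
      rw [pull, ← integral_const_mul]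
      congr 1
      ext θ
      ring)
    (fun K hK => by
      obtain ⟨R, hR⟩ := K.isCompact.isBounded.subset_closedBall (0 : ℝ × ℝ)
      obtain ⟨N, C, hC, hb⟩ := exists_dist_bound a (isCompact_closedBall (0 : ℝ) (2 * R))
      have hs : ∀ ψ : 𝓓_{K}(ℝ × ℝ, ℝ),
          tsupport (TestFunction.ofSupportedIn hK ψ : PlaneTest) ⊆ Metric.closedBall 0 R :=
        fun ψ => ψ.tsupport_subset.trans hR
      refine (ContDiffMapSupportedIn.mkCLMtoNormedSpace ℝ
        (fun ψ : 𝓓_{K}(ℝ × ℝ, ℝ) => a (pullTest H (TestFunction.ofSupportedIn hK ψ))) ?_ ?_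
        ⟨Finset.range (N + 1), C * μ.real {θ | |τ θ| ≤ R}, by positivity, ?_⟩).continuous
      · intro ψ₁ ψ₂
        rw [← map_add]
        congr 1
        ext y
        change ∫ θ, σ θ * (ψ₁ (y + ξ θ, τ θ) + ψ₂ (y + ξ θ, τ θ)) ∂μ = _
        simp only [mul_add]
        exact integral_add (integrable_pull H (TestFunction.ofSupportedIn hK ψ₁) y)
          (integrable_pull H (TestFunction.ofSupportedIn hK ψ₂) y)
      · intro c ψ
        rw [← map_smul]
        congr 1
        ext y
        change ∫ θ, σ θ * (c * ψ (y + ξ θ, τ θ)) ∂μ =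
          c * pull μ σ ξ τ (TestFunction.ofSupportedIn hK ψ) y
        rw [pull, ← integral_const_mul]
        congr 1
        ext θ
        change _ = c * (σ θ * ψ (y + ξ θ, τ θ))
        ring
      · intro ψ
        rw [mul_assoc]
        refine hb _ ?_ _ (by positivity) fun i hi y => ?_
        · refine closure_minimal (fun y hy => ?_) Metric.isClosed_closedBall
          by_contra hn
          exact hy (pull_eq_zero H _ (hs ψ) hn)
        · rw [norm_iteratedFDeriv_eq_norm_iteratedDeriv]
          change ‖iteratedDeriv i (pull μ σ ξ τ (TestFunction.ofSupportedIn hK ψ)) y‖ ≤ _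
          rw [iteratedDeriv_pull H]
          refine abs_pull_le H _ ((tsupport_lineDeriv_two_subset _ _).trans (hs ψ))
            (fun z => ?_) y
          have h1 := norm_iterate_lineDeriv_le i (TestFunction.ofSupportedIn hK ψ) 0 z
          rw [norm_iteratedFDeriv_zero, zero_add] at h1
          refine h1.trans ?_
          have h2 : ‖iteratedFDeriv ℝ i ψ z‖ ≤
              ContDiffMapSupportedIn.seminorm ℝ (ℝ × ℝ) ℝ ⊤ K i ψ :=
            ContDiffMapSupportedIn.norm_iteratedFDeriv_apply_le_seminorm_top ℝ
          refine h2.trans ?_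
          exact Seminorm.le_finset_sup_apply (p := fun i =>
            ContDiffMapSupportedIn.seminorm ℝ (ℝ × ℝ) ℝ ⊤ K i)
            (by simpa [Nat.lt_succ_iff] using hi))

lemma admissible_line (c : ℝ) (hc : |c| ≤ 1) :
    Admissible (volume : Measure ℝ) (fun _ => 1) (fun t => c * t) (fun t => t) where
  meas_weight := measurable_const
  meas_space := by fun_prop
  meas_time := measurable_id
  weight_le _ := by simp
  cone := Eventually.of_forall fun t => by
    rw [abs_mul]; exact mul_le_of_le_one_left (abs_nonneg t) hc
  finite R := by
    have : {t : ℝ | |t| ≤ R} = Metric.closedBall 0 R := by ext t; simp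
    rw [this]
    exact measure_closedBall_lt_top

lemma admissible_cone :
    Admissible ((volume : Measure (ℝ × ℝ)).restrict {z | |z.1| ≤ |z.2|})
      (fun z => Real.sign z.2) (fun z => z.1) (fun z => z.2) where
  meas_weight := by
    unfold Real.sign
    exact Measurable.ite (measurableSet_lt measurable_snd measurable_const) measurable_const
      (Measurable.ite (measurableSet_lt measurable_const measurable_snd) measurable_const
        measurable_const)
  meas_space := measurable_fst
  meas_time := measurable_snd
  weight_le z := by
    rcases Real.sign_apply_eq z.2 with h | h | h <;> simp [h]
  cone := ae_restrict_mem (measurableSet_le measurable_fst.abs measurable_snd.abs)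
  finite R := by
    refine lt_of_le_of_lt ?_ (measure_closedBall_lt_top (μ := (volume : Measure (ℝ × ℝ)))
      (x := 0) (r := R))
    rw [Measure.restrict_apply (measurableSet_le measurable_snd.abs measurable_const)]
    refine measure_mono fun z hz => ?_
    have h1 : |z.2| ≤ R := hz.1
    have h2 : |z.1| ≤ |z.2| := hz.2
    rw [mem_closedBall_zero_iff, Prod.norm_def]
    exact max_le (h2.trans h1) h1

/-- The solution `v = ½ (a(x - t) + a(x + t)) + ½ ∫_{x-t}^{x+t} b(y) dy` of the linear wave equation
with the distributions `a`, `b` as initial data. As a distribution, it is defined by transposition,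
see `dAlembert_apply`. -/
def dAlembert (a b : 𝓓'((⊤ : Opens ℝ), ℝ)) : 𝓓'((⊤ : Opens (ℝ × ℝ)), ℝ) :=
  (1 / 2 : ℝ) • (push (admissible_line 1 (by simp)) a + push (admissible_line (-1) (by simp)) a) +
    (1 / 2 : ℝ) • push admissible_cone b

/-- `⟨v, ψ⟩ = ½ ⟨a(y), ∫ ψ(y + t, t) dt + ∫ ψ(y - t, t) dt⟩
  + ½ ⟨b(y), ∫∫_{|s| ≤ |t|} sgn(t) ψ(y + s, t) ds dt⟩`. -/
lemma dAlembert_apply (a b : 𝓓'((⊤ : Opens ℝ), ℝ)) (ψ : PlaneTest) (A B : 𝓓((⊤ : Opens ℝ), ℝ))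
    (hA : ∀ y, A y = (∫ t, ψ (y + t, t)) + ∫ t, ψ (y - t, t))
    (hB : ∀ y, B y = ∫ z in {z : ℝ × ℝ | |z.1| ≤ |z.2|}, Real.sign z.2 * ψ (y + z.1, z.2)) :
    dAlembert a b ψ = 1 / 2 * a A + 1 / 2 * b B := by
  have h1 : A = pullTest (admissible_line 1 (by simp)) ψ +
      pullTest (admissible_line (-1) (by simp)) ψ := by
    ext y
    rw [hA]
    change _ = (∫ t, 1 * ψ (y + 1 * t, t)) + ∫ t, 1 * ψ (y + -1 * t, t)
    simp [sub_eq_add_neg]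
  have h2 : B = pullTest admissible_cone ψ := by
    ext y
    rw [hB]
    rfl
  rw [h1, h2, map_add]
  rfl

end Linear

/-! ### The wave equations -/

/-- The wave operator `∂ₜ² - ∂ₓ²` on test functions. -/
def waveTest (ψ : 𝓓((⊤ : Opens (ℝ × ℝ)), ℝ)) : 𝓓((⊤ : Opens (ℝ × ℝ)), ℝ) :=
  ∂_{((0 : ℝ), (1 : ℝ))} (∂_{((0 : ℝ), (1 : ℝ))} ψ) -
    ∂_{((1 : ℝ), (0 : ℝ))} (∂_{((1 : ℝ), (0 : ℝ))} ψ)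

/-- `w` is a weak solution of `∂ₜ² w - ∂ₓ² w = F` on the plane with `w = ∂ₜ w = 0` at `t = 0`.
The test functions do not have to vanish at `t = 0`: this encodes the initial conditions. -/
def IsWeakSolution (w F : ℝ × ℝ → ℝ) : Prop :=
  ∀ ψ : 𝓓((⊤ : Opens (ℝ × ℝ)), ℝ),
    (∫ z in {z : ℝ × ℝ | 0 < z.2}, w z * waveTest ψ z =
      ∫ z in {z : ℝ × ℝ | 0 < z.2}, F z * ψ z) ∧
    (∫ z in {z : ℝ × ℝ | z.2 < 0}, w z * waveTest ψ z =
      ∫ z in {z : ℝ × ℝ | z.2 < 0}, F z * ψ z)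

/-- `u` solves `∂ₜ² u - ∂ₓ² u = f(u)`, `u = α` and `∂ₜ u = β` at `t = 0`, in the Colombeau
algebra. -/
def IsColombeauSolution (f : ℝ → ℝ) (hf : IsSlowlyGrowing f) (α β : Colombeau ℝ)
    (u : Colombeau (ℝ × ℝ)) : Prop :=
  (u.pderiv (0, 1)).pderiv (0, 1) - (u.pderiv (1, 0)).pderiv (1, 0) = u.superpos f hf ∧
  u.restrict = α ∧ (u.pderiv (0, 1)).restrict = β

end DeltaWave

end

/-! Fix a representative `r ε` of the Colombeau solution and let `wave` be the linear wave v_ε with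
the mollified data. It suffices that v_ε → v in the sense of distributions and that r_ε − v_ε → w
uniformly on each bounded domain of determinacy in t > 0 and, after time reflection, in t < 0; the
line t = 0 is null.

The first limit is transposition: pairing v_ε with a test function equals pairing the mollified data
with fixed test functions on the line (`integral_freeWave_mul`), and mollified data converge as
distributions (`tendsto_conv`).

The delta waves are invisible to the nonlinearity because f is bounded and they live on a null set.
The data have countable support, so almost every point avoids the characteristics issuing from it.
Near such a point the mollified data at the two characteristic feet tend to zero, so v_ε is
asymptotically constant there (`wave_locally_constant`). Together with distributional convergence
this makes v a constant near the point, and makes that constant the limit of v_ε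
(`tendsto_offSingSupp`). Hence v_ε → V almost everywhere, where V is v off its singular support and
zero on it, and f(v_ε + w) → f(V + w) in L¹ on bounded regions by dominated convergence.

By Duhamel's formula (`duhamel`), W_ε = r_ε − v_ε solves W = ½ ∫ f(v_ε + W) over the backward cone
up to a uniformly small error (`upper_residual`). The weak solution w solves the limit equation
almost everywhere: every g with compact support in t > 0 is the image under the wave operator of a
function that agrees there with a test function (`exists_planeTest`), which gives
`IsUpperWeakSolution.duhamel`. The Lipschitz bound and a Gronwall inequality on cones then force W_ε
→ w (`gronwall_cone`, `integral_equation_stable`). -/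

noncomputable section

namespace DeltaWave

/-! ### The wave operator on smooth functions and Duhamel's formula -/

/-- The wave operator `∂ₜ² - ∂ₓ²`. -/
def box (r : ℝ × ℝ → ℝ) (z : ℝ × ℝ) : ℝ :=
  fderiv ℝ (fun y => fderiv ℝ r y (0, 1)) z (0, 1) -
    fderiv ℝ (fun y => fderiv ℝ r y (1, 0)) z (1, 0)

/-- The part in `t > 0` of the open backward light cone with vertex `z`. -/
def cone (z : ℝ × ℝ) : Set (ℝ × ℝ) := {y | 0 < y.2 ∧ |y.1 - z.1| < z.2 - y.2}

lemma measurableSet_cone (z : ℝ × ℝ) : MeasurableSet (cone z) :=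
  (measurableSet_lt measurable_const measurable_snd).inter
    (measurableSet_lt (measurable_fst.sub_const _).abs (measurable_const.sub measurable_snd))

lemma cone_subset (z : ℝ × ℝ) :
    cone z ⊆ Set.Icc (z.1 - z.2) (z.1 + z.2) ×ˢ Set.Icc 0 z.2 := fun y ⟨h1, h2⟩ => by
  rw [abs_lt] at h2
  exact ⟨⟨by linarith, by linarith⟩, ⟨h1.le, by linarith⟩⟩

lemma integrableOn_cone {F : ℝ × ℝ → ℝ} (hF : Continuous F) (z : ℝ × ℝ) :
    IntegrableOn F (cone z) :=
  (hF.continuousOn.integrableOn_compact (isCompact_Icc.prod isCompact_Icc)).mono_set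
    (cone_subset z)

lemma contDiff_dir {r : ℝ × ℝ → ℝ} (hr : ContDiff ℝ ∞ r) (h : ℝ × ℝ) :
    ContDiff ℝ ∞ fun z => fderiv ℝ r z h :=
  (contDiff_fderiv_of_top hr).clm_apply contDiff_const

lemma contDiff_box {r : ℝ × ℝ → ℝ} (hr : ContDiff ℝ ∞ r) : ContDiff ℝ ∞ (box r) :=
  (contDiff_dir (contDiff_dir hr _) _).sub (contDiff_dir (contDiff_dir hr _) _)

lemma fderiv_fderiv_apply {r : ℝ × ℝ → ℝ} (hr : ContDiff ℝ ∞ r) (h k z : ℝ × ℝ) :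
    fderiv ℝ (fun y => fderiv ℝ r y h) z k = fderiv ℝ (fderiv ℝ r) z k h := by
  have h1 := ((contDiff_fderiv_of_top hr).differentiable (by simp)) z
  have h2 := h1.hasFDerivAt.clm_apply (hasFDerivAt_const h z)
  rw [h2.fderiv]
  simp

/-- The factorization (∂ₜ − ∂ₓ)(∂ₜ + ∂ₓ); the mixed terms cancel by symmetry of the second
derivative. -/
lemma box_eq_fderiv {r : ℝ × ℝ → ℝ} (hr : ContDiff ℝ ∞ r) (z : ℝ × ℝ) :
    box r z = fderiv ℝ (fun y => fderiv ℝ r y (1, 1)) z (-1, 1) := by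
  have hs : IsSymmSndFDerivAt ℝ r z := hr.contDiffAt.isSymmSndFDerivAt
    (by simp only [minSmoothness_of_isRCLikeNormedField]; exact WithTop.coe_le_coe.2 (le_top (a := (2 : ℕ∞))))
  have hs' := hs.eq (1, 0) (0, 1)
  rw [box, fderiv_fderiv_apply hr, fderiv_fderiv_apply hr, fderiv_fderiv_apply hr]
  have e1 : ((1 : ℝ), (1 : ℝ)) = (1, 0) + (0, 1) := by simp
  have e2 : ((-1 : ℝ), (1 : ℝ)) = -(1, 0) + (0, 1) := by simp
  rw [e1, e2]
  simp only [map_add, map_neg, _root_.add_apply, _root_.neg_apply]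
  linarith

/-- Integrating successively along the two families of characteristics covers the backward cone
once. The parameters range over the triangle 0 < s < τ < t, and the factor ½ is the Jacobian. -/
lemma integral_triangle {F : ℝ × ℝ → ℝ} (hF : Continuous F) (x : ℝ) {t : ℝ} (ht : 0 ≤ t) :
    ∫ τ in (0 : ℝ)..t, ∫ s in (0 : ℝ)..τ, F (x - t + 2 * τ - s, s) =
      (∫ z in cone (x, t), F z) / 2 := by
  set T : ℝ → ℝ → ℝ := fun s τ =>
    {q : ℝ × ℝ | 0 < q.1 ∧ q.1 < q.2 ∧ q.2 < t}.indicator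
      (fun q => F (x - t + 2 * q.2 - q.1, q.1)) (s, τ) with hT
  have hm : MeasurableSet {q : ℝ × ℝ | 0 < q.1 ∧ q.1 < q.2 ∧ q.2 < t} :=
    (measurableSet_lt measurable_const measurable_fst).inter
      ((measurableSet_lt measurable_fst measurable_snd).inter
        (measurableSet_lt measurable_snd measurable_const))
  have hi : Integrable (Function.uncurry T) (volume.prod volume) := by
    have : Function.uncurry T = {q : ℝ × ℝ | 0 < q.1 ∧ q.1 < q.2 ∧ q.2 < t}.indicator
      (fun q => F (x - t + 2 * q.2 - q.1, q.1)) := rfl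
    rw [this, integrable_indicator_iff hm]
    refine (Continuous.continuousOn (by fun_prop)).integrableOn_compact
      (isCompact_Icc.prod isCompact_Icc : IsCompact (Set.Icc 0 t ×ˢ Set.Icc 0 t))
      |>.mono_set fun q ⟨h1, h2, h3⟩ => ?_
    exact ⟨⟨by linarith, by linarith⟩, ⟨by linarith, by linarith⟩⟩
  have h1 : ∫ z in cone (x, t), F z = ∫ s, 2 * ∫ τ, T s τ := by
    rw [← integral_indicator (measurableSet_cone _), Measure.volume_eq_prod,
      integral_prod_symm _ ((integrable_indicator_iff (measurableSet_cone _)).mpr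
        (integrableOn_cone hF _))]
    congr 1
    ext s
    -- At fixed time s, the substitution y = 2τ + (x − t − s) turns the slice of the cone into s < τ
    -- < t.
    have := (Measure.integral_comp_mul_left
      (fun y => (cone (x, t)).indicator F (y + (x - t - s), s)) 2).trans
      (congrArg _ (integral_add_right_eq_self (fun y => (cone (x, t)).indicator F (y, s)) _))
    have e : ∀ τ, (cone (x, t)).indicator F (2 * τ + (x - t - s), s) = T s τ := fun τ => by
      simp only [hT, Set.indicator_apply, cone, Set.mem_ofPred_eq, abs_lt]
      rw [show 2 * τ + (x - t - s) = x - t + 2 * τ - s by ring]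
      congr 1
      apply propext
      constructor
      · rintro ⟨h1, h2, h3⟩
        exact ⟨h1, by linarith, by linarith⟩
      · rintro ⟨h1, h2, h3⟩
        exact ⟨h1, by linarith, by linarith⟩
    simp only [e] at this
    rw [this]
    simp
  rw [h1, integral_const_mul, integral_integral_swap hi]
  rw [mul_div_cancel_left₀ _ (two_ne_zero)]
  rw [intervalIntegral.integral_of_le ht, integral_Ioc_eq_integral_Ioo,
    ← integral_indicator measurableSet_Ioo]
  congr 1
  ext τ
  by_cases h : τ ∈ Set.Ioo 0 t
  · rw [Set.indicator_of_mem h, intervalIntegral.integral_of_le h.1.le,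
      integral_Ioc_eq_integral_Ioo, ← integral_indicator measurableSet_Ioo]
    congr 1
    ext s
    simp only [hT, Set.indicator_apply, Set.mem_ofPred_eq, Set.mem_Ioo, h.2, and_true]
  · rw [Set.indicator_of_notMem h]
    symm
    refine integral_eq_zero_of_ae (Eventually.of_forall fun s => ?_)
    exact Set.indicator_of_notMem (s := {q : ℝ × ℝ | 0 < q.1 ∧ q.1 < q.2 ∧ q.2 < t})
      (a := (s, τ)) (fun hq : 0 < s ∧ s < τ ∧ τ < t => h ⟨hq.1.trans hq.2.1, hq.2.2⟩) _

/-- The solution `½ (α(x - t) + α(x + t)) + ½ ∫_{x-t}^{x+t} β` of the wave equation. -/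
def freeWave (α β : ℝ → ℝ) (z : ℝ × ℝ) : ℝ :=
  (α (z.1 - z.2) + α (z.1 + z.2)) / 2 + (∫ y in (z.1 - z.2)..(z.1 + z.2), β y) / 2

/-- Duhamel's formula. -/
lemma duhamel {r : ℝ × ℝ → ℝ} (hr : ContDiff ℝ ∞ r) (z : ℝ × ℝ) (ht : 0 ≤ z.2) :
    r z = freeWave (fun y => r (y, 0)) (fun y => fderiv ℝ r (y, 0) (0, 1)) z +
      (∫ y in cone z, box r y) / 2 := by
  obtain ⟨x, t⟩ := z
  simp only at ht
  have hp : ContDiff ℝ ∞ fun y => fderiv ℝ r y (1, 1) := contDiff_dir hr _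
  set p : ℝ × ℝ → ℝ := fun y => fderiv ℝ r y (1, 1) with hp'
  have hb := (contDiff_box hr).continuous
  -- Along a left-going characteristic the derivative of `p` = (∂ₜ + ∂ₓ)r is exactly `box r`.
  have hA : ∀ ξ τ : ℝ, p (ξ - τ, τ) = p (ξ, 0) + ∫ s in (0 : ℝ)..τ, box r (ξ - s, s) := by
    intro ξ τ
    have hd : ∀ s, HasDerivAt (fun s : ℝ => p (ξ - s, s)) (box r (ξ - s, s)) s := fun s => by
      rw [box_eq_fderiv hr]
      have h1 : HasDerivAt (fun s : ℝ => (ξ - s, s)) ((-1 : ℝ), (1 : ℝ)) s :=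
        ((hasDerivAt_id s).const_sub ξ).prodMk (hasDerivAt_id s)
      exact ((hp.differentiable (by simp)) _).hasFDerivAt.comp_hasDerivAt s h1
    have := intervalIntegral.integral_eq_sub_of_hasDerivAt (a := 0) (b := τ) (fun s _ => hd s)
      ((by fun_prop : Continuous fun s : ℝ => box r (ξ - s, s)).intervalIntegrable _ _)
    rw [this]
    simp
  -- Along a right-going characteristic the derivative of `r` is `p`, so a second integration
  -- recovers `r`.
  have hB : r (x, t) - r (x - t, 0) = ∫ τ in (0 : ℝ)..t, p (x - t + τ, τ) := by
    have hd : ∀ s, HasDerivAt (fun s : ℝ => r (x - t + s, s)) (p (x - t + s, s)) s := fun s => by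
      have h1 : HasDerivAt (fun s : ℝ => (x - t + s, s)) ((1 : ℝ), (1 : ℝ)) s :=
        ((hasDerivAt_id s).const_add _).prodMk (hasDerivAt_id s)
      exact ((hr.differentiable (by simp)) _).hasFDerivAt.comp_hasDerivAt s h1
    have hpc := hp.continuous
    have := intervalIntegral.integral_eq_sub_of_hasDerivAt (a := 0) (b := t) (fun s _ => hd s)
      ((by fun_prop : Continuous fun s : ℝ => p (x - t + s, s)).intervalIntegrable _ _)
    rw [this]
    simp
  have hpc := hp.continuous
  have hC : ∫ τ in (0 : ℝ)..t, p (x - t + τ, τ) =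
      (∫ τ in (0 : ℝ)..t, p (2 * τ + (x - t), 0)) +
        ∫ τ in (0 : ℝ)..t, ∫ s in (0 : ℝ)..τ, box r (x - t + 2 * τ - s, s) := by
    rw [← intervalIntegral.integral_add]
    · refine intervalIntegral.integral_congr fun τ _ => ?_
      have := hA (x - t + 2 * τ) τ
      rw [show x - t + 2 * τ - τ = x - t + τ by ring] at this
      simp only [this]
      rw [show x - t + 2 * τ = 2 * τ + (x - t) by ring]
    · exact (by fun_prop : Continuous fun τ : ℝ => p (2 * τ + (x - t), 0)).intervalIntegrable _ _
    · refine Continuous.intervalIntegrable ?_ _ _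
      have : ∀ τ : ℝ, ∫ s in (0 : ℝ)..τ, box r (x - t + 2 * τ - s, s) =
          p (x - t + τ, τ) - p (2 * τ + (x - t), 0) := fun τ => by
        have := hA (x - t + 2 * τ) τ
        rw [show x - t + 2 * τ - τ = x - t + τ by ring] at this
        rw [this, show x - t + 2 * τ = 2 * τ + (x - t) by ring]
        ring
      simp only [this]
      fun_prop
  -- On the initial line `p` is the velocity plus the derivative of the position; the latter
  -- integrates to boundary values.
  have hD : ∫ τ in (0 : ℝ)..t, p (2 * τ + (x - t), 0) =
      (∫ y in (x - t)..(x + t), fderiv ℝ r (y, 0) (0, 1)) / 2 +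
        (r (x + t, 0) - r (x - t, 0)) / 2 := by
    rw [intervalIntegral.integral_comp_mul_add (fun y => p (y, 0)) two_ne_zero]
    have e : ∀ y, p (y, 0) = fderiv ℝ r (y, 0) (0, 1) + fderiv ℝ r (y, 0) (1, 0) := fun y => by
      rw [hp', ← map_add]
      simp
    have c1 := (contDiff_dir hr (0, 1)).continuous
    have c2 := (contDiff_dir hr (1, 0)).continuous
    have hd : ∀ s, HasDerivAt (fun s : ℝ => r (s, 0)) (fderiv ℝ r (s, 0) (1, 0)) s := fun s => by
      have h1 : HasDerivAt (fun s : ℝ => (s, (0 : ℝ))) ((1 : ℝ), (0 : ℝ)) s :=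
        (hasDerivAt_id s).prodMk (hasDerivAt_const _ _)
      exact ((hr.differentiable (by simp)) _).hasFDerivAt.comp_hasDerivAt s h1
    simp only [e]
    rw [intervalIntegral.integral_add
      ((by fun_prop : Continuous fun y : ℝ => fderiv ℝ r (y, 0) (0, 1)).intervalIntegrable _ _)
      ((by fun_prop : Continuous fun y : ℝ => fderiv ℝ r (y, 0) (1, 0)).intervalIntegrable _ _),
      intervalIntegral.integral_eq_sub_of_hasDerivAt (fun s _ => hd s)
      ((by fun_prop : Continuous fun y : ℝ => fderiv ℝ r (y, 0) (1, 0)).intervalIntegrable _ _)]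
    rw [show 2 * 0 + (x - t) = x - t by ring, show 2 * t + (x - t) = x + t by ring, smul_eq_mul]
    ring
  rw [integral_triangle hb x ht, hD] at hC
  rw [hC] at hB
  simp only [freeWave]
  linarith


/-! ### Stability of the integral equation -/

/-- An open domain of determinacy in the upper half-plane. -/
def region (T : ℝ) : Set (ℝ × ℝ) := {z | 0 < z.2 ∧ |z.1| + z.2 < T}

lemma isOpen_region (T : ℝ) : IsOpen (region T) :=
  (isOpen_lt continuous_const continuous_snd).inter
    (isOpen_lt (continuous_fst.abs.add continuous_snd) continuous_const)

lemma region_subset (T : ℝ) : region T ⊆ Set.Icc (-T) T ×ˢ Set.Icc 0 T := fun y ⟨h1, h2⟩ => by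
  have h3 : |y.1| ≤ T := by linarith
  exact ⟨abs_le.mp h3, ⟨h1.le, by linarith [abs_nonneg y.1]⟩⟩

lemma cone_subset_region {T : ℝ} {z : ℝ × ℝ} (hz : z ∈ region T) : cone z ⊆ region T :=
  fun y ⟨h1, h2⟩ => ⟨h1, by
    have := hz.2
    have h3 : |y.1| ≤ |y.1 - z.1| + |z.1| := by simpa using abs_add_le (y.1 - z.1) z.1
    linarith⟩

lemma volume_region_lt_top (T : ℝ) : volume (region T) < ⊤ :=
  (measure_mono (region_subset T)).trans_lt (isCompact_Icc.prod isCompact_Icc).measure_lt_top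

/-- The weight exp(lt) gains a factor 1/l under integration over the cone, estimated here by the
enclosing rectangle. For large l the cone integral becomes a contraction in the weighted sup norm.
-/
lemma integral_cone_exp_le {T : ℝ} {z : ℝ × ℝ} (hz : z ∈ region T) {l : ℝ} (hl : 0 < l) :
    ∫ y in cone z, Real.exp (l * y.2) ≤ 2 * T * (Real.exp (l * z.2) / l) := by
  have hc : Continuous fun y : ℝ × ℝ => Real.exp (l * y.2) := by fun_prop
  have hz0 := hz.1
  have hzT : z.2 ≤ T := by linarith [hz.2, abs_nonneg z.1]
  have h1 : ∫ y in cone z, Real.exp (l * y.2) ≤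
      ∫ y in Set.Icc (z.1 - z.2) (z.1 + z.2) ×ˢ Set.Icc 0 z.2, Real.exp (l * y.2) :=
    setIntegral_mono_set (hc.continuousOn.integrableOn_compact (isCompact_Icc.prod isCompact_Icc))
      (Eventually.of_forall fun _ => (Real.exp_pos _).le) (cone_subset z).eventuallyLE
  have h2 : ∫ y in Set.Icc (z.1 - z.2) (z.1 + z.2) ×ˢ Set.Icc 0 z.2, Real.exp (l * y.2) =
      (2 * z.2) * ∫ s in Set.Icc 0 z.2, Real.exp (l * s) := by
    have := setIntegral_prod_mul (μ := (volume : Measure ℝ)) (ν := (volume : Measure ℝ))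
      (fun _ : ℝ => (1 : ℝ)) (fun s => Real.exp (l * s))
      (Set.Icc (z.1 - z.2) (z.1 + z.2)) (Set.Icc 0 z.2)
    simp only [one_mul] at this
    rw [Measure.volume_eq_prod, this]
    congr 1
    rw [setIntegral_const, smul_eq_mul, mul_one, measureReal_def, Real.volume_Icc,
      ENNReal.toReal_ofReal (by linarith)]
    ring
  have h3 : ∫ s in Set.Icc 0 z.2, Real.exp (l * s) ≤ Real.exp (l * z.2) / l := by
    rw [integral_Icc_eq_integral_Ioc, ← intervalIntegral.integral_of_le hz0.le]
    have hd : ∀ s ∈ Set.uIcc 0 z.2, HasDerivAt (fun s => Real.exp (l * s) / l)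
        (Real.exp (l * s)) s := fun s _ => by
      have := (((hasDerivAt_id s).const_mul l).exp).div_const l
      simpa [hl.ne'] using this
    rw [intervalIntegral.integral_eq_sub_of_hasDerivAt hd
      ((by fun_prop : Continuous fun s : ℝ => Real.exp (l * s)).intervalIntegrable _ _)]
    have : 0 < Real.exp (l * 0) / l := by positivity
    linarith
  have h4 : 0 ≤ ∫ s in Set.Icc 0 z.2, Real.exp (l * s) :=
    integral_nonneg fun _ => (Real.exp_pos _).le
  rw [h2] at h1
  refine h1.trans (mul_le_mul (by linarith) h3 h4 (by linarith))

/-- A Gronwall inequality on backward light cones. -/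
lemma gronwall_cone {E : ℝ × ℝ → ℝ} (hE : Continuous E) {L δ T : ℝ}
    (hL : 0 ≤ L) (h : ∀ᵐ z, z ∈ region T → E z ≤ δ + L * ∫ y in cone z, E y) (hδ : 0 ≤ δ)
    {z : ℝ × ℝ} (hz : z ∈ region T) : E z ≤ 2 * δ * Real.exp ((4 * L * T + 1) * T) := by
  have hT : 0 < T := by linarith [hz.1, hz.2, abs_nonneg z.1]
  -- Large enough that 2LT/l ≤ ½, so the integral term can be absorbed; the 1 keeps `l` positive
  -- when `L` = 0.
  set l : ℝ := 4 * L * T + 1 with hl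
  have hl0 : 0 < l := by positivity
  set G : ℝ × ℝ → ℝ := fun z => E z * Real.exp (-(l * z.2)) with hG
  have hGc : Continuous G := by fun_prop
  have hbd : BddAbove (G '' region T) :=
    ((isCompact_Icc.prod isCompact_Icc).bddAbove_image hGc.continuousOn).mono
      (Set.image_mono (region_subset T))
  set M := sSup (G '' region T) with hM
  -- `E` may be negative, so the supremum is truncated at 0 to keep the estimates monotone.
  set M' := max M 0
  have hGM : ∀ y ∈ region T, G y ≤ M' := fun y hy =>
    (le_csSup hbd ⟨y, hy, rfl⟩).trans (le_max_left _ _)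
  have hEM : ∀ y ∈ region T, E y ≤ M' * Real.exp (l * y.2) := fun y hy => by
    have h1 := mul_le_mul_of_nonneg_right (hGM y hy) (Real.exp_pos (l * y.2)).le
    simpa [hG, mul_assoc, ← Real.exp_add] using h1
  have hae : ∀ᵐ z, z ∈ region T → G z ≤ δ + M' / 2 := by
    filter_upwards [h] with y hy hyT
    have h1 : ∫ x in cone y, E x ≤ ∫ x in cone y, M' * Real.exp (l * x.2) :=
      setIntegral_mono_on (integrableOn_cone hE y) (integrableOn_cone (by fun_prop) y)
        (measurableSet_cone y) fun x hx => hEM x (cone_subset_region hyT hx)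
    rw [integral_const_mul] at h1
    have h2 := integral_cone_exp_le hyT hl0
    have h3 : E y ≤ δ + L * (M' * (2 * T * (Real.exp (l * y.2) / l))) := by
      refine (hy hyT).trans ?_
      gcongr
      refine h1.trans ?_
      gcongr
    have h4 : L * (M' * (2 * T * (Real.exp (l * y.2) / l))) ≤
        M' / 2 * Real.exp (l * y.2) := by
      have h5 : L * (2 * T) / l ≤ 1 / 2 := by
        rw [div_le_iff₀ hl0, hl]
        linarith
      calc _ = (L * (2 * T) / l) * (M' * Real.exp (l * y.2)) := by ring
        _ ≤ 1 / 2 * (M' * Real.exp (l * y.2)) := by gcongr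
        _ = _ := by ring
    have h6 : 1 ≤ Real.exp (l * y.2) := Real.one_le_exp (mul_nonneg hl0.le hyT.1.le)
    have h7 : E y ≤ (δ + M' / 2) * Real.exp (l * y.2) := by nlinarith
    calc G y ≤ (δ + M' / 2) * Real.exp (l * y.2) * Real.exp (-(l * y.2)) :=
          mul_le_mul_of_nonneg_right h7 (Real.exp_pos _).le
      _ = _ := by rw [mul_assoc, ← Real.exp_add]; simp
  -- A closed condition on a continuous function that holds almost everywhere in an open set holds
  -- throughout it.
  have hall : ∀ y ∈ region T, G y ≤ δ + M' / 2 := by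
    have h1 : region T ⊆ closure (region T ∩ {y | y ∈ region T → G y ≤ δ + M' / 2}) :=
      (Measure.dense_of_ae hae).open_subset_closure_inter (isOpen_region T)
    intro y hy
    have h2 : closure (region T ∩ {y | y ∈ region T → G y ≤ δ + M' / 2}) ⊆
        {y | G y ≤ δ + M' / 2} :=
      closure_minimal (fun x hx => hx.2 hx.1) (isClosed_le hGc continuous_const)
    exact h2 (h1 hy)
  have hM2 : M' ≤ 2 * δ := by
    have h1 : M ≤ δ + M' / 2 := csSup_le ⟨_, z, hz, rfl⟩ (by rintro _ ⟨y, hy, rfl⟩; exact hall y hy)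
    have h2 : M' ≤ δ + M' / 2 := max_le h1 (by positivity)
    linarith
  refine (hEM z hz).trans ?_
  have : z.2 ≤ T := by linarith [hz.2, abs_nonneg z.1]
  gcongr

/-- Approximate solutions `W` of the integral equation with a perturbation `v` that converges almost
everywhere converge to the solution `w` of the limit equation. -/
lemma integral_equation_stable {ι : Type*} {l : Filter ι} [l.IsCountablyGenerated] {f : ℝ → ℝ}
    {L : NNReal} (hL : LipschitzWith L f) {M : ℝ} (hM : ∀ y, |f y| ≤ M) {V w : ℝ × ℝ → ℝ}
    {v W : ι → ℝ × ℝ → ℝ} (hV : AEStronglyMeasurable V volume) (hw : Continuous w)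
    (hv : ∀ ε, Continuous (v ε)) (hW : ∀ ε, Continuous (W ε))
    (hlim : ∀ᵐ z, Tendsto (fun ε => v ε z) l (𝓝 (V z)))
    (hwD : ∀ᵐ z : ℝ × ℝ, 0 < z.2 → w z = (∫ y in cone z, f (V y + w y)) / 2) {T : ℝ}
    (hWD : ∀ δ > 0, ∀ᶠ ε in l, ∀ z ∈ region T,
      |W ε z - (∫ y in cone z, f (v ε y + W ε y)) / 2| ≤ δ) {δ : ℝ} (hδ : 0 < δ) :
    ∀ᶠ ε in l, ∀ z ∈ region T, |W ε z - w z| ≤ δ := by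
  have hfc := hL.continuous
  have hmeas : AEStronglyMeasurable (fun y => f (V y + w y)) volume :=
    hfc.comp_aestronglyMeasurable (hV.add hw.aestronglyMeasurable)
  have hint : ∀ s : Set (ℝ × ℝ), volume s < ⊤ → IntegrableOn (fun y => f (V y + w y)) s :=
    fun s hs => by
      have : IsFiniteMeasure (volume.restrict s) := ⟨by simpa using hs⟩
      exact (integrable_const M).mono' hmeas.restrict (Eventually.of_forall fun y => hM _)
  have hcont : ∀ ε, Continuous fun y => f (v ε y + w y) := fun ε =>
    hfc.comp ((hv ε).add hw)
  have hfin := volume_region_lt_top T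
  have : IsFiniteMeasure (volume.restrict (region T)) := ⟨by simpa using hfin⟩
  -- Only almost everywhere convergence of `v` is available, and `v` may be unbounded in ε. The
  -- bound on `f` provides the dominating constant on a region of finite measure.
  have hI : Tendsto (fun ε => ∫ y in region T, |f (v ε y + w y) - f (V y + w y)|) l (𝓝 0) := by
    have : Tendsto (fun ε => ∫ y in region T, |f (v ε y + w y) - f (V y + w y)|) l
        (𝓝 (∫ y in region T, (0 : ℝ))) := by
      refine tendsto_integral_filter_of_dominated_convergence (fun _ => 2 * M) ?_ ?_
        (integrable_const _) ?_
      · exact Eventually.of_forall fun ε =>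
          ((hcont ε).aestronglyMeasurable.sub hmeas).norm.restrict
      · refine Eventually.of_forall fun ε => Eventually.of_forall fun y => ?_
        rw [Real.norm_eq_abs, abs_abs]
        refine (abs_sub _ _).trans ?_
        linarith [hM (v ε y + w y), hM (V y + w y)]
      · refine ae_restrict_of_ae (hlim.mono fun y hy => ?_)
        have h1 : Tendsto (fun ε => f (v ε y + w y)) l (𝓝 (f (V y + w y))) :=
          (hfc.tendsto _).comp (hy.add_const _)
        have h2 := (h1.sub_const (f (V y + w y))).abs
        simpa using h2
    simpa using this
  -- The amplification factor of `gronwall_cone` for the Lipschitz constant L/2, the ½ coming from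
  -- Duhamel's formula.
  set A : ℝ := 2 * Real.exp ((4 * (L / 2 : ℝ) * T + 1) * T) with hA
  have hA0 : 0 < A := by positivity
  have hIδ : ∀ᶠ ε in l, ∫ y in region T, |f (v ε y + w y) - f (V y + w y)| ≤ δ / A :=
    hI.eventually (eventually_le_nhds (by positivity))
  filter_upwards [hIδ, hWD (δ / A / 2) (by positivity)] with ε h1 h2 z hz
  have key : ∀ᵐ z, z ∈ region T →
      |W ε z - w z| ≤ δ / A + (L / 2 : ℝ) * ∫ y in cone z, |W ε y - w y| := by
    filter_upwards [hwD] with z hwz hz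
    have i1 : IntegrableOn (fun y => f (v ε y + W ε y)) (cone z) :=
      integrableOn_cone (hfc.comp ((hv ε).add (hW ε))) z
    have i2 : IntegrableOn (fun y => f (v ε y + w y)) (cone z) := integrableOn_cone (hcont ε) z
    have i3 : IntegrableOn (fun y => f (V y + w y)) (cone z) :=
      hint _ ((measure_mono (cone_subset_region hz)).trans_lt hfin)
    -- Three errors: the residual of the approximate equation, a Lipschitz term for Gronwall, and
    -- the replacement of `v ε` by `V`, controlled by `hI`.
    have e : W ε z - w z = (W ε z - (∫ y in cone z, f (v ε y + W ε y)) / 2) +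
        (∫ y in cone z, (f (v ε y + W ε y) - f (v ε y + w y))) / 2 +
        (∫ y in cone z, (f (v ε y + w y) - f (V y + w y))) / 2 := by
      rw [integral_sub i1 i2, integral_sub i2 i3, hwz hz.1]
      ring
    have b1 : |∫ y in cone z, (f (v ε y + W ε y) - f (v ε y + w y))| ≤
        L * ∫ y in cone z, |W ε y - w y| := by
      rw [← integral_const_mul, ← Real.norm_eq_abs]
      refine norm_integral_le_of_norm_le
        ((integrableOn_cone (((hW ε).sub hw).abs) z).const_mul _)
        (Eventually.of_forall fun y => ?_)
      have := hL.dist_le_mul (v ε y + W ε y) (v ε y + w y)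
      simpa [Real.dist_eq] using this
    have b2 : |∫ y in cone z, (f (v ε y + w y) - f (V y + w y))| ≤ δ / A := by
      refine (abs_integral_le_integral_abs).trans (le_trans ?_ h1)
      exact setIntegral_mono_set ((((hcont ε).continuousOn.integrableOn_compact
        (isCompact_Icc.prod isCompact_Icc)).mono_set (region_subset T)).sub (hint _ hfin)).abs
        (Eventually.of_forall fun _ => abs_nonneg _) (cone_subset_region hz).eventuallyLE
    rw [e]
    refine (abs_add_three _ _ _).trans ?_
    rw [abs_div, abs_div, abs_two]
    have := h2 z hz
    linarith
  have := gronwall_cone (((hW ε).sub hw).abs) (by positivity) key (by positivity) hz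
  refine this.trans (le_of_eq ?_)
  rw [show 2 * (δ / A) * Real.exp ((4 * (L / 2 : ℝ) * T + 1) * T) = δ / A * A by rw [hA]; ring]
  field_simp


/-! ### Time reflection -/

/-- The reflection `(x, t) ↦ (x, c - t)`. -/
def timeReflect (c : ℝ) : (ℝ × ℝ) ≃ₜ (ℝ × ℝ) := (Homeomorph.refl ℝ).prodCongr (Homeomorph.subLeft c)

@[simp] lemma timeReflect_apply (c : ℝ) (z : ℝ × ℝ) : timeReflect c z = (z.1, c - z.2) := rfl

lemma measurePreserving_timeReflect (c : ℝ) :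
    MeasurePreserving (timeReflect c) (volume : Measure (ℝ × ℝ)) volume :=
  (MeasurePreserving.id volume).prod (Measure.measurePreserving_sub_left volume c)

lemma contDiff_timeReflect (c : ℝ) : ContDiff ℝ ∞ (timeReflect c) :=
  contDiff_fst.prodMk (contDiff_const.sub contDiff_snd)

lemma fderiv_comp_timeReflect {r : ℝ × ℝ → ℝ} (hr : ContDiff ℝ ∞ r) (c : ℝ) (z h : ℝ × ℝ) :
    fderiv ℝ (fun y => r (timeReflect c y)) z h = fderiv ℝ r (timeReflect c z) (h.1, -h.2) := by
  have h1 : HasFDerivAt (timeReflect c) ((ContinuousLinearMap.fst ℝ ℝ ℝ).prod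
      (-ContinuousLinearMap.snd ℝ ℝ ℝ)) z :=
    hasFDerivAt_fst.prodMk (hasFDerivAt_snd.const_sub c)
  have h2 := ((hr.differentiable (by simp)) (timeReflect c z)).hasFDerivAt.comp z h1
  change fderiv ℝ (r ∘ timeReflect c) z h = _
  rw [h2.fderiv]
  simp

/-- Time enters the operator through two derivatives, whose sign changes cancel. -/
lemma box_comp_timeReflect {r : ℝ × ℝ → ℝ} (hr : ContDiff ℝ ∞ r) (c : ℝ) (z : ℝ × ℝ) :
    box (fun y => r (timeReflect c y)) z = box r (timeReflect c z) := by
  have e1 : (fun y => fderiv ℝ (fun y => r (timeReflect c y)) y (0, 1)) =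
      fun y => (fun x => -fderiv ℝ r x (0, 1)) (timeReflect c y) := by
    funext y
    have e : ((0 : ℝ), -(1 : ℝ)) = -(0, 1) := by simp
    rw [fderiv_comp_timeReflect hr, e, map_neg]
  have e2 : (fun y => fderiv ℝ (fun y => r (timeReflect c y)) y (1, 0)) =
      fun y => (fun x => fderiv ℝ r x (1, 0)) (timeReflect c y) := by
    funext y
    rw [fderiv_comp_timeReflect hr]
    simp
  rw [box, e1, e2, fderiv_comp_timeReflect (contDiff_dir hr _).neg, fderiv_comp_timeReflect (contDiff_dir hr _),
    box]
  have e3 : ((0 : ℝ), -(1 : ℝ)) = -(0, 1) := by simp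
  simp only [neg_zero, e3, map_neg]
  rw [show (fun x => -fderiv ℝ r x (0, 1)) = -fun x => fderiv ℝ r x (0, 1) from rfl, fderiv_neg]
  simp

/-! ### Test functions with prescribed image under the wave operator -/

/-- The open forward light cone with vertex `z`. -/
def fcone (z : ℝ × ℝ) : Set (ℝ × ℝ) := {y | |y.1 - z.1| < y.2 - z.2}

lemma measurableSet_fcone (z : ℝ × ℝ) : MeasurableSet (fcone z) :=
  measurableSet_lt (measurable_fst.sub_const _).abs (measurable_snd.sub_const _)

/-- A smooth function that vanishes at late times is recovered from its image under the wave
operator. -/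
lemma integral_fcone_box {g : ℝ × ℝ → ℝ} (hg : ContDiff ℝ ∞ g) (hc : HasCompactSupport g)
    (z : ℝ × ℝ) : (∫ y in fcone z, box g y) / 2 = g z := by
  obtain ⟨R, hR⟩ := hc.isBounded.subset_closedBall (0 : ℝ × ℝ)
  have hbox : ∀ y, y ∉ tsupport g → box g y = 0 := fun y hy => by
    have h1 : ∀ h k : ℝ × ℝ, fderiv ℝ (fun y => fderiv ℝ g y h) y k = 0 := fun h k => by
      rw [fderiv_fderiv_apply hg]
      have : fderiv ℝ (fderiv ℝ g) y = 0 := image_eq_zero_of_notMem_tsupport fun hm =>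
        hy (tsupport_fderiv_subset ℝ (tsupport_fderiv_subset ℝ hm))
      simp [this]
    rw [box, h1, h1, sub_zero]
  -- A time later than the support of `g` and than `z`. Reflection in it turns vanishing at late
  -- times into vanishing initial data for Duhamel's formula.
  set T : ℝ := max (R + 1) (z.2 + 1) with hT
  have hfar : ∀ y : ℝ × ℝ, T ≤ y.2 → y ∉ tsupport g := fun y hy hm => by
    have h1 := hR hm
    rw [mem_closedBall_zero_iff, Prod.norm_def] at h1
    have h2 := (le_abs_self _).trans ((le_max_right _ _).trans h1)
    linarith [le_max_left (R + 1) (z.2 + 1)]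
  have hTz : z.2 + 1 ≤ T := le_max_right _ _
  have hr : ContDiff ℝ ∞ fun y => g (timeReflect T y) := hg.comp (contDiff_timeReflect T)
  have h1 := duhamel hr (timeReflect T z) (by simp; linarith)
  have h2 : ∀ y : ℝ, g (timeReflect T (y, 0)) = 0 := fun y =>
    image_eq_zero_of_notMem_tsupport (hfar _ (by simp))
  have h3 : ∀ y : ℝ, fderiv ℝ (fun y => g (timeReflect T y)) (y, 0) (0, 1) = 0 := fun y => by
    have : fderiv ℝ g (timeReflect T (y, 0)) = 0 := image_eq_zero_of_notMem_tsupport fun hm =>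
      hfar _ (by simp) (tsupport_fderiv_subset ℝ hm)
    rw [fderiv_comp_timeReflect hg, this, _root_.zero_apply]
  simp only [freeWave, h2, h3, box_comp_timeReflect hg] at h1
  have h4 : timeReflect T (timeReflect T z) = z := by simp
  rw [h4] at h1
  rw [h1]
  simp only [add_zero, zero_div, intervalIntegral.integral_zero, zero_add]
  congr 1
  rw [← integral_indicator (measurableSet_cone _), ← integral_indicator (measurableSet_fcone _),
    ← (measurePreserving_timeReflect T).integral_comp (timeReflect T).measurableEmbedding]
  congr 1
  ext y
  -- The backward cone is cut off at time 0 and the forward cone is not; the part of the latter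
  -- beyond time `T` lies outside the support of `g`.
  by_cases hy : T ≤ (timeReflect T y).2
  · have : box g (timeReflect T y) = 0 := hbox _ (hfar _ hy)
    classical rw [Set.indicator_apply, Set.indicator_apply, this, ite_self, ite_self]
  · have hy' : 0 < y.2 := by simpa using hy
    simp only [Set.indicator_apply, fcone, cone, Set.mem_ofPred_eq, timeReflect_apply, hy', true_and,
      sub_right_comm T y.2 z.2]

/-- The integral kernel of the backward wave equation. -/
def kernel : ℝ × ℝ → ℝ := {y | |y.1| < -y.2}.indicator fun _ => 1 / 2

lemma locallyIntegrable_kernel : LocallyIntegrable kernel :=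
  (locallyIntegrable_const _).indicator
    (measurableSet_lt measurable_fst.abs measurable_snd.neg)

/-- Writing the forward cone integral as a convolution gives its smoothness and lets derivatives
pass to `g`. -/
lemma kernel_convolution (g : ℝ × ℝ → ℝ) (z : ℝ × ℝ) :
    (convolution kernel g (ContinuousLinearMap.mul ℝ ℝ) volume) z = (∫ y in fcone z, g y) / 2 := by
  rw [convolution_eq_swap, ← integral_indicator (measurableSet_fcone z), ← integral_div]
  congr 1
  ext y
  simp only [kernel, Set.indicator_apply, fcone, Set.mem_ofPred_eq, ContinuousLinearMap.mul_apply',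
    Prod.fst_sub, Prod.snd_sub, neg_sub, abs_sub_comm z.1 y.1]
  split_ifs <;> ring

lemma fderiv_kernel_convolution {g : ℝ × ℝ → ℝ} (hg : ContDiff ℝ ∞ g) (hc : HasCompactSupport g)
    (z h : ℝ × ℝ) :
    fderiv ℝ (convolution kernel g (ContinuousLinearMap.mul ℝ ℝ) volume) z h =
      (convolution kernel (fun y => fderiv ℝ g y h) (ContinuousLinearMap.mul ℝ ℝ) volume) z := by
  have h1 : ContDiff ℝ 1 g := hg.of_le (by exact_mod_cast le_top)
  rw [(hc.hasFDerivAt_convolution_right (ContinuousLinearMap.mul ℝ ℝ) locallyIntegrable_kernel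
    h1 z).fderiv, convolution_precompR_apply _ locallyIntegrable_kernel (hc.fderiv ℝ)
    (h1.continuous_fderiv one_ne_zero)]

/-- The operator commutes with the convolution, and the convolution with `box g` returns `g` by
`integral_fcone_box`. So a left inverse is also a right inverse. -/
lemma box_kernel_convolution {g : ℝ × ℝ → ℝ} (hg : ContDiff ℝ ∞ g) (hc : HasCompactSupport g)
    (z : ℝ × ℝ) :
    box (convolution kernel g (ContinuousLinearMap.mul ℝ ℝ) volume) z = g z := by
  have h1 : ∀ h : ℝ × ℝ, fderiv ℝ (fun y => fderiv ℝ
      (convolution kernel g (ContinuousLinearMap.mul ℝ ℝ) volume) y h) z h =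
      (∫ y in fcone z, fderiv ℝ (fun y => fderiv ℝ g y h) y h) / 2 := fun h => by
    have e : (fun y => fderiv ℝ (convolution kernel g (ContinuousLinearMap.mul ℝ ℝ) volume) y h) =
        convolution kernel (fun y => fderiv ℝ g y h) (ContinuousLinearMap.mul ℝ ℝ) volume :=
      funext fun y => fderiv_kernel_convolution hg hc y h
    have hch : HasCompactSupport fun y => fderiv ℝ g y h := hc.fderiv_apply ℝ h
    rw [e, fderiv_kernel_convolution (contDiff_dir hg h) hch, kernel_convolution]
  have hi : ∀ h : ℝ × ℝ, IntegrableOn (fun y => fderiv ℝ (fun y => fderiv ℝ g y h) y h)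
      (fcone z) := fun h =>
    ((contDiff_dir (contDiff_dir hg h) h).continuous.integrable_of_hasCompactSupport
      ((hc.fderiv_apply ℝ h).fderiv_apply ℝ h)).integrableOn
  rw [box, h1, h1, ← integral_fcone_box hg hc z, ← sub_div, ← integral_sub (hi _) (hi _)]
  rfl

lemma box_congr {r s : ℝ × ℝ → ℝ} {z : ℝ × ℝ} (h : r =ᶠ[𝓝 z] s) : box r z = box s z := by
  have h1 : ∀ k : ℝ × ℝ, (fun y => fderiv ℝ r y k) =ᶠ[𝓝 z] fun y => fderiv ℝ s y k := fun k =>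
    h.fderiv.mono fun y (hy : fderiv ℝ r y = fderiv ℝ s y) => by simp only [hy]
  rw [box, box, (h1 _).fderiv_eq, (h1 _).fderiv_eq]

lemma waveTest_apply (ψ : PlaneTest) (z : ℝ × ℝ) : waveTest ψ z = box ψ z := by
  have h1 : ∀ h : ℝ × ℝ, (∂_{h} (∂_{h} ψ) : PlaneTest) z =
      fderiv ℝ (fun y => fderiv ℝ ψ y h) z h := fun h => by
    rw [coe_lineDeriv_two]
    rw [show ⇑(∂_{h} ψ : PlaneTest) = fun y => fderiv ℝ ψ y h from
      funext fun y => coe_lineDeriv_two ψ h y]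
  rw [box, ← h1, ← h1]
  rfl

/-- Solves the backward wave equation with source `g`. The solution vanishes at late times but
spreads into the past, so it is cut off below t = −1. The result need not vanish at t = 0, which is
how the weak formulation transmits the zero initial data. -/
lemma exists_planeTest {g : ℝ × ℝ → ℝ} (hg : ContDiff ℝ ∞ g) (hc : HasCompactSupport g) :
    ∃ ψ : PlaneTest, ∀ z : ℝ × ℝ, 0 < z.2 →
      ψ z = (∫ y in fcone z, g y) / 2 ∧ waveTest ψ z = g z := by
  obtain ⟨R, hR⟩ := hc.isBounded.subset_closedBall (0 : ℝ × ℝ)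
  set k := convolution kernel g (ContinuousLinearMap.mul ℝ ℝ) volume with hk
  have hks : ContDiff ℝ ∞ k :=
    hc.contDiff_convolution_right (n := ⊤) _ locallyIntegrable_kernel hg
  let ψ : PlaneTest :=
    { toFun := fun z => Real.smoothTransition (z.2 + 2) * k z
      contDiff' := (Real.smoothTransition.contDiff.comp (contDiff_snd.add contDiff_const)).mul hks
      hasCompactSupport' := by
        -- A point with z.2 > −2 whose forward cone meets the ball of radius R satisfies |z.1| ≤ R +
        -- (R + 2).
        refine HasCompactSupport.intro (isCompact_closedBall (0 : ℝ × ℝ) (2 * |R| + 2))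
          fun z hz => ?_
        by_contra hne
        have h1 : 0 < z.2 + 2 := by
          by_contra h
          exact hne (by rw [Real.smoothTransition.zero_of_nonpos (not_lt.mp h), zero_mul])
        have h2 : ∃ y, y ∈ fcone z ∧ g y ≠ 0 := by
          by_contra! h
          refine hne ?_
          rw [hk, kernel_convolution, setIntegral_eq_zero_of_forall_eq_zero h]
          simp
        obtain ⟨y, hy, hgy⟩ := h2
        have h3 := hR (subset_tsupport _ hgy)
        rw [mem_closedBall_zero_iff, Prod.norm_def] at h3
        have h4 : |y.1| ≤ R := (le_max_left _ _).trans h3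
        have h5 : |y.2| ≤ R := (le_max_right _ _).trans h3
        have h6 : |y.1 - z.1| < y.2 - z.2 := hy
        rw [abs_lt] at h6
        rw [abs_le] at h4 h5
        have h7 := le_abs_self R
        refine hz (mem_closedBall_zero_iff.mpr (max_le ?_ ?_)) <;>
          rw [Real.norm_eq_abs, abs_le] <;> constructor <;> linarith
      tsupport_subset' := fun _ _ => trivial }
  refine ⟨ψ, fun z hz => ⟨?_, ?_⟩⟩
  · change Real.smoothTransition (z.2 + 2) * k z = _
    rw [Real.smoothTransition.one_of_one_le (by linarith), one_mul, hk, kernel_convolution]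
  · rw [waveTest_apply, ← box_kernel_convolution hg hc z]
    refine box_congr ?_
    filter_upwards [(isOpen_lt continuous_const continuous_snd).mem_nhds hz] with y hy
    have hy' : 0 < y.2 := hy
    change Real.smoothTransition (y.2 + 2) * k y = _
    rw [Real.smoothTransition.one_of_one_le (by linarith), one_mul]


/-! ### Weak solutions satisfy Duhamel's formula almost everywhere -/

/-- The upper half of `IsWeakSolution`. -/
def IsUpperWeakSolution (w F : ℝ × ℝ → ℝ) : Prop :=
  ∀ ψ : PlaneTest, ∫ z in {z : ℝ × ℝ | 0 < z.2}, w z * waveTest ψ z =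
      ∫ z in {z : ℝ × ℝ | 0 < z.2}, F z * ψ z

lemma measurableSet_upper : MeasurableSet {z : ℝ × ℝ | 0 < z.2} :=
  measurableSet_lt measurable_const measurable_snd

/-- The composition of a test function with the time reflection. -/
def timeReflectTest (ψ : PlaneTest) : PlaneTest where
  toFun z := ψ (timeReflect 0 z)
  contDiff' := ψ.contDiff.comp (contDiff_timeReflect 0)
  hasCompactSupport' := ψ.hasCompactSupport.comp_homeomorph (timeReflect 0)
  tsupport_subset' := fun _ _ => trivial

lemma IsWeakSolution.upper {w F : ℝ × ℝ → ℝ} (h : IsWeakSolution w F) :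
    IsUpperWeakSolution w F := fun ψ => (h ψ).1

/-- Lebesgue measure and the wave operator are invariant under t ↦ −t, so the past can be treated as
a future. -/
lemma IsWeakSolution.lower {w F : ℝ × ℝ → ℝ} (h : IsWeakSolution w F) :
    IsUpperWeakSolution (fun z => w (timeReflect 0 z)) (fun z => F (timeReflect 0 z)) := fun ψ => by
  have e : timeReflect 0 ⁻¹' {z : ℝ × ℝ | z.2 < 0} = {z : ℝ × ℝ | 0 < z.2} := by
    ext z
    simp
  have h1 : ∀ G : ℝ × ℝ → ℝ, ∫ z in {z : ℝ × ℝ | 0 < z.2}, G (timeReflect 0 z) =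
      ∫ z in {z : ℝ × ℝ | z.2 < 0}, G z := fun G => by
    rw [← e]
    exact (measurePreserving_timeReflect 0).setIntegral_preimage_emb (timeReflect 0).measurableEmbedding G _
  have h2 : ∀ z, timeReflect 0 (timeReflect 0 z) = z := fun z => by simp
  have h3 : ∀ z, timeReflectTest ψ (timeReflect 0 z) = ψ z := fun z => by
    change ψ (timeReflect 0 (timeReflect 0 z)) = _
    rw [h2]
  have h4 : ∀ z, waveTest (timeReflectTest ψ) (timeReflect 0 z) = waveTest ψ z := fun z => by
    rw [waveTest_apply, waveTest_apply]
    exact (box_comp_timeReflect ψ.contDiff 0 (timeReflect 0 z)).trans (by rw [h2])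
  have := (h (timeReflectTest ψ)).2
  rw [← h1, ← h1] at this
  simpa only [h3, h4] using this

lemma ball_cone {R : ℝ} {y z : ℝ × ℝ} (hy : y ∈ Metric.closedBall (0 : ℝ × ℝ) R)
    (hz : z ∈ cone y) : z ∈ Metric.closedBall (0 : ℝ × ℝ) (2 * R) := by
  rw [mem_closedBall_zero_iff, Prod.norm_def] at hy ⊢
  have h1 := abs_le.mp ((le_max_left _ _).trans hy)
  have h2 := abs_le.mp ((le_max_right _ _).trans hy)
  have h3 := abs_lt.mp hz.2
  have h4 := hz.1
  refine max_le ?_ ?_ <;> rw [Real.norm_eq_abs, abs_le] <;> constructor <;> linarith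

lemma measurableSet_cone_prod :
    MeasurableSet {q : (ℝ × ℝ) × (ℝ × ℝ) | q.2 ∈ cone q.1} := by
  have : {q : (ℝ × ℝ) × (ℝ × ℝ) | q.2 ∈ cone q.1} =
      {q | 0 < q.2.2} ∩ {q | |q.2.1 - q.1.1| < q.1.2 - q.2.2} := rfl
  rw [this]
  exact (measurableSet_lt (by fun_prop) (by fun_prop)).inter
    (measurableSet_lt ((by fun_prop : Measurable fun q : (ℝ × ℝ) × (ℝ × ℝ) =>
      q.2.1 - q.1.1).abs) (by fun_prop))

/-- Vertices in the support of `g` have truncated cones in a common ball, so the integrand is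
bounded with bounded support. -/
lemma integrable_cone_prod {F g : ℝ × ℝ → ℝ} (hF : AEStronglyMeasurable F volume) {M : ℝ}
    (hM : ∀ z, |F z| ≤ M) (hg : Continuous g) (hc : HasCompactSupport g) :
    Integrable ({q : (ℝ × ℝ) × (ℝ × ℝ) | q.2 ∈ cone q.1}.indicator fun q => F q.2 * g q.1)
      (volume.prod volume) := by
  obtain ⟨R, hR⟩ := hc.isBounded.subset_closedBall (0 : ℝ × ℝ)
  obtain ⟨B, hB⟩ := hg.bounded_above_of_compact_support hc
  have hK : IsCompact (Metric.closedBall (0 : ℝ × ℝ) R ×ˢ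
      Metric.closedBall (0 : ℝ × ℝ) (2 * R)) :=
    (isCompact_closedBall _ _).prod (isCompact_closedBall _ _)
  have hI : Integrable ((Metric.closedBall (0 : ℝ × ℝ) R ×ˢ
      Metric.closedBall (0 : ℝ × ℝ) (2 * R)).indicator fun _ => M * B)
      ((volume : Measure (ℝ × ℝ)).prod (volume : Measure (ℝ × ℝ))) :=
    (integrable_indicator_iff hK.measurableSet).mpr (integrableOn_const hK.measure_lt_top.ne)
  refine hI.mono' ?_ (Eventually.of_forall fun q => ?_)
  · exact (hF.comp_snd.mul (hg.comp continuous_fst).aestronglyMeasurable).indicator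
      measurableSet_cone_prod
  · have hM0 : 0 ≤ M := (abs_nonneg _).trans (hM 0)
    have hB0 : 0 ≤ B := (norm_nonneg _).trans (hB 0)
    by_cases h1 : q.2 ∈ cone q.1 ∧ g q.1 ≠ 0
    · have h2 := hR (subset_tsupport _ h1.2)
      rw [Set.indicator_of_mem (by exact h1.1),
        Set.indicator_of_mem (by exact ⟨h2, ball_cone h2 h1.1⟩), norm_mul]
      exact mul_le_mul (hM _) (hB _) (norm_nonneg _) hM0
    · have : {q : (ℝ × ℝ) × (ℝ × ℝ) | q.2 ∈ cone q.1}.indicator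
          (fun q => F q.2 * g q.1) q = 0 := by
        by_cases h2 : q.2 ∈ cone q.1
        · rw [Set.indicator_of_mem (by exact h2), not_not.mp fun h => h1 ⟨h2, h⟩, mul_zero]
        · exact Set.indicator_of_notMem (s := {q : (ℝ × ℝ) × (ℝ × ℝ) | q.2 ∈ cone q.1}) (a := q)
            h2 _
      rw [this, norm_zero]
      exact Set.indicator_nonneg (fun _ _ => mul_nonneg hM0 hB0) _

/-- The integral over backward cones is the transpose of the integral over forward cones. -/
lemma integral_cone_swap {F g : ℝ × ℝ → ℝ} (hF : AEStronglyMeasurable F volume) {M : ℝ}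
    (hM : ∀ z, |F z| ≤ M) (hg : Continuous g) (hc : HasCompactSupport g) :
    ∫ z in {z : ℝ × ℝ | 0 < z.2}, F z * ∫ y in fcone z, g y =
      ∫ y, (∫ z in cone y, F z) * g y := by
  have hi := integrable_cone_prod hF hM hg hc
  have h1 := integral_integral_swap (f := fun y z =>
    {q : (ℝ × ℝ) × (ℝ × ℝ) | q.2 ∈ cone q.1}.indicator (fun q => F q.2 * g q.1) (y, z)) hi
  rw [← integral_indicator measurableSet_upper]
  symm
  refine Eq.trans ?_ (h1.trans ?_)
  · congr 1
    ext y
    rw [← integral_indicator (measurableSet_cone y), ← integral_mul_const]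
    congr 1
    ext z
    by_cases hz : z ∈ cone y
    · rw [Set.indicator_of_mem hz, Set.indicator_of_mem (by exact hz)]
    · rw [Set.indicator_of_notMem hz, Set.indicator_of_notMem (by exact hz), zero_mul]
  · congr 1
    ext z
    by_cases hz0 : 0 < z.2
    · rw [Set.indicator_of_mem (by exact hz0), ← integral_indicator (measurableSet_fcone z),
        ← integral_const_mul]
      congr 1
      ext y
      -- Above t = 0 the two cone relations are converse to each other; the truncation of `cone` is
      -- the restriction to the upper half-plane.
      have hiff : z ∈ cone y ↔ y ∈ fcone z := by
        simp only [cone, fcone, Set.mem_ofPred_eq, hz0, true_and, abs_sub_comm z.1 y.1]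
      by_cases hz : y ∈ fcone z
      · rw [Set.indicator_of_mem (by exact hiff.mpr hz), Set.indicator_of_mem hz]
      · rw [Set.indicator_of_notMem (by exact fun h => hz (hiff.mp h)),
          Set.indicator_of_notMem hz, mul_zero]
    · rw [Set.indicator_of_notMem (by exact hz0)]
      refine integral_eq_zero_of_ae (Eventually.of_forall fun y => ?_)
      exact Set.indicator_of_notMem (s := {q : (ℝ × ℝ) × (ℝ × ℝ) | q.2 ∈ cone q.1})
        (a := (y, z)) (fun hz : z ∈ cone y => hz0 hz.1) _

lemma locallyIntegrable_integral_cone {F : ℝ × ℝ → ℝ} (hF : AEStronglyMeasurable F volume) {M : ℝ}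
    (hM : ∀ z, |F z| ≤ M) : LocallyIntegrable fun y => ∫ z in cone y, F z := by
  have hM0 : 0 ≤ M := (abs_nonneg _).trans (hM 0)
  have hm : AEStronglyMeasurable (fun y => ∫ z in cone y, F z) volume := by
    have h1 : AEStronglyMeasurable ({q : (ℝ × ℝ) × (ℝ × ℝ) | q.2 ∈ cone q.1}.indicator
        fun q => F q.2) ((volume : Measure (ℝ × ℝ)).prod (volume : Measure (ℝ × ℝ))) :=
      hF.comp_snd.indicator measurableSet_cone_prod
    refine h1.integral_prod_right'.congr (Eventually.of_forall fun y => ?_)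
    simp only [← integral_indicator (measurableSet_cone y)]
    rfl
  rw [locallyIntegrable_iff]
  intro K hK
  obtain ⟨R, hR⟩ := hK.isBounded.subset_closedBall (0 : ℝ × ℝ)
  have hb : ∀ y ∈ K, ‖∫ z in cone y, F z‖ ≤
      M * volume.real (Metric.closedBall (0 : ℝ × ℝ) (2 * R)) := fun y hy => by
    have hs : cone y ⊆ Metric.closedBall (0 : ℝ × ℝ) (2 * R) := fun z hz => ball_cone (hR hy) hz
    have hf : volume (Metric.closedBall (0 : ℝ × ℝ) (2 * R)) < ⊤ := measure_closedBall_lt_top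
    refine (norm_setIntegral_le_of_norm_le_const ((measure_mono hs).trans_lt hf)
      fun z _ => hM z).trans ?_
    exact mul_le_mul_of_nonneg_left (measureReal_mono hs hf.ne) hM0
  exact Measure.integrableOn_of_bounded hK.measure_lt_top.ne hm
    ((ae_restrict_iff' hK.measurableSet).mpr (Eventually.of_forall hb))

/-- For `g` supported in t > 0, the test function of `exists_planeTest` turns the weak equation into
∫ w g = ½ ∫ F(z) ∫_{fcone z} g. Fubini moves the cone onto `F`, and the fundamental lemma of the
calculus of variations gives equality almost everywhere. -/
lemma IsUpperWeakSolution.duhamel {w F : ℝ × ℝ → ℝ} (h : IsUpperWeakSolution w F)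
    (hw : Continuous w) (hF : AEStronglyMeasurable F volume) {M : ℝ} (hM : ∀ z, |F z| ≤ M) :
    ∀ᵐ z : ℝ × ℝ, 0 < z.2 → w z = (∫ y in cone z, F y) / 2 := by
  have hH := locallyIntegrable_integral_cone hF hM
  have hU : IsOpen {z : ℝ × ℝ | 0 < z.2} := isOpen_lt continuous_const continuous_snd
  have hl : LocallyIntegrable fun z => w z - (1 / 2 : ℝ) • ∫ y in cone z, F y :=
    hw.locallyIntegrable.sub (hH.smul (1 / 2 : ℝ))
  have := hU.ae_eq_zero_of_integral_contDiff_smul_eq_zero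
    (f := fun z => w z - (1 / 2 : ℝ) • ∫ y in cone z, F y) (μ := volume)
    (hl.locallyIntegrableOn _) fun g hg hc hs => ?_
  · refine this.mono fun z hz hz0 => ?_
    have := hz hz0
    rw [smul_eq_mul] at this
    linarith
  obtain ⟨ψ, hψ⟩ := exists_planeTest hg hc
  have h1 := h ψ
  have e1 : ∫ z in {z : ℝ × ℝ | 0 < z.2}, w z * waveTest ψ z = ∫ z, w z * g z := by
    rw [← setIntegral_eq_integral_of_forall_compl_eq_zero (s := {z : ℝ × ℝ | 0 < z.2})
      (f := fun z => w z * g z)]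
    · exact setIntegral_congr_fun measurableSet_upper fun z hz => by
        simp only [(hψ z hz).2]
    · intro z hz
      simp only [image_eq_zero_of_notMem_tsupport fun hm => hz (hs hm), mul_zero]
  have e2 : ∫ z in {z : ℝ × ℝ | 0 < z.2}, F z * ψ z =
      (∫ y, (∫ z in cone y, F z) * g y) / 2 := by
    rw [← integral_cone_swap hF hM hg.continuous hc, ← integral_div]
    refine setIntegral_congr_fun measurableSet_upper fun z hz => ?_
    simp only [(hψ z hz).1]
    ring
  rw [e1, e2] at h1
  have i1 : Integrable fun z => w z * g z :=
    (hw.mul hg.continuous).integrable_of_hasCompactSupport hc.mul_left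
  have i2 : Integrable fun z => g z • ∫ y in cone z, F y :=
    hH.integrable_smul_left_of_hasCompactSupport hg.continuous hc
  have e3 : ∫ z, g z • (w z - (1 / 2 : ℝ) • ∫ y in cone z, F y) =
      (∫ z, w z * g z) - (∫ y, (∫ z in cone y, F z) * g y) / 2 := by
    rw [← integral_div, ← integral_sub i1]
    · congr 1
      ext z
      simp only [smul_eq_mul]
      ring
    · refine (i2.div_const 2).congr (Eventually.of_forall fun z => ?_)
      simp only [smul_eq_mul]
      ring
  rw [e3, h1, sub_self]


/-! ### Convolution of distributions and test functions on the line -/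

/-- The space of test functions on the line. -/
abbrev LineTest : Type := 𝓓((⊤ : Opens ℝ), ℝ)

/-- The convolution `y ↦ ∫ f(x) η(y - x) dx`. -/
def smear (f : ℝ → ℝ) (hf : LocallyIntegrable f) (hc : HasCompactSupport f) (η : LineTest) :
    LineTest where
  toFun := convolution f η (ContinuousLinearMap.mul ℝ ℝ) volume
  contDiff' := η.hasCompactSupport.contDiff_convolution_right (n := ⊤) _ hf η.contDiff
  hasCompactSupport' := HasCompactSupport.convolution _ hc η.hasCompactSupport
  tsupport_subset' := fun _ _ => trivial

/-- All derivatives fall on `η`, so `f` may jump, as the truncations to `Set.Ioc` do. -/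
lemma iteratedDeriv_smear {f : ℝ → ℝ} (hf : LocallyIntegrable f) (hc : HasCompactSupport f)
    (η : LineTest) (i : ℕ) (y : ℝ) :
    iteratedDeriv i (smear f hf hc η) y = ∫ x, f x * iteratedDeriv i η (y - x) := by
  induction i generalizing η y with
  | zero => rfl
  | succ i ih =>
    have h : deriv (smear f hf hc η) = smear f hf hc (∂_{(1 : ℝ)} η) := funext fun y => by
      have := (η.hasCompactSupport.hasDerivAt_convolution_right (ContinuousLinearMap.mul ℝ ℝ) hf
        (η.contDiff.of_le (by exact_mod_cast le_top)) y).deriv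
      rw [← coe_lineDeriv] at this
      exact this
    rw [iteratedDeriv_succ', h, ih, coe_lineDeriv, ← iteratedDeriv_succ']

lemma lipschitz_iteratedDeriv (η : LineTest) (i : ℕ) {B : ℝ}
    (hB : ∀ z, |iteratedDeriv (i + 1) η z| ≤ B) (x y : ℝ) :
    |iteratedDeriv i η x - iteratedDeriv i η y| ≤ B * |x - y| := by
  have hs : ContDiff ℝ ∞ (iteratedDeriv i η) := by
    rw [iteratedDeriv_eq_iterate]
    exact (η.contDiff : ContDiff ℝ ∞ η).iterate_deriv i
  exact convex_univ.norm_image_sub_le_of_norm_deriv_le (f := iteratedDeriv i η) (C := B)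
    (fun y _ => (hs.differentiable (by simp)) y)
    (fun y _ => by rw [← iteratedDeriv_succ]; exact hB y) (Set.mem_univ y) (Set.mem_univ x)

lemma norm_iteratedFDeriv_sub_le {f g : LineTest} {i : ℕ} {y M : ℝ}
    (h : |iteratedDeriv i f y - iteratedDeriv i g y| ≤ M) :
    ‖iteratedFDeriv ℝ i (f - g : LineTest) y‖ ≤ M := by
  have c : ∀ φ : LineTest, ContDiffAt ℝ i φ y := fun φ =>
    (φ.contDiff.of_le (by exact_mod_cast le_top)).contDiffAt
  rw [norm_iteratedFDeriv_eq_norm_iteratedDeriv]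
  change ‖iteratedDeriv i (⇑f - ⇑g) y‖ ≤ M
  rwa [iteratedDeriv_sub (c _) (c _)]

lemma conv_eq (a : 𝓓'((⊤ : Opens ℝ), ℝ)) (θ : LineTest) (x : ℝ) : conv a θ x = a (reflect θ x) :=
  rfl

lemma smear_eq_zero {f : ℝ → ℝ} (hf : LocallyIntegrable f) (hc : HasCompactSupport f)
    (η : LineTest) {K : Set ℝ} (hK : ∀ x y, f x ≠ 0 → η (y - x) ≠ 0 → y ∈ K) {y : ℝ}
    (hy : y ∉ K) : smear f hf hc η y = 0 := by
  change ∫ x, f x * η (y - x) = 0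
  refine integral_eq_zero_of_ae (Eventually.of_forall fun x => ?_)
  by_contra hne
  exact hy (hK x y (left_ne_zero_of_mul hne) (right_ne_zero_of_mul hne))

section Interchange

variable (a : 𝓓'((⊤ : Opens ℝ), ℝ)) (θ A : LineTest)

lemma locallyIntegrable_Ioc (s t : ℝ) : LocallyIntegrable ((Set.Ioc s t).indicator A) :=
  (A.continuous.locallyIntegrable).indicator measurableSet_Ioc

lemma hasCompactSupport_Ioc (s t : ℝ) : HasCompactSupport ((Set.Ioc s t).indicator A) :=
  A.hasCompactSupport.mono (by rw [Set.support_indicator]; exact Set.inter_subset_right)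

/-- The test function `y ↦ ∫_s^t A(x) θ(x - y) dx`. -/
def smearIoc (s t : ℝ) : LineTest :=
  smear _ (locallyIntegrable_Ioc A s t) (hasCompactSupport_Ioc A s t) (reflect θ 0)

lemma reflect_eq (x y : ℝ) : reflect θ x y = reflect θ 0 (y - x) := by
  change θ (x - y) = θ (0 - (y - x))
  congr 1
  ring

lemma iteratedDeriv_smearIoc {s t : ℝ} (i : ℕ) (y : ℝ) :
    iteratedDeriv i (smearIoc θ A s t) y =
      ∫ x in Set.Ioc s t, A x * iteratedDeriv i (reflect θ 0) (y - x) := by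
  rw [smearIoc, iteratedDeriv_smear, ← integral_indicator measurableSet_Ioc]
  congr 1
  ext x
  by_cases h : x ∈ Set.Ioc s t
  · rw [Set.indicator_of_mem h, Set.indicator_of_mem h]
  · rw [Set.indicator_of_notMem h, Set.indicator_of_notMem h, zero_mul]

lemma iteratedDeriv_smul_reflect (m c : ℝ) (i : ℕ) (y : ℝ) :
    iteratedDeriv i (m • reflect θ c : LineTest) y =
      m * iteratedDeriv i (reflect θ 0) (y - c) := by
  change iteratedDeriv i (fun z => m * reflect θ c z) y = _
  rw [iteratedDeriv_const_mul_field]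
  have : (reflect θ c : ℝ → ℝ) = fun z => reflect θ 0 (z - c) := funext (reflect_eq θ c)
  rw [this, iteratedDeriv_comp_sub_const]

/-- On a short interval the integral of translates is its length times the integrand at `c`, with
quadratic error in every derivative. All supports stay in one compact set, so a single seminorm
bound for `a` gives a uniform constant. This is the derivative of the pairing with respect to an
endpoint. -/
lemma exists_smearIoc_bound : ∃ C : ℝ, ∀ s t c : ℝ, s ≤ t → c ∈ Set.Icc s t →
    |a (smearIoc θ A s t) - (t - s) * (A c * conv a θ c)| ≤ C * (t - s) ^ 2 := by
  set K : Set ℝ := (fun p : ℝ × ℝ => p.1 - p.2) '' (tsupport A ×ˢ tsupport θ) with hKdef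
  have hK : IsCompact K := (A.hasCompactSupport.prod θ.hasCompactSupport).image (by fun_prop)
  obtain ⟨N, C, hC, hb⟩ := exists_dist_bound a hK
  obtain ⟨B, hB, hB'⟩ := exists_bound_iteratedDeriv (reflect θ 0) (N + 1)
  obtain ⟨D, hD, hD'⟩ := exists_bound_iteratedDeriv A 1
  -- The product A(x) η(y − x) has Lipschitz constant 2DB in x, since `D` and `B` bound both the
  -- factors and their first derivatives.
  refine ⟨C * (2 * (D * B)), fun s t c hst hc => ?_⟩
  have e : a (smearIoc θ A s t) - (t - s) * (A c * conv a θ c) =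
      a (smearIoc θ A s t - ((t - s) * A c) • reflect θ c) := by
    rw [map_sub, map_smul, smul_eq_mul, mul_assoc]
    rfl
  have hmem : ∀ x y : ℝ, A x ≠ 0 → θ (x - y) ≠ 0 → y ∈ K := fun x y h1 h2 =>
    ⟨(x, x - y), ⟨subset_tsupport _ h1, subset_tsupport _ h2⟩, by simp⟩
  rw [e, mul_assoc]
  refine hb _ ?_ _ (by positivity) fun i hi y => ?_
  · refine closure_minimal (fun y hy => ?_) hK.isClosed
    by_contra hn
    apply hy
    change smearIoc θ A s t y - ((t - s) * A c) * θ (c - y) = 0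
    have h1 : smearIoc θ A s t y = 0 := by
      refine smear_eq_zero _ _ _ (K := K) (fun x y h1 h2 => ?_) hn
      rw [← reflect_eq] at h2
      exact hmem x y (fun h => h1 (by simp [Set.indicator_apply, h])) h2
    have h2 : A c * θ (c - y) = 0 := by
      by_contra hne
      exact hn (hmem c y (left_ne_zero_of_mul hne) (right_ne_zero_of_mul hne))
    rw [h1, mul_assoc, h2]
    ring
  · refine norm_iteratedFDeriv_sub_le ?_
    rw [iteratedDeriv_smearIoc, iteratedDeriv_smul_reflect]
    set η := iteratedDeriv i (reflect θ 0) with hη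
    have hηc : Continuous η := (reflect θ 0).contDiff.continuous_iteratedDeriv i
      (by exact_mod_cast le_top)
    have hint : IntegrableOn (fun x => A x * η (y - x)) (Set.Ioc s t) :=
      ((A.continuous.mul (hηc.comp (continuous_const.sub continuous_id))).integrableOn_Icc).mono_set
        Set.Ioc_subset_Icc_self
    have hlip : ∀ x ∈ Set.Ioc s t, ‖A x * η (y - x) - A c * η (y - c)‖ ≤
        2 * (D * B) * (t - s) := fun x hx => by
      have hxc : |x - c| ≤ t - s := by
        rw [abs_le]; constructor <;> linarith [hx.1, hx.2, hc.1, hc.2]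
      have h1 : |A x - A c| ≤ D * |x - c| := lipschitz_iteratedDeriv A 0 (hD' 1 le_rfl) x c
      have h2 : |η (y - x) - η (y - c)| ≤ B * |x - c| := by
        refine (lipschitz_iteratedDeriv (reflect θ 0) i (hB' (i + 1) (by omega)) _ _).trans ?_
        rw [show y - x - (y - c) = -(x - c) by ring, abs_neg]
      have h3 : |η (y - x)| ≤ B := hB' i (by omega) _
      have h4 : |A c| ≤ D := hD' 0 (by omega) c
      calc ‖A x * η (y - x) - A c * η (y - c)‖
          = |(A x - A c) * η (y - x) + A c * (η (y - x) - η (y - c))| := by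
            rw [Real.norm_eq_abs]; congr 1; ring
        _ ≤ |A x - A c| * |η (y - x)| + |A c| * |η (y - x) - η (y - c)| := by
            rw [← abs_mul, ← abs_mul]; exact abs_add_le _ _
        _ ≤ (D * |x - c|) * B + D * (B * |x - c|) := by gcongr
        _ = 2 * (D * B) * |x - c| := by ring
        _ ≤ _ := by gcongr
    have hvol : volume.real (Set.Ioc s t) = t - s := by
      rw [measureReal_def, Real.volume_Ioc, ENNReal.toReal_ofReal (by linarith)]
    have e2 : (∫ x in Set.Ioc s t, A x * η (y - x)) - (t - s) * A c * η (y - c) =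
        ∫ x in Set.Ioc s t, (A x * η (y - x) - A c * η (y - c)) := by
      rw [integral_sub hint (integrableOn_const (by simp)), setIntegral_const, hvol, smul_eq_mul,
        mul_assoc]
    rw [e2]
    refine (norm_setIntegral_le_of_norm_le_const (by simp) hlip).trans (le_of_eq ?_)
    rw [hvol]
    ring

lemma smearIoc_add {r s t : ℝ} (hrs : r ≤ s) (hst : s ≤ t) :
    smearIoc θ A r t = smearIoc θ A r s + smearIoc θ A s t := by
  ext y
  change iteratedDeriv 0 (smearIoc θ A r t) y =
    iteratedDeriv 0 (smearIoc θ A r s) y + iteratedDeriv 0 (smearIoc θ A s t) y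
  have hi : ∀ p q : ℝ, IntegrableOn (fun x => A x * iteratedDeriv 0 (reflect θ 0) (y - x))
      (Set.Ioc p q) := fun p q =>
    ((A.continuous.mul ((reflect θ 0).continuous.comp
      (continuous_const.sub continuous_id))).integrableOn_Icc).mono_set Set.Ioc_subset_Icc_self
  rw [iteratedDeriv_smearIoc, iteratedDeriv_smearIoc, iteratedDeriv_smearIoc,
    ← Set.Ioc_union_Ioc_eq_Ioc hrs hst,
    setIntegral_union (Set.Ioc_disjoint_Ioc_of_le le_rfl) measurableSet_Ioc (hi _ _) (hi _ _)]

/-- A distribution can be interchanged with an integral of translates of a test function. -/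
lemma integral_conv_mul {P : LineTest} (hP : ∀ y, P y = ∫ x, A x * θ (x - y)) :
    ∫ x, conv a θ x * A x = a P := by
  obtain ⟨R, hR⟩ := A.hasCompactSupport.isBounded.subset_closedBall (0 : ℝ)
  set r : ℝ := |R| + 1
  have hA0 : ∀ x, x ∉ Set.Ioc (-r) r → A x = 0 := fun x hx => by
    refine image_eq_zero_of_notMem_tsupport fun hm => hx ?_
    have := hR hm
    rw [mem_closedBall_zero_iff, Real.norm_eq_abs] at this
    have h2 := abs_le.mp (this.trans (le_abs_self R))
    exact ⟨by linarith [h2.1], by linarith [h2.2]⟩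
  obtain ⟨C, hC⟩ := exists_smearIoc_bound a θ A
  have hr : -r ≤ r := by
    have : 0 ≤ r := by positivity
    linarith
  -- The interchange is reduced to the fundamental theorem of calculus in the upper endpoint. The
  -- base point −r − 1 leaves room to the left of s = −r, since `Set.Ioc` carries no orientation.
  have hd : ∀ s ∈ Set.uIcc (-r) r, HasDerivAt (fun s => a (smearIoc θ A (-r - 1) s))
      (A s * conv a θ s) s := fun s hs => by
    rw [Set.uIcc_of_le hr] at hs
    rw [hasDerivAt_iff_isLittleO_nhds_zero]
    have hO : (fun h => a (smearIoc θ A (-r - 1) (s + h)) - a (smearIoc θ A (-r - 1) s) -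
        h • (A s * conv a θ s)) =O[𝓝 0] fun h : ℝ => h ^ 2 := by
      refine Asymptotics.IsBigO.of_bound |C| ?_
      filter_upwards [Ioi_mem_nhds (show -r - 1 - s < 0 by linarith [hs.1])] with h hh
      have hh' : -r - 1 ≤ s + h := by linarith [Set.mem_Ioi.mp hh]
      rw [Real.norm_eq_abs, Real.norm_eq_abs, abs_of_nonneg (sq_nonneg h), smul_eq_mul]
      -- The evaluation point is s in both cases: the left endpoint for h ≥ 0, the right endpoint
      -- for h ≤ 0.
      rcases le_total 0 h with h0 | h0
      · rw [smearIoc_add θ A (show -r - 1 ≤ s by linarith [hs.1]) (show s ≤ s + h by linarith), map_add, add_sub_cancel_left]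
        have := hC s (s + h) s (by linarith) ⟨le_rfl, by linarith⟩
        rw [add_sub_cancel_left] at this
        exact this.trans (by gcongr; exact le_abs_self C)
      · rw [smearIoc_add θ A hh' (show s + h ≤ s by linarith), map_add]
        have := hC (s + h) s s (by linarith) ⟨by linarith, le_rfl⟩
        rw [show s - (s + h) = -h by ring, neg_sq] at this
        rw [← abs_neg]
        refine le_trans (le_of_eq ?_) (this.trans (by gcongr; exact le_abs_self C))
        congr 1
        ring
    refine hO.trans_isLittleO ?_
    simpa using Asymptotics.isLittleO_pow_id (𝕜 := ℝ) (n := 2) (by norm_num)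
  have hgc : Continuous fun x => A x * conv a θ x :=
    A.continuous.mul (contDiff_conv a θ).continuous
  have hftc := intervalIntegral.integral_eq_sub_of_hasDerivAt hd
    (hgc.intervalIntegrable _ _)
  have h0 : smearIoc θ A (-r - 1) (-r) = 0 := by
    ext y
    change iteratedDeriv 0 (smearIoc θ A (-r - 1) (-r)) y = 0
    rw [iteratedDeriv_smearIoc]
    refine setIntegral_eq_zero_of_forall_eq_zero fun x hx => ?_
    rw [hA0 x fun h => absurd h.1 (not_lt.mpr hx.2), zero_mul]
  have h1 : smearIoc θ A (-r - 1) r = P := by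
    ext y
    rw [hP]
    change iteratedDeriv 0 (smearIoc θ A (-r - 1) r) y = _
    rw [iteratedDeriv_smearIoc, setIntegral_eq_integral_of_forall_compl_eq_zero
      fun x hx => by
        rw [hA0 x fun h => hx ⟨by linarith [h.1], h.2⟩, zero_mul]]
    congr 1
    ext x
    rw [iteratedDeriv_zero, ← reflect_eq]
    rfl
  rw [h0, h1, map_zero, sub_zero, intervalIntegral.integral_of_le hr,
    setIntegral_eq_integral_of_forall_compl_eq_zero fun x hx => by rw [hA0 x hx, zero_mul]] at hftc
  rw [← hftc]
  congr 1
  ext x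
  ring

end Interchange


/-! ### Convergence of the embedded distributions -/

/-- Needed for dominated convergence along ε → 0 and for measurability of the almost everywhere
limit. -/
instance : toZero.IsCountablyGenerated := by unfold toZero; infer_instance

lemma tendsto_param : Tendsto (fun ε : Param => (ε : ℝ)) toZero (𝓝 0) := tendsto_comap

instance : toZero.NeBot := by
  refine comap_neBot fun t ht => ?_
  obtain ⟨δ, hδ, h⟩ := Metric.mem_nhds_iff.mp ht
  have h1 : 0 < min (δ / 2) 1 := by positivity
  refine ⟨⟨min (δ / 2) 1, h1, min_le_right _ _⟩, h ?_⟩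
  rw [mem_ball_zero_iff, Real.norm_eq_abs, abs_of_pos h1]
  exact (min_le_left _ _).trans_lt (by linarith)

section Mollify

variable (φ : 𝓢(ℝ, ℝ)) (χ : LineTest)

lemma cutMollifier_apply (ε : Param) (x : ℝ) :
    cutMollifier φ χ ε x = χ x * ((ε : ℝ)⁻¹ * φ (x / ε)) := rfl

lemma tsupport_cutMollifier (ε : Param) : tsupport (cutMollifier φ χ ε) ⊆ tsupport χ :=
  closure_mono (Function.support_mul_subset_left _ _)

/-- The test function `y ↦ ∫ A(x) θ_ε(x - y) dx`. -/
def mollify (A : LineTest) (ε : Param) : LineTest :=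
  smear (reflect (cutMollifier φ χ ε) 0) (reflect (cutMollifier φ χ ε) 0).continuous.locallyIntegrable
    (reflect (cutMollifier φ χ ε) 0).hasCompactSupport A

lemma iteratedDeriv_mollify (A : LineTest) (ε : Param) (i : ℕ) (y : ℝ) :
    iteratedDeriv i (mollify φ χ A ε) y =
      ∫ z, cutMollifier φ χ ε z * iteratedDeriv i A (y + z) := by
  rw [mollify, iteratedDeriv_smear, ← integral_neg_eq_self]
  congr 1
  ext z
  change cutMollifier φ χ ε (0 - -z) * _ = _
  rw [sub_neg_eq_add, zero_add, sub_neg_eq_add]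

lemma mollify_apply (A : LineTest) (ε : Param) (y : ℝ) :
    mollify φ χ A ε y = ∫ x, A x * cutMollifier φ χ ε (x - y) := by
  have h := iteratedDeriv_mollify φ χ A ε 0 y
  rw [iteratedDeriv_zero] at h
  rw [h, ← integral_add_right_eq_self (fun x => A x * cutMollifier φ χ ε (x - y)) y]
  congr 1
  ext z
  rw [iteratedDeriv_zero, add_sub_cancel_right, add_comm, mul_comm]

/-- After z = εs the profile `φ` is fixed, and ε occurs only in the arguments of the smooth factors.
-/
lemma iteratedDeriv_mollify_rescale (A : LineTest) (ε : Param) (i : ℕ) (y : ℝ) :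
    iteratedDeriv i (mollify φ χ A ε) y =
      ∫ s, φ s * (χ (ε * s) * iteratedDeriv i A (y + ε * s)) := by
  have h0 := ε.2.1
  have := Measure.integral_comp_mul_left
    (fun z => cutMollifier φ χ ε z * iteratedDeriv i A (y + z)) (ε : ℝ)
  rw [abs_of_pos (by positivity), smul_eq_mul] at this
  rw [iteratedDeriv_mollify]
  have e : ∀ I J : ℝ, I = (ε : ℝ)⁻¹ * J → J = ε * I := fun I J h => by
    rw [h, mul_inv_cancel_left₀ h0.ne']
  rw [e _ _ this, ← integral_const_mul]
  congr 1
  ext s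
  rw [cutMollifier_apply, mul_div_cancel_left₀ _ h0.ne']
  field_simp

/-- Since `φ` has mass 1, the error is the integral of `φ` against the increment of χ(εs) η(y + εs)
from s = 0. That increment is O(ε|s|) by Lipschitz bounds, and `φ` has a finite first absolute
moment. -/
lemma mollify_sub_le (hφ : ∫ x, φ x = 1) (hχ : χ 0 = 1) (A : LineTest) (N : ℕ) :
    ∃ C : ℝ, 0 ≤ C ∧ ∀ ε : Param, ∀ i ≤ N, ∀ y,
      |iteratedDeriv i (mollify φ χ A ε) y - iteratedDeriv i A y| ≤ C * ε := by
  obtain ⟨B, hB, hB'⟩ := exists_bound_iteratedDeriv A (N + 1)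
  obtain ⟨D, hD, hD'⟩ := exists_bound_iteratedDeriv χ 1
  have hφ1 : Integrable fun s => |s| * |φ s| := by
    simpa using φ.integrable_pow_mul volume 1
  refine ⟨2 * (D * B) * ∫ s, |s| * |φ s|, by positivity, fun ε i hi y => ?_⟩
  have h0 := ε.2.1
  set η := iteratedDeriv i A with hη
  have hηc : Continuous η := A.contDiff.continuous_iteratedDeriv i (by exact_mod_cast le_top)
  have hb : ∀ s, |χ (ε * s) * η (y + ε * s) - η y| ≤ 2 * (D * B) * (ε * |s|) := fun s => by
    have e : |(ε : ℝ) * s| = ε * |s| := by rw [abs_mul, abs_of_pos h0]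
    have h1 : |χ (ε * s) - χ 0| ≤ D * |ε * s - 0| :=
      lipschitz_iteratedDeriv χ 0 (hD' 1 le_rfl) _ _
    have h2 : |η (y + ε * s) - η y| ≤ B * |y + ε * s - y| :=
      lipschitz_iteratedDeriv A i (hB' (i + 1) (by omega)) _ _
    have h3 : |η (y + ε * s)| ≤ B := hB' i (by omega) _
    -- As χ 0 = 1, the sup bound `D` is at least 1, so both error terms are at most DBε|s|.
    have h4 : 1 ≤ D := by
      have := hD' 0 (by omega) 0
      rwa [iteratedDeriv_zero, hχ, abs_one] at this
    rw [sub_zero, e, hχ] at h1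
    rw [add_sub_cancel_left, e] at h2
    calc |χ (ε * s) * η (y + ε * s) - η y|
        = |(χ (ε * s) - 1) * η (y + ε * s) + (η (y + ε * s) - η y)| := by congr 1; ring
      _ ≤ |χ (ε * s) - 1| * |η (y + ε * s)| + |η (y + ε * s) - η y| := by
          rw [← abs_mul]; exact abs_add_le _ _
      _ ≤ (D * (ε * |s|)) * B + 1 * (B * (ε * |s|)) := by rw [one_mul]; gcongr
      _ ≤ (D * (ε * |s|)) * B + D * (B * (ε * |s|)) := by gcongr
      _ = _ := by ring
  have hi2 : Integrable fun s => φ s * η y := φ.integrable.mul_const _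
  have hi3 : Integrable fun s => φ s * (χ (ε * s) * η (y + ε * s) - η y) := by
    refine ((hφ1.const_mul (2 * (D * B) * ε))).mono' (Continuous.aestronglyMeasurable ?_)
      (Eventually.of_forall fun s => ?_)
    · have := χ.continuous
      have := φ.continuous
      fun_prop
    · rw [norm_mul, Real.norm_eq_abs, Real.norm_eq_abs]
      calc _ ≤ |φ s| * (2 * (D * B) * (ε * |s|)) := by gcongr; exact hb s
        _ = _ := by ring
  have e : (∫ s, φ s * (χ (ε * s) * η (y + ε * s))) - η y =
      ∫ s, φ s * (χ (ε * s) * η (y + ε * s) - η y) := by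
    have e1 : η y = ∫ s, φ s * η y := by rw [integral_mul_const, hφ, one_mul]
    have e2 : ∫ s, φ s * (χ (ε * s) * η (y + ε * s)) =
        ∫ s, (φ s * (χ (ε * s) * η (y + ε * s) - η y) + φ s * η y) := by
      congr 1
      ext s
      ring
    rw [e2, integral_add hi3 hi2, ← e1, add_sub_cancel_right]
  rw [iteratedDeriv_mollify_rescale, e]
  calc _ ≤ ∫ s, 2 * (D * B) * ε * (|s| * |φ s|) := by
        rw [← Real.norm_eq_abs]
        refine norm_integral_le_of_norm_le (hφ1.const_mul _) (Eventually.of_forall fun s => ?_)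
        rw [norm_mul, Real.norm_eq_abs, Real.norm_eq_abs]
        calc _ ≤ |φ s| * (2 * (D * B) * (ε * |s|)) := by gcongr; exact hb s
          _ = _ := by ring
    _ = _ := by rw [integral_const_mul]; ring

/-- The embedded distributions converge in the sense of distributions. -/
lemma tendsto_conv (hφ : ∫ x, φ x = 1) (hχ : χ 0 = 1) (a : 𝓓'((⊤ : Opens ℝ), ℝ)) (A : LineTest) :
    Tendsto (fun ε => ∫ x, conv a (cutMollifier φ χ ε) x * A x) toZero (𝓝 (a A)) := by
  have h : ∀ ε, ∫ x, conv a (cutMollifier φ χ ε) x * A x = a (mollify φ χ A ε) := fun ε =>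
    integral_conv_mul a _ A (mollify_apply φ χ A ε)
  simp only [h]
  -- The cut-off confines all mollifications of `A` to one compact set, so one seminorm estimate
  -- serves every ε.
  set K : Set ℝ := tsupport A ∪ (fun p : ℝ × ℝ => p.1 - p.2) '' (tsupport A ×ˢ tsupport χ)
  have hK : IsCompact K := A.hasCompactSupport.isCompact.union
    ((A.hasCompactSupport.prod χ.hasCompactSupport).image (by fun_prop))
  obtain ⟨N, C, hC, hb⟩ := exists_dist_bound a hK
  obtain ⟨D, hD, hD'⟩ := mollify_sub_le φ χ hφ hχ A N
  rw [tendsto_iff_norm_sub_tendsto_zero]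
  refine squeeze_zero (fun _ => norm_nonneg _) (fun ε => ?_)
    (by simpa using (tendsto_param.const_mul (C * D)))
  have h0 := ε.2.1
  rw [← map_sub, mul_assoc]
  refine hb _ ?_ _ (by positivity) fun i hi y => norm_iteratedFDeriv_sub_le (hD' ε i hi y)
  refine closure_minimal (fun y hy => ?_) hK.isClosed
  by_contra hn
  apply hy
  change mollify φ χ A ε y - A y = 0
  have h1 : A y = 0 := image_eq_zero_of_notMem_tsupport fun h => hn (Or.inl h)
  rw [h1, mollify_apply, sub_zero]
  refine integral_eq_zero_of_ae (Eventually.of_forall fun x => ?_)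
  by_contra hne
  refine hn (Or.inr ⟨(x, x - y), ⟨subset_tsupport _ (left_ne_zero_of_mul hne),
    tsupport_cutMollifier φ χ ε (subset_tsupport _ (right_ne_zero_of_mul hne))⟩, by simp⟩)

/-- Off the origin, the rescaled mollifiers tend to zero with all their derivatives. -/
lemma cutMollifier_bd {r : ℝ} (hr : 0 < r) (hχ : ∀ x, |x| < r → χ x = 0) (N : ℕ) :
    Bd (fun ε => (cutMollifier φ χ ε : ℝ → ℝ)) (tsupport χ) N 1 := by
  have hfar : ∀ x ∈ tsupport χ, r ≤ |x| := fun x hx => by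
    have : tsupport χ ⊆ {x | r ≤ |x|} := closure_minimal
      (fun x hx => not_lt.mp fun h => hx (hχ x h)) (isClosed_le continuous_const continuous_abs)
    exact this hx
  have h1 : Bd (fun (_ : Param) => (χ : ℝ → ℝ)) (tsupport χ) N 0 := by
    obtain ⟨B, hB, hB'⟩ := exists_bound_iteratedDeriv χ N
    refine ⟨B, hB, Eventually.of_forall fun ε x _ i hi => ?_⟩
    rw [norm_iteratedFDeriv_eq_norm_iteratedDeriv, zpow_zero, mul_one]
    exact hB' i hi x
  have s2 : ∀ ε : Param, ContDiff ℝ ∞ fun x : ℝ => (ε : ℝ)⁻¹ * φ ((ε : ℝ)⁻¹ * x) := fun ε =>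
    contDiff_const.mul ((φ.smooth ⊤).comp (contDiff_const.mul contDiff_id))
  have h2 : Bd (fun (ε : Param) (x : ℝ) => (ε : ℝ)⁻¹ * φ ((ε : ℝ)⁻¹ * x)) (tsupport χ) N 1 := by
    refine Bd.of_forall fun i _ => ?_
    -- The rescaled derivative costs ε^{-(i+1)}; decay of order i + 2 at |x/ε| ≥ r/ε pays for it and
    -- leaves one power of ε.
    obtain ⟨B, hB⟩ := φ.decay (i + 2) i
    refine ⟨B / r ^ (i + 2), Eventually.of_forall fun ε x hx => ?_⟩
    have h0 := ε.2.1
    rw [norm_iteratedFDeriv_eq_norm_iteratedDeriv, iteratedDeriv_const_mul_field,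
      iteratedDeriv_comp_const_mul ((φ.smooth ⊤).of_le (by exact_mod_cast le_top))]
    have := hB.2 ((ε : ℝ)⁻¹ * x)
    rw [norm_iteratedFDeriv_eq_norm_iteratedDeriv] at this
    rw [norm_mul, norm_mul, norm_pow, norm_inv, Real.norm_of_nonneg h0.le, zpow_one]
    rw [norm_mul, norm_inv, Real.norm_of_nonneg h0.le] at this
    set Y := ‖iteratedDeriv i φ ((ε : ℝ)⁻¹ * x)‖
    have hx' : r ≤ ‖x‖ := hfar x hx
    have h3 : r ^ (i + 2) * ((ε : ℝ)⁻¹ ^ (i + 2) * Y) ≤ B := by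
      refine le_trans ?_ this
      rw [mul_pow]
      calc _ = (ε : ℝ)⁻¹ ^ (i + 2) * r ^ (i + 2) * Y := by ring
        _ ≤ _ := by gcongr
    rw [div_mul_eq_mul_div, le_div_iff₀ (by positivity)]
    calc _ = r ^ (i + 2) * ((ε : ℝ)⁻¹ ^ (i + 2) * Y) * ε := by
          linear_combination
            (-((ε : ℝ)⁻¹ ^ (i + 1) * Y * r ^ (i + 2))) * inv_mul_cancel₀ h0.ne'
      _ ≤ _ := by gcongr
  have := h1.smul h2 (fun _ => χ.contDiff) s2
  rw [zero_add] at this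
  convert this using 3 with ε x
  rw [cutMollifier_apply, smul_eq_mul, div_eq_inv_mul]

/-- With a cut-off vanishing near 0 only the rapidly decreasing tail of the mollifier remains, and
this is small whatever `a` is. -/
lemma conv_cutMollifier_far {r : ℝ} (hr : 0 < r) (hχ : ∀ x, |x| < r → χ x = 0)
    (a : 𝓓'((⊤ : Opens ℝ), ℝ)) {L : Set ℝ} (hL : IsCompact L) :
    ∃ C : ℝ, ∀ᶠ ε : Param in toZero, ∀ y ∈ L, |conv a (cutMollifier φ χ ε) y| ≤ C * ε := by
  set K : Set ℝ := (fun p : ℝ × ℝ => p.1 - p.2) '' (L ×ˢ tsupport χ)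
  have hK : IsCompact K := (hL.prod χ.hasCompactSupport).image (by fun_prop)
  obtain ⟨N, C, hC, hb⟩ := exists_dist_bound a hK
  obtain ⟨D, hD, hp⟩ := cutMollifier_bd φ χ hr hχ N
  refine ⟨C * D, hp.mono fun ε hp x hx => ?_⟩
  have h0 := ε.2.1
  rw [mul_assoc]
  refine hb _ ?_ _ (by positivity) fun i hi y => ?_
  · exact (tsupport_reflect_subset _ hL hx).trans
      (Set.image_mono (Set.prod_mono subset_rfl (tsupport_cutMollifier φ χ ε)))
  · rw [norm_iteratedFDeriv_eq_norm_iteratedDeriv, iteratedDeriv_reflect,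
      norm_mul, norm_pow, norm_neg, norm_one, one_pow, one_mul]
    by_cases hz : x - y ∈ tsupport χ
    · have := hp _ hz i hi
      rwa [norm_iteratedFDeriv_eq_norm_iteratedDeriv, zpow_one] at this
    · rw [← norm_iteratedFDeriv_eq_norm_iteratedDeriv, image_eq_zero_of_notMem_tsupport
        fun h => hz (tsupport_cutMollifier φ χ ε (tsupport_iteratedFDeriv_subset i h)), norm_zero]
      positivity

/-- Off the support, the embedded distributions tend to zero locally uniformly. -/
lemma conv_tendsto_zero (a : 𝓓'((⊤ : Opens ℝ), ℝ)) {x : ℝ} (hx : x ∉ Distribution.dsupport a) :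
    ∃ r > 0, ∀ δ > 0, ∀ᶠ ε : Param in toZero, ∀ y ∈ Metric.ball x r,
      |conv a (cutMollifier φ χ ε) y| ≤ δ := by
  obtain ⟨s, hs, hso, hxs⟩ := (Distribution.notMem_dsupport_iff x).mp hx
  obtain ⟨r, hr, hrs⟩ := Metric.isOpen_iff.mp hso x hxs
  -- Splits the mollifier into a near part of radius r/4 and a tail. For y within r/4 of x the near
  -- part only sees `a` within r/2 of x, where `a` vanishes; the tail falls under
  -- `conv_cutMollifier_far`.
  let κ : ContDiffBump (0 : ℝ) := ⟨r / 8, r / 4, by positivity, by linarith⟩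
  let χ₁ : LineTest := ⟨fun x => κ x * χ x, κ.contDiff.mul χ.contDiff,
    χ.hasCompactSupport.mul_left, fun _ _ => trivial⟩
  let χ₂ : LineTest := ⟨fun x => (1 - κ x) * χ x, (contDiff_const.sub κ.contDiff).mul χ.contDiff,
    χ.hasCompactSupport.mul_left, fun _ _ => trivial⟩
  have hdec : ∀ (ε : Param) (y : ℝ), conv a (cutMollifier φ χ ε) y =
      conv a (cutMollifier φ χ₁ ε) y + conv a (cutMollifier φ χ₂ ε) y := fun ε y => by
    rw [conv_eq, conv_eq, conv_eq, ← map_add]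
    congr 1
    ext z
    change χ (y - z) * _ = κ (y - z) * χ (y - z) * _ + (1 - κ (y - z)) * χ (y - z) * _
    ring
  have hfar : ∀ x, |x| < r / 8 → χ₂ x = 0 := fun x hx => by
    change (1 - κ x) * χ x = 0
    rw [κ.one_of_mem_closedBall (by
      rw [mem_closedBall_zero_iff]; exact hx.le), sub_self, zero_mul]
  obtain ⟨C, hC⟩ := conv_cutMollifier_far φ χ₂ (by positivity) hfar a
    (isCompact_closedBall x (r / 4))
  refine ⟨r / 4, by positivity, fun δ hδ => ?_⟩
  have hlim : Tendsto (fun ε : Param => C * (ε : ℝ)) toZero (𝓝 0) := by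
    simpa using tendsto_param.const_mul C
  filter_upwards [hC, hlim.eventually (eventually_le_nhds hδ)] with ε h1 h2 y hy
  have h3 : conv a (cutMollifier φ χ₁ ε) y = 0 := by
    refine hs _ ((closure_minimal (fun z hz => ?_) Metric.isClosed_closedBall).trans
      ((Metric.closedBall_subset_ball (show r / 2 < r by linarith)).trans hrs))
    by_contra hn
    apply hz
    change κ (y - z) * χ (y - z) * _ = 0
    have : κ (y - z) = 0 := by
      refine κ.zero_of_le_dist ?_
      rw [dist_zero_right, Real.norm_eq_abs]
      rw [Metric.mem_closedBall, not_le, Real.dist_eq] at hn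
      rw [Metric.mem_ball, Real.dist_eq] at hy
      change r / 4 ≤ |y - z|
      have := abs_sub_abs_le_abs_sub (z - x) (y - x)
      rw [show z - x - (y - x) = -(y - z) by ring, abs_neg] at this
      linarith
    rw [this, zero_mul, zero_mul]
  rw [hdec, h3, zero_add]
  exact (h1 y (Metric.ball_subset_closedBall hy)).trans h2

end Mollify


/-! ### Convergence of the linear waves in the sense of distributions -/

lemma continuous_integral_interval {g : ℝ → ℝ} (hg : Continuous g) :
    Continuous fun z : ℝ × ℝ => ∫ y in (z.1 - z.2)..(z.1 + z.2), g y := by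
  have hi : ∀ a b : ℝ, IntervalIntegrable g volume a b := fun a b => hg.intervalIntegrable a b
  have hG : Continuous fun x => ∫ y in (0 : ℝ)..x, g y := intervalIntegral.continuous_primitive hi 0
  have e : (fun z : ℝ × ℝ => ∫ y in (z.1 - z.2)..(z.1 + z.2), g y) =
      fun z => (∫ y in (0 : ℝ)..(z.1 + z.2), g y) - ∫ y in (0 : ℝ)..(z.1 - z.2), g y :=
    funext fun z => (intervalIntegral.integral_interval_sub_left (hi _ _) (hi _ _)).symm
  rw [e]
  exact (hG.comp (continuous_fst.add continuous_snd)).sub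
    (hG.comp (continuous_fst.sub continuous_snd))

lemma continuous_freeWave {α β : ℝ → ℝ} (hα : Continuous α) (hβ : Continuous β) :
    Continuous (freeWave α β) :=
  ((hα.comp (continuous_fst.sub continuous_snd)).add
    (hα.comp (continuous_fst.add continuous_snd))).div_const 2 |>.add
    ((continuous_integral_interval hβ).div_const 2)

/-- Reversing time negates the initial velocity, which the orientation of the interval integral
reflects. -/
lemma freeWave_timeReflect (α β : ℝ → ℝ) (z : ℝ × ℝ) :
    freeWave α (fun y => -β y) z = freeWave α β (timeReflect 0 z) := by
  simp only [freeWave, timeReflect_apply, zero_sub, sub_neg_eq_add, ← sub_eq_add_neg,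
    intervalIntegral.integral_neg]
  rw [intervalIntegral.integral_symm (z.1 - z.2)]
  ring

lemma freeWave_sub {α β α' β' : ℝ → ℝ} (hβ : Continuous β) (hβ' : Continuous β') (z : ℝ × ℝ) :
    freeWave α β z - freeWave α' β' z =
      freeWave (fun y => α y - α' y) (fun y => β y - β' y) z := by
  simp only [freeWave]
  rw [intervalIntegral.integral_sub (hβ.intervalIntegrable _ _) (hβ'.intervalIntegrable _ _)]
  ring

section Pull

variable {Θ : Type*} [MeasurableSpace Θ] {μ : Measure Θ} {σ ξ τ : Θ → ℝ}

/-- Fubini and translation in x. The condition |ξ| ≤ |τ| bounds y on the support of the integrand,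
so `g` needs no growth condition. -/
lemma integral_mul_pull [SFinite μ] (H : Admissible μ σ ξ τ) {g : ℝ → ℝ} (hg : Continuous g)
    (ψ : PlaneTest) : ∫ y, g y * pull μ σ ξ τ ψ y =
      ∫ θ, σ θ * (∫ x, g (x - ξ θ) * ψ (x, τ θ)) ∂μ := by
  obtain ⟨R, hR⟩ := exists_ball ψ
  obtain ⟨M, hM⟩ := exists_sup ψ
  obtain ⟨B, hB⟩ := (isCompact_closedBall (0 : ℝ) (2 * R)).exists_bound_of_continuousOn
    hg.continuousOn
  have hi : Integrable (Function.uncurry fun y θ => g y * (σ θ * ψ (y + ξ θ, τ θ)))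
      (volume.prod μ) := by
    have hI : Integrable ((Metric.closedBall (0 : ℝ) (2 * R) ×ˢ {θ | |τ θ| ≤ R}).indicator
        fun _ => B * M) (volume.prod μ) := by
      rw [integrable_indicator_iff (Metric.isClosed_closedBall.measurableSet.prod
        (measurableSet_le H.meas_time.abs measurable_const))]
      refine integrableOn_const ?_
      rw [Measure.prod_prod]
      exact (ENNReal.mul_lt_top measure_closedBall_lt_top (H.finite R)).ne
    refine hI.mono' (Measurable.aestronglyMeasurable ?_) ?_
    · exact (hg.measurable.comp measurable_fst).mul ((H.meas_weight.comp measurable_snd).mul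
        (ψ.continuous.measurable.comp ((measurable_fst.add (H.meas_space.comp measurable_snd)).prodMk
          (H.meas_time.comp measurable_snd))))
    · filter_upwards [Measure.quasiMeasurePreserving_snd.ae H.cone] with q hq
      change ‖g q.1 * (σ q.2 * ψ (q.1 + ξ q.2, τ q.2))‖ ≤ _
      by_cases h0 : ψ (q.1 + ξ q.2, τ q.2) = 0
      · rw [h0, mul_zero, mul_zero, norm_zero]
        refine Set.indicator_apply_nonneg fun hq => mul_nonneg
          ((norm_nonneg _).trans (hB q.1 hq.1)) ((abs_nonneg _).trans (hM 0))
      · have h1 := hR (subset_tsupport _ h0)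
        rw [mem_closedBall_zero_iff, Prod.norm_def] at h1
        have h2 : |q.1 + ξ q.2| ≤ R := (le_max_left _ _).trans h1
        have h3 : |τ q.2| ≤ R := (le_max_right _ _).trans h1
        have h4 : q.1 ∈ Metric.closedBall (0 : ℝ) (2 * R) := by
          rw [mem_closedBall_zero_iff, Real.norm_eq_abs]
          have := abs_sub (q.1 + ξ q.2) (ξ q.2)
          rw [add_sub_cancel_right] at this
          linarith
        rw [Set.indicator_of_mem (by exact ⟨h4, h3⟩), norm_mul, norm_mul]
        have h5 := hB _ h4
        calc _ ≤ B * (1 * M) := by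
              refine mul_le_mul h5 (mul_le_mul (H.weight_le _) (hM _) (norm_nonneg _) zero_le_one)
                (by positivity) ((norm_nonneg _).trans h5)
          _ = _ := by ring
  have h1 := integral_integral_swap hi
  simp only [integral_const_mul] at h1
  refine h1.trans ?_
  congr 1
  ext θ
  rw [← integral_add_right_eq_self (fun x => g (x - ξ θ) * ψ (x, τ θ)) (ξ θ),
    ← integral_const_mul]
  congr 1
  ext y
  rw [add_sub_cancel_right]
  ring

end Pull

lemma integral_mul_pull_line (c : ℝ) (hc : |c| ≤ 1) {g : ℝ → ℝ} (hg : Continuous g)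
    (ψ : PlaneTest) : ∫ z : ℝ × ℝ, g (z.1 - c * z.2) * ψ z =
      ∫ y, g y * pullTest (admissible_line c hc) ψ y := by
  refine Eq.trans ?_ (integral_mul_pull (admissible_line c hc) hg ψ).symm
  simp only [one_mul]
  refine integral_prod_symm (fun z : ℝ × ℝ => g (z.1 - c * z.2) * ψ z) ?_
  refine Continuous.integrable_of_hasCompactSupport ?_ ψ.hasCompactSupport.mul_left
  have := ψ.continuous
  fun_prop

/-- Explains the weight sgn(t) in `admissible_cone`: it restores the orientation of the interval for
t < 0. -/
lemma sign_mul_integral_interval {g : ℝ → ℝ} (x t : ℝ) :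
    Real.sign t * ∫ s in {s : ℝ | |s| ≤ |t|}, g (x - s) = ∫ y in (x - t)..(x + t), g y := by
  have h1 : ∀ t : ℝ, 0 ≤ t → ∫ s in {s : ℝ | |s| ≤ t}, g (x - s) =
      ∫ y in (x - t)..(x + t), g y := fun t ht => by
    have e : {s : ℝ | |s| ≤ t} = Set.Icc (-t) t := by
      ext s
      simp only [Set.mem_ofPred_eq, Set.mem_Icc, abs_le]
    rw [e, integral_Icc_eq_integral_Ioc, ← intervalIntegral.integral_of_le (by linarith),
      intervalIntegral.integral_comp_sub_left g x, sub_neg_eq_add]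
  rw [h1 |t| (abs_nonneg t)]
  rcases lt_trichotomy t 0 with ht | ht | ht
  · rw [Real.sign_of_neg ht, abs_of_neg ht, intervalIntegral.integral_symm, sub_neg_eq_add,
      ← sub_eq_add_neg]
    ring
  · simp [ht]
  · rw [Real.sign_of_pos ht, abs_of_pos ht, one_mul]

/-- Fubini in the three variables s, t, x: at fixed (x, t) the s-integral over |s| ≤ |t| is the
velocity term of d'Alembert's formula. On the support, |s| ≤ |t| ≤ R and |x| ≤ R, which gives
integrability. -/
lemma integral_mul_pull_cone {g : ℝ → ℝ} (hg : Continuous g) (ψ : PlaneTest) :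
    ∫ z : ℝ × ℝ, (∫ y in (z.1 - z.2)..(z.1 + z.2), g y) * ψ z =
      ∫ y, g y * pullTest admissible_cone ψ y := by
  refine Eq.trans ?_ (integral_mul_pull admissible_cone hg ψ).symm
  have hCm : MeasurableSet {z : ℝ × ℝ | |z.1| ≤ |z.2|} :=
    measurableSet_le measurable_fst.abs measurable_snd.abs
  set h : ℝ × ℝ → ℝ → ℝ := fun z x =>
    {z : ℝ × ℝ | |z.1| ≤ |z.2|}.indicator (fun z => Real.sign z.2 * (g (x - z.1) * ψ (x, z.2))) z
    with hh
  obtain ⟨R, hR⟩ := exists_ball ψ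
  obtain ⟨M, hM⟩ := exists_sup ψ
  obtain ⟨B, hB⟩ := (isCompact_closedBall (0 : ℝ) (2 * R)).exists_bound_of_continuousOn
    hg.continuousOn
  have hK : IsCompact (Metric.closedBall (0 : ℝ × ℝ) R ×ˢ Metric.closedBall (0 : ℝ) R) :=
    (isCompact_closedBall _ _).prod (isCompact_closedBall _ _)
  have hi : Integrable (Function.uncurry h) (volume.prod volume) := by
    have hI : Integrable ((Metric.closedBall (0 : ℝ × ℝ) R ×ˢ Metric.closedBall (0 : ℝ) R).indicator
        fun _ => |B| * M) ((volume : Measure (ℝ × ℝ)).prod (volume : Measure ℝ)) :=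
      (integrable_indicator_iff hK.measurableSet).mpr (integrableOn_const hK.measure_lt_top.ne)
    refine hI.mono' (Measurable.aestronglyMeasurable ?_) (Eventually.of_forall fun q => ?_)
    · have e : Function.uncurry h = (Prod.fst ⁻¹' {z : ℝ × ℝ | |z.1| ≤ |z.2|}).indicator
          fun q : (ℝ × ℝ) × ℝ => Real.sign q.1.2 * (g (q.2 - q.1.1) * ψ (q.2, q.1.2)) := rfl
      rw [e]
      refine Measurable.indicator ?_ (measurable_fst hCm)
      have h1 := admissible_cone.meas_weight.comp
        (measurable_fst : Measurable (Prod.fst : (ℝ × ℝ) × ℝ → ℝ × ℝ))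
      refine h1.mul (Continuous.measurable ?_)
      have := ψ.continuous
      fun_prop
    · change ‖{z : ℝ × ℝ | |z.1| ≤ |z.2|}.indicator
        (fun z => Real.sign z.2 * (g (q.2 - z.1) * ψ (q.2, z.2))) q.1‖ ≤ _
      have hBM : 0 ≤ |B| * M := mul_nonneg (abs_nonneg _) ((abs_nonneg _).trans (hM 0))
      by_cases hq : |q.1.1| ≤ |q.1.2| ∧ ψ (q.2, q.1.2) ≠ 0
      · have h1 := hR (subset_tsupport _ hq.2)
        rw [mem_closedBall_zero_iff, Prod.norm_def] at h1
        have h2 : |q.2| ≤ R := (le_max_left _ _).trans h1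
        have h3 : |q.1.2| ≤ R := (le_max_right _ _).trans h1
        have h4 : q.2 - q.1.1 ∈ Metric.closedBall (0 : ℝ) (2 * R) := by
          rw [mem_closedBall_zero_iff, Real.norm_eq_abs]
          have := abs_sub q.2 q.1.1
          linarith [hq.1]
        have h5 : q.1 ∈ Metric.closedBall (0 : ℝ × ℝ) R := by
          rw [mem_closedBall_zero_iff, Prod.norm_def]
          exact max_le (hq.1.trans h3) h3
        rw [Set.indicator_of_mem (by exact hq.1),
          Set.indicator_of_mem (by exact ⟨h5, by simpa using h2⟩), norm_mul, norm_mul]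
        calc _ ≤ 1 * (|B| * M) := by
              refine mul_le_mul (admissible_cone.weight_le _) (mul_le_mul
                ((hB _ h4).trans (le_abs_self B)) (hM _) (norm_nonneg _) (abs_nonneg _))
                (by positivity) zero_le_one
          _ = _ := one_mul _
      · have : {z : ℝ × ℝ | |z.1| ≤ |z.2|}.indicator
            (fun z => Real.sign z.2 * (g (q.2 - z.1) * ψ (q.2, z.2))) q.1 = 0 := by
          refine Set.indicator_apply_eq_zero.mpr fun h1 => ?_
          rw [not_not.mp fun h => hq ⟨h1, h⟩, mul_zero, mul_zero]
        rw [this, norm_zero]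
        exact Set.indicator_nonneg (fun _ _ => hBM) _
  have h1 : ∫ z in {z : ℝ × ℝ | |z.1| ≤ |z.2|}, Real.sign z.2 *
      ∫ x, g (x - z.1) * ψ (x, z.2) = ∫ z, ∫ x, h z x := by
    rw [← integral_indicator hCm]
    congr 1
    ext z
    by_cases hz : |z.1| ≤ |z.2|
    · rw [Set.indicator_of_mem (by exact hz), ← integral_const_mul]
      congr 1
      ext x
      rw [hh]
      exact (Set.indicator_of_mem (s := {z : ℝ × ℝ | |z.1| ≤ |z.2|}) hz
        fun z => Real.sign z.2 * (g (x - z.1) * ψ (x, z.2))).symm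
    · rw [Set.indicator_of_notMem (by exact hz)]
      refine (integral_eq_zero_of_ae (Eventually.of_forall fun x => ?_)).symm
      exact Set.indicator_of_notMem (s := {z : ℝ × ℝ | |z.1| ≤ |z.2|}) hz
        (fun z => Real.sign z.2 * (g (x - z.1) * ψ (x, z.2)))
  rw [h1, integral_integral_swap hi, Measure.volume_eq_prod, integral_prod]
  · refine integral_congr_ae ?_
    filter_upwards [hi.prod_left_ae] with x hx
    rw [integral_prod_symm (fun z => h z x) hx]
    congr 1
    ext t
    have hm : MeasurableSet {s : ℝ | |s| ≤ |t|} := measurableSet_le measurable_id.abs measurable_const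
    rw [← sign_mul_integral_interval, mul_assoc, ← integral_mul_const, ← integral_const_mul,
      ← integral_indicator hm]
    rfl
  · exact ((continuous_integral_interval hg).mul ψ.continuous).integrable_of_hasCompactSupport
      ψ.hasCompactSupport.mul_left

lemma dAlembert_eq (a b : 𝓓'((⊤ : Opens ℝ), ℝ)) (ψ : PlaneTest) :
    dAlembert a b ψ = (a (pullTest (admissible_line 1 (by simp)) ψ) +
      a (pullTest (admissible_line (-1) (by simp)) ψ)) / 2 +
        b (pullTest admissible_cone ψ) / 2 := by
  have : dAlembert a b ψ = 1 / 2 * (a (pullTest (admissible_line 1 (by simp)) ψ) +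
      a (pullTest (admissible_line (-1) (by simp)) ψ)) +
        1 / 2 * b (pullTest admissible_cone ψ) := rfl
  rw [this]
  ring

/-- For continuous data the classical formula and the transposed definition of `dAlembert` agree.
The right side depends on the data only through pairings with fixed test functions. -/
lemma integral_freeWave_mul {α β : ℝ → ℝ} (hα : Continuous α) (hβ : Continuous β) (ψ : PlaneTest) :
    ∫ z, freeWave α β z * ψ z =
      ((∫ y, α y * pullTest (admissible_line 1 (by simp)) ψ y) +
        ∫ y, α y * pullTest (admissible_line (-1) (by simp)) ψ y) / 2 +
          (∫ y, β y * pullTest admissible_cone ψ y) / 2 := by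
  rw [← integral_mul_pull_line 1 (by simp) hα, ← integral_mul_pull_line (-1) (by simp) hα,
    ← integral_mul_pull_cone hβ]
  have hi : ∀ {k : ℝ × ℝ → ℝ}, Continuous k → Integrable fun z => k z * ψ z := fun hk =>
    (hk.mul ψ.continuous).integrable_of_hasCompactSupport ψ.hasCompactSupport.mul_left
  have i1 : Integrable fun z : ℝ × ℝ => α (z.1 - 1 * z.2) * ψ z := hi (by fun_prop)
  have i2 : Integrable fun z : ℝ × ℝ => α (z.1 - -1 * z.2) * ψ z := hi (by fun_prop)
  have i3 := hi (continuous_integral_interval hβ)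
  have i4 : Integrable fun z : ℝ × ℝ =>
      (α (z.1 - 1 * z.2) * ψ z + α (z.1 - -1 * z.2) * ψ z) / 2 := (i1.add i2).div_const 2
  rw [← integral_add i1 i2, ← integral_div, ← integral_div, ← integral_add i4 (i3.div_const 2)]
  congr 1
  ext z
  simp only [freeWave, one_mul, neg_mul, sub_neg_eq_add]
  ring

/-- The solution of the linear wave equation with embedded data. -/
def wave (φ : 𝓢(ℝ, ℝ)) (χ : LineTest) (a b : 𝓓'((⊤ : Opens ℝ), ℝ)) (ε : Param) : ℝ × ℝ → ℝ :=
  freeWave (conv a (cutMollifier φ χ ε)) (conv b (cutMollifier φ χ ε))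

lemma continuous_wave (φ : 𝓢(ℝ, ℝ)) (χ : LineTest) (a b : 𝓓'((⊤ : Opens ℝ), ℝ)) (ε : Param) :
    Continuous (wave φ χ a b ε) :=
  continuous_freeWave (contDiff_conv a _).continuous (contDiff_conv b _).continuous

lemma tendsto_integral_wave (φ : 𝓢(ℝ, ℝ)) (χ : LineTest) (hφ : ∫ x, φ x = 1) (hχ : χ 0 = 1)
    (a b : 𝓓'((⊤ : Opens ℝ), ℝ)) (ψ : PlaneTest) :
    Tendsto (fun ε => ∫ z, wave φ χ a b ε z * ψ z) toZero (𝓝 (dAlembert a b ψ)) := by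
  have e : ∀ ε, ∫ z, wave φ χ a b ε z * ψ z = _ := fun ε =>
    integral_freeWave_mul (contDiff_conv a _).continuous (contDiff_conv b _).continuous ψ
  simp only [e]
  rw [dAlembert_eq]
  exact (((tendsto_conv φ χ hφ hχ a _).add (tendsto_conv φ χ hφ hχ a _)).div_const 2).add
    ((tendsto_conv φ χ hφ hχ b _).div_const 2)


/-! ### Pointwise convergence of the linear waves off the light cones -/

/-- In the difference of the waves at two nearby points the bulk of the velocity integral cancels.
What remains are values and short integrals near the characteristic feet z.1 ± z.2, where the
mollified data tend to zero. The wave itself need not be small. -/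
lemma wave_locally_constant (φ : 𝓢(ℝ, ℝ)) (χ : LineTest) (a b : 𝓓'((⊤ : Opens ℝ), ℝ)) {z : ℝ × ℝ}
    (h1 : z.1 - z.2 ∉ Distribution.dsupport a ∪ Distribution.dsupport b)
    (h2 : z.1 + z.2 ∉ Distribution.dsupport a ∪ Distribution.dsupport b) :
    ∃ U : Set (ℝ × ℝ), IsOpen U ∧ z ∈ U ∧ ∀ δ > 0, ∀ᶠ ε in toZero, ∀ y ∈ U,
      |wave φ χ a b ε y - wave φ χ a b ε z| ≤ δ := by
  simp only [Set.mem_union, not_or] at h1 h2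
  obtain ⟨r₁, hr₁, hc₁⟩ := conv_tendsto_zero φ χ a h1.1
  obtain ⟨r₂, hr₂, hc₂⟩ := conv_tendsto_zero φ χ a h2.1
  obtain ⟨r₃, hr₃, hc₃⟩ := conv_tendsto_zero φ χ b h1.2
  obtain ⟨r₄, hr₄, hc₄⟩ := conv_tendsto_zero φ χ b h2.2
  obtain ⟨r, hr, hr1, hrr₁, hrr₂, hrr₃, hrr₄⟩ : ∃ r > 0, r ≤ 1 ∧ r ≤ r₁ ∧ r ≤ r₂ ∧ r ≤ r₃ ∧
      r ≤ r₄ := ⟨min 1 (min (min r₁ r₂) (min r₃ r₄)), by positivity, by simp, by simp, by simp,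
        by simp, by simp⟩
  refine ⟨{y | |y.1 - y.2 - (z.1 - z.2)| < r} ∩ {y | |y.1 + y.2 - (z.1 + z.2)| < r},
    (isOpen_lt (by fun_prop) continuous_const).inter (isOpen_lt (by fun_prop) continuous_const),
    by simp [hr], fun δ hδ => ?_⟩
  -- Four values and two integrals over intervals of length at most r ≤ 1, each weighted by ½,
  -- contribute 6 · ½ · δ/3 = δ.
  filter_upwards [hc₁ (δ / 3) (by positivity), hc₂ (δ / 3) (by positivity),
    hc₃ (δ / 3) (by positivity), hc₄ (δ / 3) (by positivity)] with ε k₁ k₂ k₃ k₄ y hy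
  have hy₁ : |y.1 - y.2 - (z.1 - z.2)| < r := hy.1
  have hy₂ : |y.1 + y.2 - (z.1 + z.2)| < r := hy.2
  set A := conv a (cutMollifier φ χ ε)
  set B := conv b (cutMollifier φ χ ε)
  have hB : ∀ p q : ℝ, IntervalIntegrable B volume p q := fun p q =>
    (contDiff_conv b _).continuous.intervalIntegrable _ _
  have m₁ := k₁ (z.1 - z.2) (Metric.mem_ball_self hr₁)
  have m₂ := k₂ (z.1 + z.2) (Metric.mem_ball_self hr₂)
  have m₃ := k₁ (y.1 - y.2) (hy₁.trans_le hrr₁)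
  have m₄ := k₂ (y.1 + y.2) (hy₂.trans_le hrr₂)
  have n₁ : |∫ s in (z.1 - z.2)..(y.1 - y.2), B s| ≤ δ / 3 := by
    refine (intervalIntegral.norm_integral_le_of_norm_le_const (f := B) (C := δ / 3)
      fun s hs => k₃ s ?_).trans ?_
    · exact (Set.abs_sub_left_of_mem_uIcc (Set.uIoc_subset_uIcc hs)).trans_lt
        (hy₁.trans_le hrr₃)
    · exact mul_le_of_le_one_right (by positivity) (hy₁.le.trans hr1)
  have n₂ : |∫ s in (z.1 + z.2)..(y.1 + y.2), B s| ≤ δ / 3 := by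
    refine (intervalIntegral.norm_integral_le_of_norm_le_const (f := B) (C := δ / 3)
      fun s hs => k₄ s ?_).trans ?_
    · exact (Set.abs_sub_left_of_mem_uIcc (Set.uIoc_subset_uIcc hs)).trans_lt
        (hy₂.trans_le hrr₄)
    · exact mul_le_of_le_one_right (by positivity) (hy₂.le.trans hr1)
  have e₁ := intervalIntegral.integral_add_adjacent_intervals
    (hB (z.1 - z.2) (y.1 - y.2)) (hB (y.1 - y.2) (y.1 + y.2))
  have e₂ := intervalIntegral.integral_add_adjacent_intervals
    (hB (z.1 - z.2) (z.1 + z.2)) (hB (z.1 + z.2) (y.1 + y.2))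
  change |(A (y.1 - y.2) + A (y.1 + y.2)) / 2 + (∫ s in (y.1 - y.2)..(y.1 + y.2), B s) / 2 -
    ((A (z.1 - z.2) + A (z.1 + z.2)) / 2 + (∫ s in (z.1 - z.2)..(z.1 + z.2), B s) / 2)| ≤ δ
  rw [abs_le] at *
  constructor <;> linarith [m₁.1, m₁.2, m₂.1, m₂.2, m₃.1, m₃.2, m₄.1, m₄.2, n₁.1, n₁.2, n₂.1, n₂.2]

lemma integrable_mul_planeTest {g : ℝ × ℝ → ℝ} (hg : Continuous g) (ψ : PlaneTest) :
    Integrable fun z => g z * ψ z :=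
  (hg.mul ψ.continuous).integrable_of_hasCompactSupport ψ.hasCompactSupport.mul_left

/-- Shows that the choice in `offSingSupp` is harmless: on the overlap the chosen representative
equals `c` almost everywhere by the fundamental lemma, hence everywhere by continuity. -/
lemma offSingSupp_eq {T : 𝓓'((⊤ : Opens (ℝ × ℝ)), ℝ)} {U : Set (ℝ × ℝ)} (hU : IsOpen U) {c : ℝ}
    (hT : ∀ ψ : PlaneTest, tsupport ψ ⊆ U → T ψ = ∫ x, c * ψ x) {z : ℝ × ℝ} (hz : z ∈ U) :
    offSingSupp T z = c := by
  have h : ∃ (U : Set (ℝ × ℝ)) (g : ℝ × ℝ → ℝ), z ∈ U ∧ IsSmoothOn T U g :=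
    ⟨U, fun _ => c, hz, hU, contDiffOn_const, hT⟩
  rw [offSingSupp, dif_pos h]
  obtain ⟨hz', hV, hg, hTV⟩ := h.choose_spec.choose_spec
  set V := h.choose
  set g := h.choose_spec.choose
  have hW : IsOpen (U ∩ V) := hU.inter hV
  have hgW : ContinuousOn g (U ∩ V) := hg.continuousOn.mono Set.inter_subset_right
  have hae := hW.ae_eq_zero_of_integral_contDiff_smul_eq_zero (f := fun x => g x - c)
    (μ := volume) ((hgW.sub continuousOn_const).locallyIntegrableOn hW.measurableSet)
    fun ψ hψ hc hs => ?_
  · have h1 : g =ᵐ[volume.restrict (U ∩ V)] fun _ => c := by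
      refine (ae_restrict_iff' hW.measurableSet).mpr (hae.mono fun x hx hxW => ?_)
      exact sub_eq_zero.mp (hx hxW)
    exact Measure.eqOn_open_of_ae_eq h1 hW hgW continuousOn_const ⟨hz, hz'⟩
  · let Ψ : PlaneTest := ⟨ψ, hψ, hc, fun _ _ => trivial⟩
    have h1 : ∫ x, g x * ψ x = ∫ x, c * ψ x :=
      (hTV Ψ (hs.trans Set.inter_subset_right)).symm.trans
        (hT Ψ (hs.trans Set.inter_subset_left))
    have i1 : Integrable fun x => g x * ψ x := by
      have hgs : Continuous fun x => g x * ψ x := by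
        refine continuous_iff_continuousAt.mpr fun x => ?_
        by_cases hx : x ∈ tsupport ψ
        · exact ((hgW.continuousAt (hW.mem_nhds (hs hx)))).mul hψ.continuous.continuousAt
        · have : (fun x => g x * ψ x) =ᶠ[𝓝 x] fun _ => 0 := by
            filter_upwards [(isClosed_tsupport ψ).isOpen_compl.mem_nhds hx] with y hy
            rw [image_eq_zero_of_notMem_tsupport hy, mul_zero]
          exact continuousAt_const.congr this.symm
      exact hgs.integrable_of_hasCompactSupport hc.mul_left
    have i2 : Integrable fun x => c * ψ x :=
      (hψ.continuous.integrable_of_hasCompactSupport hc).const_mul c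
    calc ∫ x, ψ x • (g x - c) = ∫ x, (g x * ψ x - c * ψ x) := by
          congr 1
          ext x
          rw [smul_eq_mul]
          ring
      _ = 0 := by rw [integral_sub i1 i2, h1, sub_self]

/-- A net of continuous functions which converges in the sense of distributions and is
asymptotically constant near `z` converges at `z`. -/
lemma tendsto_offSingSupp {T : 𝓓'((⊤ : Opens (ℝ × ℝ)), ℝ)} {v : Param → ℝ × ℝ → ℝ}
    (hv : ∀ ε, Continuous (v ε))
    (hT : ∀ ψ : PlaneTest, Tendsto (fun ε => ∫ x, v ε x * ψ x) toZero (𝓝 (T ψ)))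
    {U : Set (ℝ × ℝ)} (hU : IsOpen U) {z : ℝ × ℝ} (hz : z ∈ U)
    (hc : ∀ δ > 0, ∀ᶠ ε in toZero, ∀ y ∈ U, |v ε y - v ε z| ≤ δ) :
    Tendsto (fun ε => v ε z) toZero (𝓝 (offSingSupp T z)) := by
  -- On `U` the net may be replaced by its value at `z` without changing limits of pairings,
  -- although that value is not yet known to converge.
  have h1 : ∀ ψ : PlaneTest, tsupport ψ ⊆ U →
      Tendsto (fun ε => (∫ x, v ε x * ψ x) - v ε z * ∫ x, ψ x) toZero (𝓝 0) := fun ψ hψ => by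
    have hψi : Integrable fun x => |ψ x| :=
      (ψ.continuous.integrable_of_hasCompactSupport ψ.hasCompactSupport).abs
    set I := ∫ x, |ψ x|
    have hI : 0 ≤ I := integral_nonneg fun _ => abs_nonneg _
    rw [Metric.tendsto_nhds]
    intro δ hδ
    filter_upwards [hc (δ / (2 * (I + 1))) (by positivity)] with ε hε
    rw [dist_zero_right, ← integral_const_mul,
      ← integral_sub (integrable_mul_planeTest (hv ε) ψ)
      (integrable_mul_planeTest continuous_const ψ)]
    have h2 : ‖∫ x, (v ε x * ψ x - v ε z * ψ x)‖ ≤ ∫ x, δ / (2 * (I + 1)) * |ψ x| := by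
      refine norm_integral_le_of_norm_le (hψi.const_mul _) (Eventually.of_forall fun x => ?_)
      rw [← sub_mul, norm_mul, Real.norm_eq_abs, Real.norm_eq_abs]
      by_cases hx : x ∈ U
      · gcongr
        exact hε x hx
      · rw [image_eq_zero_of_notMem_tsupport fun h => hx (hψ h)]
        simp
    rw [integral_const_mul] at h2
    refine h2.trans_lt ?_
    rw [div_mul_eq_mul_div, div_lt_iff₀ (by positivity)]
    change δ * I < _
    nlinarith
  obtain ⟨r, hr, hrU⟩ := Metric.isOpen_iff.mp hU z hz
  -- A bump of mass 1 inside `U` reads off the limit of v ε z as `T P`.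
  let ρ : ContDiffBump z := ⟨r / 4, r / 2, by positivity, by linarith⟩
  let P : PlaneTest := ⟨ρ.normed volume, ρ.contDiff_normed, ρ.hasCompactSupport_normed,
    fun _ _ => trivial⟩
  have hP : tsupport P ⊆ U := by
    change tsupport (ρ.normed volume) ⊆ U
    rw [ρ.tsupport_normed_eq]
    exact (Metric.closedBall_subset_ball (show r / 2 < r by linarith)).trans hrU
  have hP1 : ∫ x, P x = 1 := ρ.integral_normed
  have hlim : Tendsto (fun ε => v ε z) toZero (𝓝 (T P)) := by
    have := (hT P).sub (h1 P hP)
    simpa [hP1] using this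
  -- By uniqueness of limits `T` is the constant `T P` on `U`, so `z` is off the singular support
  -- and the value there is this constant.
  have hTU : ∀ ψ : PlaneTest, tsupport ψ ⊆ U → T ψ = ∫ x, T P * ψ x := fun ψ hψ => by
    have h2 := (h1 ψ hψ).add (hlim.mul_const (∫ x, ψ x))
    simp only [sub_add_cancel, zero_add] at h2
    rw [integral_const_mul]
    exact tendsto_nhds_unique (hT ψ) h2
  rw [offSingSupp_eq hU hTU hz]
  exact hlim

/-- Each line x = const meets the characteristics through `P` in countably many points. -/
lemma ae_notMem_of_countable {P : Set ℝ} (hP : P.Countable) :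
    ∀ᵐ z : ℝ × ℝ, z.1 - z.2 ∉ P ∧ z.1 + z.2 ∉ P := by
  have h1 : MeasurableSet {z : ℝ × ℝ | z.1 - z.2 ∉ P ∧ z.1 + z.2 ∉ P} :=
    ((measurable_fst.sub measurable_snd) hP.measurableSet.compl).inter
      ((measurable_fst.add measurable_snd) hP.measurableSet.compl)
  rw [Measure.volume_eq_prod, Measure.ae_prod_iff_ae_ae h1]
  refine Eventually.of_forall fun x => ?_
  have h2 : {t : ℝ | x - t ∈ P}.Countable := hP.preimage sub_right_injective
  have h3 : {t : ℝ | x + t ∈ P}.Countable := hP.preimage (add_right_injective x)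
  filter_upwards [h2.ae_notMem volume, h3.ae_notMem volume] with t ht ht'
  exact ⟨ht, ht'⟩

/-- A subspace of the line is separable, and a separable discrete space is countable. -/
lemma countable_of_isDiscrete {P : Set ℝ} (hP : IsDiscrete P) : P.Countable := by
  have := hP.to_subtype
  exact Set.countable_coe_iff.mp (TopologicalSpace.separableSpace_iff_countable.mp inferInstance)

/-- The linear waves converge almost everywhere. -/
lemma ae_tendsto_wave (φ : 𝓢(ℝ, ℝ)) (χ : LineTest) (hφ : ∫ x, φ x = 1) (hχ : χ 0 = 1)
    {a b : 𝓓'((⊤ : Opens ℝ), ℝ)} (ha : IsDiscrete (Distribution.dsupport a))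
    (hb : IsDiscrete (Distribution.dsupport b)) :
    ∀ᵐ z, Tendsto (fun ε => wave φ χ a b ε z) toZero (𝓝 (offSingSupp (dAlembert a b) z)) := by
  filter_upwards [ae_notMem_of_countable
    ((countable_of_isDiscrete ha).union (countable_of_isDiscrete hb))] with z hz
  obtain ⟨U, hU, hzU, hc⟩ := wave_locally_constant φ χ a b hz.1 hz.2
  exact tendsto_offSingSupp (continuous_wave φ χ a b) (tendsto_integral_wave φ χ hφ hχ a b)
    hU hzU hc


/-! ### Convergence of the nonlinear part -/

lemma IsNull.eventually_le {E : Type*} [NormedAddCommGroup E] [NormedSpace ℝ E]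
    {u : Param → E → ℝ} (hu : IsNull u) {K : Set E} (hK : IsCompact K) {δ : ℝ} (hδ : 0 < δ) :
    ∀ᶠ ε in toZero, ∀ x ∈ K, |u ε x| ≤ δ := by
  obtain ⟨C, hC⟩ := hu.2 K hK 0 1
  have hlim : Tendsto (fun ε : Param => C * (ε : ℝ)) toZero (𝓝 0) := by
    simpa using tendsto_param.const_mul C
  filter_upwards [hC, hlim.eventually (eventually_le_nhds hδ)] with ε h1 h2 x hx
  have := h1 x hx
  rw [norm_iteratedFDeriv_zero, pow_one] at this
  exact this.trans h2

lemma abs_freeWave_le {α β : ℝ → ℝ} {T δ : ℝ} {z : ℝ × ℝ} (hz : z ∈ region T)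
    (hα : ∀ x ∈ Set.Icc (-T) T, |α x| ≤ δ) (hβ : ∀ x ∈ Set.Icc (-T) T, |β x| ≤ δ) :
    |freeWave α β z| ≤ δ * (1 + T) := by
  have hz1 := hz.1
  have hz2 := hz.2
  have h1 := neg_abs_le z.1
  have h2 := le_abs_self z.1
  have m1 : z.1 - z.2 ∈ Set.Icc (-T) T := ⟨by linarith, by linarith⟩
  have m2 : z.1 + z.2 ∈ Set.Icc (-T) T := ⟨by linarith, by linarith⟩
  have hδ : 0 ≤ δ := (abs_nonneg _).trans (hα _ m1)
  have hI : |∫ y in (z.1 - z.2)..(z.1 + z.2), β y| ≤ δ * |z.1 + z.2 - (z.1 - z.2)| := by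
    refine intervalIntegral.norm_integral_le_of_norm_le_const (f := β) fun s hs => hβ s ?_
    rw [Set.uIoc_of_le (by linarith)] at hs
    exact ⟨by linarith [hs.1, m1.1], by linarith [hs.2, m2.2]⟩
  rw [show z.1 + z.2 - (z.1 - z.2) = 2 * z.2 by ring,
    abs_of_pos (show 0 < 2 * z.2 by linarith)] at hI
  have hzT : δ * z.2 ≤ δ * T := by
    gcongr
    linarith [abs_nonneg z.1]
  have n1 := abs_le.mp (hα _ m1)
  have n2 := abs_le.mp (hα _ m2)
  have n3 := abs_le.mp hI
  rw [freeWave, abs_le]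
  constructor <;> linarith [n1.1, n1.2, n2.1, n2.2, n3.1, n3.2]

section Upper

variable {f : ℝ → ℝ} {α β : Param → ℝ → ℝ} {r : Param → ℝ × ℝ → ℝ}

/-- Duhamel's formula is exact for `r ε`, so the residual is the free wave of the error in the data
plus the cone integral of the error in the equation. Both are uniformly small on a bounded region.
-/
lemma upper_residual (hf : Continuous f) (hβ : ∀ ε, Continuous (β ε))
    (hr : ∀ ε, ContDiff ℝ ∞ (r ε))
    (h1 : ∀ K, IsCompact K → ∀ δ > 0, ∀ᶠ ε in toZero, ∀ x ∈ K, |r ε (x, 0) - α ε x| ≤ δ)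
    (h2 : ∀ K, IsCompact K → ∀ δ > 0, ∀ᶠ ε in toZero, ∀ x ∈ K,
      |fderiv ℝ (r ε) (x, 0) (0, 1) - β ε x| ≤ δ)
    (h3 : ∀ K, IsCompact K → ∀ δ > 0, ∀ᶠ ε in toZero, ∀ z ∈ K, |box (r ε) z - f (r ε z)| ≤ δ)
    (T : ℝ) {δ : ℝ} (hδ : 0 < δ) : ∀ᶠ ε in toZero, ∀ z ∈ region T,
      |(r ε z - freeWave (α ε) (β ε) z) - (∫ y in cone z, f (r ε y)) / 2| ≤ δ := by
  set A : ℝ := 1 + |T| + volume.real (region T)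
  have hA : 0 < A := by positivity
  have hδA : 0 < δ / A := by positivity
  filter_upwards [h1 _ (isCompact_Icc (a := -T) (b := T)) _ hδA,
    h2 _ (isCompact_Icc (a := -T) (b := T)) _ hδA,
    h3 _ (isCompact_Icc.prod isCompact_Icc : IsCompact (Set.Icc (-T) T ×ˢ Set.Icc 0 T)) _ hδA]
    with ε k1 k2 k3 z hz
  have hdt : Continuous fun x : ℝ => fderiv ℝ (r ε) (x, 0) (0, 1) :=
    (contDiff_dir (hr ε) _).continuous.comp (continuous_id.prodMk continuous_const)
  have i1 := integrableOn_cone (contDiff_box (hr ε)).continuous z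
  have i2 : IntegrableOn (fun y => f (r ε y)) (cone z) :=
    integrableOn_cone (hf.comp (hr ε).continuous) z
  have e : (r ε z - freeWave (α ε) (β ε) z) - (∫ y in cone z, f (r ε y)) / 2 =
      freeWave (fun x => r ε (x, 0) - α ε x)
        (fun x => fderiv ℝ (r ε) (x, 0) (0, 1) - β ε x) z +
        (∫ y in cone z, (box (r ε) y - f (r ε y))) / 2 := by
    rw [← freeWave_sub hdt (hβ ε), integral_sub i1 i2, duhamel (hr ε) z hz.1.le]
    ring
  have b1 := abs_freeWave_le hz k1 k2
  have hfin := volume_region_lt_top T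
  have b2 : |∫ y in cone z, (box (r ε) y - f (r ε y))| ≤ δ / A * volume.real (region T) := by
    rw [← Real.norm_eq_abs]
    refine (norm_setIntegral_le_of_norm_le_const
      ((measure_mono (cone_subset_region hz)).trans_lt hfin)
      fun y hy => k3 y (region_subset T (cone_subset_region hz hy))).trans ?_
    exact mul_le_mul_of_nonneg_left (measureReal_mono (cone_subset_region hz) hfin.ne) hδA.le
  rw [e]
  refine (abs_add_le _ _).trans ?_
  rw [abs_div, abs_two]
  have h4 : δ / A * (1 + T) ≤ δ / A * (1 + |T|) := by
    gcongr
    exact le_abs_self T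
  have h5 : 0 ≤ δ / A * volume.real (region T) := by positivity
  calc _ ≤ δ / A * (1 + |T|) + δ / A * volume.real (region T) := by linarith
    _ = δ := by
      rw [← mul_add]
      exact div_mul_cancel₀ δ hA.ne'

/-- The stability result applied to W = r − v, for which f(v + W) is f(r). Measurability of `V` is
inherited from the almost everywhere limit. -/
lemma upper_limit {L : NNReal} (hL : LipschitzWith L f) {M : ℝ} (hM : ∀ y, |f y| ≤ M)
    (hα : ∀ ε, Continuous (α ε)) (hβ : ∀ ε, Continuous (β ε))
    (hr : ∀ ε, ContDiff ℝ ∞ (r ε))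
    (h1 : ∀ K, IsCompact K → ∀ δ > 0, ∀ᶠ ε in toZero, ∀ x ∈ K, |r ε (x, 0) - α ε x| ≤ δ)
    (h2 : ∀ K, IsCompact K → ∀ δ > 0, ∀ᶠ ε in toZero, ∀ x ∈ K,
      |fderiv ℝ (r ε) (x, 0) (0, 1) - β ε x| ≤ δ)
    (h3 : ∀ K, IsCompact K → ∀ δ > 0, ∀ᶠ ε in toZero, ∀ z ∈ K, |box (r ε) z - f (r ε z)| ≤ δ)
    {V w : ℝ × ℝ → ℝ} (hw : Continuous w)
    (hlim : ∀ᵐ z, Tendsto (fun ε => freeWave (α ε) (β ε) z) toZero (𝓝 (V z)))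
    (hwF : IsUpperWeakSolution w fun z => f (V z + w z)) (T : ℝ) {δ : ℝ} (hδ : 0 < δ) :
    ∀ᶠ ε in toZero, ∀ z ∈ region T, |r ε z - freeWave (α ε) (β ε) z - w z| ≤ δ := by
  have hv : ∀ ε, Continuous (freeWave (α ε) (β ε)) := fun ε => continuous_freeWave (hα ε) (hβ ε)
  have hV : AEStronglyMeasurable V volume :=
    aestronglyMeasurable_of_tendsto_ae toZero (fun ε => (hv ε).aestronglyMeasurable) hlim
  refine integral_equation_stable hL hM hV hw hv (fun ε => (hr ε).continuous.sub (hv ε)) hlim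
    (hwF.duhamel hw (hL.continuous.comp_aestronglyMeasurable (hV.add hw.aestronglyMeasurable))
      fun _ => hM _) (fun δ hδ => ?_) hδ
  simpa only [Pi.sub_apply, add_sub_cancel] using upper_residual hL.continuous hβ hr h1 h2 h3 T hδ

end Upper

lemma ofFun_apply {w : ℝ × ℝ → ℝ} (hw : Continuous w) (ψ : PlaneTest) :
    ofFun w ψ = ∫ z, w z * ψ z := by
  have h := TestFunction.integralAgainstBilinCLM_eq_integral (B := ContinuousLinearMap.mul ℝ ℝ)
    (μ := (volume : Measure (ℝ × ℝ))) (φ := w)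
    (hw.locallyIntegrable.locallyIntegrableOn ((⊤ : Opens (ℝ × ℝ)) : Set (ℝ × ℝ))) (f := ψ)
  refine Eq.trans h ?_
  congr 1
  ext z
  exact mul_comm _ _

lemma ae_time_ne_zero : ∀ᵐ z : ℝ × ℝ, z.2 ≠ 0 :=
  (Measure.quasiMeasurePreserving_snd (μ := (volume : Measure ℝ)) (ν := (volume : Measure ℝ))).ae
    ((Set.countable_singleton (0 : ℝ)).ae_notMem volume)

/-- Locally uniform convergence in both half-planes implies convergence in the sense of
distributions. -/
lemma tendsto_integral_of_region {W : Param → ℝ × ℝ → ℝ} {w : ℝ × ℝ → ℝ}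
    (hW : ∀ ε, Continuous (W ε)) (hw : Continuous w)
    (h1 : ∀ T, ∀ δ > 0, ∀ᶠ ε in toZero, ∀ z ∈ region T, |W ε z - w z| ≤ δ)
    (h2 : ∀ T, ∀ δ > 0, ∀ᶠ ε in toZero, ∀ z ∈ region T, |W ε (timeReflect 0 z) - w (timeReflect 0 z)| ≤ δ)
    (ψ : PlaneTest) :
    Tendsto (fun ε => ∫ z, W ε z * ψ z) toZero (𝓝 (∫ z, w z * ψ z)) := by
  obtain ⟨R, hR⟩ := exists_ball ψ
  have hψi : Integrable fun x => |ψ x| :=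
    (ψ.continuous.integrable_of_hasCompactSupport ψ.hasCompactSupport).abs
  set I := ∫ x, |ψ x|
  have hI : 0 ≤ I := integral_nonneg fun _ => abs_nonneg _
  rw [Metric.tendsto_nhds]
  intro δ hδ
  have hδ' : 0 < δ / (2 * (I + 1)) := by positivity
  -- On the support of `ψ`, |x| + |t| ≤ 2R, strictly below the size of the region.
  filter_upwards [h1 (2 * R + 1) _ hδ', h2 (2 * R + 1) _ hδ'] with ε k1 k2
  rw [Real.dist_eq, ← integral_sub (integrable_mul_planeTest (hW ε) ψ)
    (integrable_mul_planeTest hw ψ)]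
  have h3 : ‖∫ x, (W ε x * ψ x - w x * ψ x)‖ ≤ ∫ x, δ / (2 * (I + 1)) * |ψ x| := by
    refine norm_integral_le_of_norm_le (hψi.const_mul _) ?_
    filter_upwards [ae_time_ne_zero] with z hz
    rw [← sub_mul, norm_mul, Real.norm_eq_abs, Real.norm_eq_abs]
    by_cases h0 : ψ z = 0
    · simp [h0]
    · have h4 := hR (subset_tsupport _ h0)
      rw [mem_closedBall_zero_iff, Prod.norm_def] at h4
      have h5 : |z.1| ≤ R := (le_max_left _ _).trans h4
      have h6 : |z.2| ≤ R := (le_max_right _ _).trans h4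
      gcongr
      rcases lt_or_gt_of_ne hz with hz | hz
      · have h7 : timeReflect 0 (timeReflect 0 z) = z := by simp
        have := k2 (timeReflect 0 z) ⟨by simpa using hz, by
          rw [abs_of_neg hz] at h6
          simp only [timeReflect_apply]
          linarith⟩
        rwa [h7] at this
      · exact k1 z ⟨hz, by
          rw [abs_of_pos hz] at h6
          linarith⟩
  rw [integral_const_mul] at h3
  refine h3.trans_lt ?_
  rw [div_mul_eq_mul_div, div_lt_iff₀ (by positivity)]
  change δ * I < _
  nlinarith

lemma isNull_of_mk_eq {E : Type*} [NormedAddCommGroup E] [NormedSpace ℝ E] {r s : moderate E}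
    (h : Colombeau.mk r = Colombeau.mk s) :
    IsNull ((r : Param → E → ℝ) - (s : Param → E → ℝ)) := Ideal.Quotient.eq.mp h

end DeltaWave

end

/-! ### Proof of the proposition: assembling the two half-planes and the linear part. -/

theorem mainTheorem3
    -- the mollifier and the cut-off function that define the embedding of distributions
    (φ : 𝓢(ℝ, ℝ)) (hφ_int : ∫ x, φ x = 1) (hφ_mom : ∀ k : ℕ, 1 ≤ k → ∫ x, x ^ k * φ x = 0)
    (χ : 𝓓((⊤ : Opens ℝ), ℝ)) (hχ : ∀ᶠ x in 𝓝 (0 : ℝ), χ x = 1)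
    -- the nonlinearity
    (f : ℝ → ℝ) (hf : DeltaWave.IsSlowlyGrowing f) (hf_bdd : ∃ M : ℝ, ∀ y, |f y| ≤ M)
    (hf_lip : ∃ L : NNReal, LipschitzWith L f)
    -- the initial data
    (a b : 𝓓'((⊤ : Opens ℝ), ℝ)) (ha : IsDiscrete (Distribution.dsupport a))
    (hb : IsDiscrete (Distribution.dsupport b))
    -- the continuous function `w`
    (w : ℝ × ℝ → ℝ) (hw_cont : Continuous w)
    (hw : DeltaWave.IsWeakSolution w fun z =>
      f (DeltaWave.offSingSupp (DeltaWave.dAlembert a b) z + w z))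
    -- the Colombeau solution
    (u : DeltaWave.Colombeau (ℝ × ℝ))
    (hu : DeltaWave.IsColombeauSolution f hf (DeltaWave.embed φ χ a) (DeltaWave.embed φ χ b) u) :
    u.IsAssociated (DeltaWave.dAlembert a b + DeltaWave.ofFun w) := by
  open DeltaWave in
  intro R hR ψ
  subst hR
  obtain ⟨M, hM⟩ := hf_bdd
  obtain ⟨L, hL⟩ := hf_lip
  have hχ0 : χ 0 = 1 := hχ.self_of_nhds
  set r : Param → ℝ × ℝ → ℝ := (R : Param → ℝ × ℝ → ℝ) with hr_def
  have hr : ∀ ε, ContDiff ℝ ∞ (r ε) := R.2.1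
  obtain ⟨hu1, hu2, hu3⟩ := hu
  have n1 : IsNull fun ε x => r ε (x, 0) - conv a (cutMollifier φ χ ε) x := isNull_of_mk_eq hu2
  have n2 : IsNull fun ε x => fderiv ℝ (r ε) (x, 0) (0, 1) - conv b (cutMollifier φ χ ε) x :=
    isNull_of_mk_eq hu3
  let rtt : moderate (ℝ × ℝ) :=
    ⟨fun ε z => fderiv ℝ (fun y => fderiv ℝ (r ε) y (0, 1)) z (0, 1),
      (IsModerate.pderiv R.2 (0, 1)).pderiv (0, 1)⟩
  let rxx : moderate (ℝ × ℝ) :=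
    ⟨fun ε z => fderiv ℝ (fun y => fderiv ℝ (r ε) y (1, 0)) z (1, 0),
      (IsModerate.pderiv R.2 (1, 0)).pderiv (1, 0)⟩
  let rf : moderate (ℝ × ℝ) := ⟨fun ε z => f (r ε z), IsModerate.superpos hf R.2⟩
  -- The equation between classes says that the representative solves the wave equation up to a null
  -- family.
  have n3 : IsNull fun ε z => box (r ε) z - f (r ε z) :=
    isNull_of_mk_eq (r := rtt - rxx) (s := rf)
      ((map_sub (Ideal.Quotient.mk (null (ℝ × ℝ))) rtt rxx).trans hu1)
  have hα : ∀ ε, Continuous (conv a (cutMollifier φ χ ε)) := fun ε => (contDiff_conv a _).continuous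
  have hβ : ∀ ε, Continuous (conv b (cutMollifier φ χ ε)) := fun ε => (contDiff_conv b _).continuous
  have hlim := ae_tendsto_wave φ χ hφ_int hχ0 ha hb
  have up := fun T δ (hδ : 0 < δ) => upper_limit (T := T) hL hM hα hβ hr
    (fun K hK δ hδ => n1.eventually_le hK hδ) (fun K hK δ hδ => n2.eventually_le hK hδ)
    (fun K hK δ hδ => n3.eventually_le hK hδ) hw_cont hlim hw.upper hδ
  -- The past is the future of the time-reflected problem, with the initial velocity negated.
  have lo : ∀ T, ∀ δ > 0, ∀ᶠ ε in toZero, ∀ z ∈ region T,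
      |r ε (timeReflect 0 z) - wave φ χ a b ε (timeReflect 0 z) - w (timeReflect 0 z)| ≤ δ := fun T δ hδ => by
    have := upper_limit (T := T) (f := f) (α := fun ε => conv a (cutMollifier φ χ ε))
      (β := fun ε y => -conv b (cutMollifier φ χ ε) y) (r := fun ε z => r ε (timeReflect 0 z)) hL hM hα
      (fun ε => (hβ ε).neg) (fun ε => (hr ε).comp (contDiff_timeReflect 0))
      (fun K hK δ hδ => by
        simpa only [timeReflect_apply, sub_zero] using n1.eventually_le hK hδ)
      (fun K hK δ hδ => by
        filter_upwards [n2.eventually_le hK hδ] with ε hε x hx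
        have e : ((0 : ℝ), -(1 : ℝ)) = -(0, 1) := by simp
        rw [fderiv_comp_timeReflect (hr ε), timeReflect_apply, e, map_neg, sub_zero, ← neg_sub', abs_neg]
        exact hε x hx)
      (fun K hK δ hδ => by
        filter_upwards [n3.eventually_le (hK.image (timeReflect 0).continuous) hδ] with ε hε z hz
        rw [box_comp_timeReflect (hr ε)]
        exact hε _ ⟨z, hz, rfl⟩)
      (w := fun z => w (timeReflect 0 z)) (V := fun z => offSingSupp (dAlembert a b) (timeReflect 0 z))
      (hw_cont.comp (timeReflect 0).continuous)
      (by
        filter_upwards [(measurePreserving_timeReflect 0).quasiMeasurePreserving.ae hlim] with z hz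
        simpa only [freeWave_timeReflect, wave] using hz)
      hw.lower hδ
    simpa only [freeWave_timeReflect, wave] using this
  have hW : ∀ ε, Continuous fun z => r ε z - wave φ χ a b ε z := fun ε =>
    (hr ε).continuous.sub (continuous_wave φ χ a b ε)
  have h1 := tendsto_integral_of_region hW hw_cont up lo ψ
  have h2 := (tendsto_integral_wave φ χ hφ_int hχ0 a b ψ).add h1
  rw [← ofFun_apply hw_cont] at h2
  -- Recombines v_ε + (r_ε − v_ε) = r_ε under the integral.
  refine h2.congr fun ε => ?_
  rw [← integral_add (integrable_mul_planeTest (continuous_wave φ χ a b ε) ψ)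
    (integrable_mul_planeTest (hW ε) ψ)]
  congr 1
  ext z
  ring
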